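/- Identify $\mathbb R^2$ with $\mathbb C$. Let $\Omega\subset\mathbb R^2$ be a bounded, simply connected domain of class $C^{1,1}$, let $\nu$ be its outer unit normal, $\tau=i\nu$ its unit tangent field, and let $g:\partial\Omega\to\mathbb R$ be any lifting of $\tau$, i.e. $e^{ig}=\tau=i\nu$ ($\mathcal H^1$-a.e.) on $\partial\Omega$. Let $u\in H^1(\Omega;\mathbb S^1)$, i.e. $u\in H^1(\Omega;\mathbb R^2)$ and $|u|=1$ a.e. in $\Omega$. Then there exists a lifting $\varphi\in H^1(\Omega;\mathbb R)$ with $u=e^{i\varphi}$ a.e. in $\Omega$, and $\varphi$ is unique up to an additive constant in $2\pi\mathbb Z$: the liftings of $u$ in $H^1(\Omega;\mathbb R)$ are exactly the functions $\varphi+2\pi k$, $k\in\mathbb Z$. Furthermore, for every constant vector $h_{ext}\in\mathbb R^2$, all $\varepsilon>0$ and $\eta>0$, and every such lifting $\varphi$, the energy $$E_{\varepsilon,\eta}(u;h_{ext})=\int_\Omega|\nabla u|^2\,dx+\frac1{\eta^2}\int_\Omega(1-|u|^2)^2\,dx+\frac1{2\pi\varepsilon}\int_{\partial\Omega}(u\cdot\nu)^2\,d\mathcal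 H^1-\int_\Omega h_{ext}\cdot u\,dx$$ equals $$G_\varepsilon(\varphi;h_{ext})=\int_\Omega|\nabla\varphi|^2\,dx+\frac1{2\pi\varepsilon}\int_{\partial\Omega}\sin^2(\varphi-g)\,d\mathcal H^1-\int_\Omega h_{ext}\cdot e^{i\varphi}\,dx .$$ In the boundary integrals $u$ and $\varphi$ stand for their traces on $\partial\Omega$, which exist at $\mathcal H^1$-a.e. point of $\partial\Omega$, and all the integrals above converge absolutely. -/

import Mathlib

open MeasureTheory Filter Topology Set
open scoped ContDiff ENNReal

/-! The plane is `ℂ`, with its Euclidean distance, its Lebesgue measure `volume`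
and the one-dimensional Hausdorff measure `μH[1]`. -/

namespace Micromagnetics

noncomputable section

/-- A planar open set of class `C^{1,1}`: near each of its boundary points it is, up to the
rotation by a unit number `e`, the part of a disk above the graph of a `C¹` function with
Lipschitz derivative. -/
def IsC11 (Ω : Set ℂ) : Prop :=
  IsOpen Ω ∧ ∀ p ∈ frontier Ω, ∃ r : ℝ, 0 < r ∧ ∃ e : ℂ, ‖e‖ = 1 ∧ ∃ γ : ℝ → ℝ,
    ContDiff ℝ 1 γ ∧ (∃ L, LipschitzWith L (deriv γ)) ∧
      Ω ∩ Metric.ball p r =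
        {z ∈ Metric.ball p r | γ ((starRingEnd ℂ e * z).re) < (starRingEnd ℂ e * z).im}

/-- Bounded simply connected domains of class `C^{1,1}`. -/
structure IsBddSimplyConnectedC11 (Ω : Set ℂ) : Prop where
  isC11 : IsC11 Ω
  bounded : Bornology.IsBounded Ω
  simplyConnected : IsSimplyConnected Ω

/-- `n` is the outer unit normal of `Ω` at `p`: starting from `p`, all directions `v` with
`v · n > 0` leave `Ω` and all directions with `v · n < 0` enter `Ω`. -/
def IsOuterUnitNormal (Ω : Set ℂ) (p n : ℂ) : Prop :=
  ‖n‖ = 1 ∧ ∀ v : ℂ,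
    (0 < inner ℝ v n → ∀ᶠ t : ℝ in 𝓝[>] 0, p + t * v ∉ Ω) ∧
    (inner ℝ v n < 0 → ∀ᶠ t : ℝ in 𝓝[>] 0, p + t * v ∈ Ω)

/-- The outer unit normal `ν` of `Ω` (such a vector is unique when it exists). -/
def outerNormal (Ω : Set ℂ) (p : ℂ) : ℂ := Classical.epsilon (IsOuterUnitNormal Ω p)

section Sobolev

variable {E : Type*} [NormedAddCommGroup E] [NormedSpace ℝ E]

/-- `f'` is the weak derivative of `f` in the direction `v` in the open set `Ω`. -/
def IsWeakDeriv (Ω : Set ℂ) (v : ℂ) (f f' : ℂ → E) : Prop :=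
  LocallyIntegrableOn f Ω ∧ LocallyIntegrableOn f' Ω ∧
    ∀ ψ : ℂ → ℝ, ContDiff ℝ ∞ ψ → HasCompactSupport ψ → tsupport ψ ⊆ Ω →
      ∫ x in Ω, fderiv ℝ ψ x v • f x = - ∫ x in Ω, ψ x • f' x

/-- The Sobolev space `H¹(Ω; E)`. -/
def MemH1 (Ω : Set ℂ) (f : ℂ → E) : Prop :=
  MemLp f 2 (volume.restrict Ω) ∧
    (∃ f₁, IsWeakDeriv Ω 1 f f₁ ∧ MemLp f₁ 2 (volume.restrict Ω)) ∧
    (∃ f₂, IsWeakDeriv Ω Complex.I f f₂ ∧ MemLp f₂ 2 (volume.restrict Ω))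

/-- A representative of the weak derivative of `f` in the direction `v`
(unique almost everywhere in `Ω` when it exists). -/
def weakDeriv (Ω : Set ℂ) (v : ℂ) (f : ℂ → E) : ℂ → E :=
  Classical.epsilon (IsWeakDeriv Ω v f)

/-- `|∇f|² = |∂₁f|² + |∂₂f|²`. -/
def gradSq (Ω : Set ℂ) (f : ℂ → E) (x : ℂ) : ℝ :=
  ‖weakDeriv Ω 1 f x‖ ^ 2 + ‖weakDeriv Ω Complex.I f x‖ ^ 2

/-- `c` is the boundary trace of `f` at the point `p ∈ ∂Ω`:
the mean of `|f - c|` over `Ω ∩ B(p, r)` tends to `0` as `r → 0`. -/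
def HasTraceAt (Ω : Set ℂ) (f : ℂ → E) (p : ℂ) (c : E) : Prop :=
  Tendsto (fun r : ℝ => ⨍⁻ y in Ω ∩ Metric.ball p r, ‖f y - c‖ₑ ∂volume) (𝓝[>] 0) (𝓝 0)

/-- The boundary trace of `f`. For `f ∈ H¹(Ω)` on a bounded domain with Lipschitz boundary, it
exists at `μH[1]`-almost every point of `∂Ω` and is the value of the usual trace operator
(the continuous extension to `H¹(Ω)` of the restriction of smooth functions to `∂Ω`). -/
def trace (Ω : Set ℂ) (f : ℂ → E) (p : ℂ) : E :=
  Classical.epsilon (HasTraceAt Ω f p)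

end Sobolev

/-- Arc length on `∂Ω`. -/
def arcLength (Ω : Set ℂ) : Measure ℂ := μH[1].restrict (frontier Ω)

/-- `E_{ε,η}(u; h) = ∫_Ω |∇u|² + η⁻² ∫_Ω (1 - |u|²)² + (2πε)⁻¹ ∫_{∂Ω} (u · ν)² - ∫_Ω h · u`. -/
def vortexEnergy (Ω : Set ℂ) (ε η : ℝ) (h : ℂ) (u : ℂ → ℂ) : ℝ :=
  (∫ x in Ω, gradSq Ω u x) + 1 / η ^ 2 * (∫ x in Ω, (1 - ‖u x‖ ^ 2) ^ 2)
    + 1 / (2 * Real.pi * ε) * (∫ x, (inner ℝ (trace Ω u x) (outerNormal Ω x)) ^ 2 ∂arcLength Ω)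
    - ∫ x in Ω, inner ℝ h (u x)

/-- `G_ε(φ; h) = ∫_Ω |∇φ|² + (2πε)⁻¹ ∫_{∂Ω} sin²(φ - g) - ∫_Ω h · e^{iφ}`. -/
def liftedEnergy (Ω : Set ℂ) (g : ℂ → ℝ) (ε : ℝ) (h : ℂ) (φ : ℂ → ℝ) : ℝ :=
  (∫ x in Ω, gradSq Ω φ x)
    + 1 / (2 * Real.pi * ε) * (∫ x, Real.sin (trace Ω φ x - g x) ^ 2 ∂arcLength Ω)
    - ∫ x in Ω, inner ℝ h (Complex.exp (Complex.I * φ x))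

/-- The traces and all the integrals in `vortexEnergy` make sense. -/
def VortexEnergyDefined (Ω : Set ℂ) (h : ℂ) (u : ℂ → ℂ) : Prop :=
  (∀ᵐ x ∂arcLength Ω, HasTraceAt Ω u x (trace Ω u x)) ∧
  IntegrableOn (gradSq Ω u) Ω ∧ IntegrableOn (fun x => (1 - ‖u x‖ ^ 2) ^ 2) Ω ∧
  Integrable (fun x => (inner ℝ (trace Ω u x) (outerNormal Ω x)) ^ 2) (arcLength Ω) ∧
  IntegrableOn (fun x => inner ℝ h (u x)) Ω

/-- The traces and all the integrals in `liftedEnergy` make sense. -/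
def LiftedEnergyDefined (Ω : Set ℂ) (g : ℂ → ℝ) (h : ℂ) (φ : ℂ → ℝ) : Prop :=
  (∀ᵐ x ∂arcLength Ω, HasTraceAt Ω φ x (trace Ω φ x)) ∧
  IntegrableOn (gradSq Ω φ) Ω ∧
  Integrable (fun x => Real.sin (trace Ω φ x - g x) ^ 2) (arcLength Ω) ∧
  IntegrableOn (fun x => inner ℝ h (Complex.exp (Complex.I * φ x))) Ω

/-- `φ ∈ H¹(Ω; ℝ)` is a lifting of `u`, that is, `u = e^{iφ}` almost everywhere in `Ω`. -/
def IsH1Lifting (Ω : Set ℂ) (u : ℂ → ℂ) (φ : ℂ → ℝ) : Prop :=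
  MemH1 Ω φ ∧ ∀ᵐ x ∂volume.restrict Ω, u x = Complex.exp (Complex.I * φ x)

/-- `g` is a lifting of the unit tangent field: `e^{ig} = τ = iν` on `∂Ω`. -/
def IsTangentLifting (Ω : Set ℂ) (g : ℂ → ℝ) : Prop :=
  ∀ᵐ x ∂arcLength Ω, Complex.exp (Complex.I * g x) = Complex.I * outerNormal Ω x

end

end Micromagnetics

/-!
A unimodular `u` satisfies `u ū = 1`, so its weak derivatives are tangent to the circle:
`∂_v u = i u Im (ū ∂_v u)` (`IsWeakDeriv.eq_of_norm_eq_one`). A lifting `u = e^{iφ}` must therefore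
have gradient `F = Im (ū ∇u)` (`ae_eq_of_eq_exp`), which determines it up to a constant on a
connected set (`exists_ae_eq_const`), and the constant lies in `2πℤ`.

*Local existence.* For a smooth `g`, Green's formula (`green_angular_form`) expresses the
circulation of `Im (ḡ ∇g)` along a rectangle as the integral of `2 ∂₁g ∧ ∂₂g`. When mollifications
of `u` converge to `u` with their gradients in `L²`, this integrand converges in `L¹` to
`2 ∂₁u ∧ ∂₂u`, which vanishes because both derivatives of `u` are multiples of `i u`. Hence the
circulation of `F` vanishes along almost every rectangle, and `F` is a gradient on every rectangle
(`exists_potential_of_tendsto`, `exists_local_potential`). If `∇φ = F`, then `u e^{-iφ}` has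
vanishing gradient; it is a constant of modulus one, which can be absorbed into `φ`
(`exists_local_lifting`).

*Gluing.* Local liftings differ by constants in `2πℤ`. So do their averages around a point `y`,
with weights depending continuously on `y`; the exponentials `e^{i A}` of the averages `A` are
therefore independent of the lifting, and define a continuous circle-valued function on `Ω`. As `Ω`
is simply connected, this function has a continuous logarithm `iθ`. Close to any point, `θ` differs
from the average of the local lifting by a constant in `2πℤ`, and subtracting that constant makes
the local liftings agree (`exists_lifting_loc`).

*Behaviour at the boundary.* In coordinates in which `Ω` lies above the graph of a `C¹` function,
a weakly differentiable function is an indefinite integral of its derivative on almost every line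
transversal to the boundary, up to the boundary (`IsBoundaryChart.ae_line`). Integrating along these
lines from the interior shows that a locally square integrable function with square integrable
gradient is square integrable (`IsC11.memLp_two`), so the lifting belongs to `H¹(Ω)`. Its limits
along these lines are traces at almost every boundary point
(`IsBoundaryChart.ae_exists_hasTraceAt`). Since `t ↦ e^{it}` is `1`-Lipschitz, the trace of `u` is
`e^{iφ}` for the trace of `φ` (`IsH1Lifting.trace_eq`), and it exists wherever that of `φ` does.

*Energies.* `|∇u| = |∇φ|`, the penalization of `|u| ≠ 1` vanishes, and `ν = -i e^{ig}` gives
`(u · ν)² = sin² (φ - g)` on the boundary.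
-/

namespace Micromagnetics

/-! ### Mollification -/

section Mollification

open scoped Convolution
open ContinuousLinearMap (lsmul)

variable {E : Type*} [NormedAddCommGroup E] [NormedSpace ℝ E]

/-- A smooth bump function at the origin of the plane, with support of radius `1 / (n + 1)`. -/
noncomputable def bump (n : ℕ) : ContDiffBump (0 : ℂ) where
  rIn := 1 / (2 * (n + 1))
  rOut := 1 / (n + 1)
  rIn_pos := by positivity
  rIn_lt_rOut := by
    rw [div_lt_div_iff₀ (by positivity) (by positivity)]
    have : (0 : ℝ) ≤ n := n.cast_nonneg
    linarith

theorem bump_rOut (n : ℕ) : (bump n).rOut = 1 / ((n : ℝ) + 1) := rfl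

theorem tendsto_bump_rOut : Tendsto (fun n => (bump n).rOut) atTop (𝓝 0) := by
  simpa [bump_rOut] using tendsto_one_div_add_atTop_nhds_zero_nat (𝕜 := ℝ)

/-- The mollification of `g` at scale `1 / (n + 1)`. -/
noncomputable def moll (n : ℕ) (g : ℂ → E) : ℂ → E :=
  (bump n).normed volume ⋆[lsmul ℝ ℝ, volume] g

theorem moll_apply (n : ℕ) (g : ℂ → E) (x : ℂ) :
    moll n g x = ∫ t, (bump n).normed volume t • g (x - t) := rfl

theorem contDiff_moll (n : ℕ) {g : ℂ → E} (hg : LocallyIntegrable g) :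
    ContDiff ℝ ∞ (moll n g) := by
  unfold moll
  exact HasCompactSupport.contDiff_convolution_left (n := (⊤ : ℕ∞)) _
    (bump n).hasCompactSupport_normed (bump n).contDiff_normed hg

theorem ae_tendsto_moll [CompleteSpace E] {g : ℂ → E} (hg : LocallyIntegrable g) :
    ∀ᵐ x, Tendsto (fun n => moll n g x) atTop (𝓝 (g x)) := by
  refine ContDiffBump.ae_convolution_tendsto_right_of_locallyIntegrable (K := 2)
    tendsto_bump_rOut (Eventually.of_forall fun n => ?_) hg
  change 1 / ((n : ℝ) + 1) ≤ 2 * (1 / (2 * ((n : ℝ) + 1)))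
  field_simp
  rfl

theorem integrable_moll_integrand (n : ℕ) {g : ℂ → E} (hg : LocallyIntegrable g) (x : ℂ) :
    Integrable (fun t => (bump n).normed volume t • g (x - t)) :=
  (bump n).hasCompactSupport_normed.convolutionExists_left (lsmul ℝ ℝ)
    (bump n).continuous_normed hg x

theorem moll_sub (n : ℕ) {f g : ℂ → E} (hf : LocallyIntegrable f) (hg : LocallyIntegrable g)
    (x : ℂ) : moll n (f - g) x = moll n f x - moll n g x := by
  simp only [moll_apply, Pi.sub_apply, smul_sub]
  exact integral_sub (integrable_moll_integrand n hf x) (integrable_moll_integrand n hg x)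

theorem norm_moll_le (n : ℕ) {g : ℂ → E} {C : ℝ} (hC : ∀ᵐ x, ‖g x‖ ≤ C) (x : ℂ) :
    ‖moll n g x‖ ≤ C := by
  have h1 : ∫ t, (bump n).normed volume t * C = C := by
    rw [integral_mul_const, (bump n).integral_normed, one_mul]
  rw [moll_apply, ← h1]
  refine norm_integral_le_of_norm_le ((bump n).integrable_normed.mul_const _) ?_
  have h2 : ∀ᵐ t : ℂ, ‖g (x - t)‖ ≤ C :=
    (quasiMeasurePreserving_sub_left_of_right_invariant volume x).ae hC
  filter_upwards [h2] with t ht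
  rw [norm_smul, Real.norm_of_nonneg ((bump n).nonneg_normed t)]
  exact mul_le_mul_of_nonneg_left ht ((bump n).nonneg_normed t)

/-- The probability measure whose density is the `n`-th mollifier. -/
noncomputable def bumpMeasure (n : ℕ) : Measure ℂ :=
  volume.withDensity fun t => ENNReal.ofReal ((bump n).normed volume t)

instance (n : ℕ) : IsProbabilityMeasure (bumpMeasure n) := by
  refine ⟨?_⟩
  rw [bumpMeasure, withDensity_apply _ MeasurableSet.univ, Measure.restrict_univ,
    ← ofReal_integral_eq_lintegral_ofReal (bump n).integrable_normed
      (Eventually.of_forall (bump n).nonneg_normed), (bump n).integral_normed, ENNReal.ofReal_one]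

theorem enorm_moll_le (n : ℕ) (g : ℂ → E) (x : ℂ) :
    ‖moll n g x‖ₑ ≤ ∫⁻ t, ‖g (x - t)‖ₑ ∂bumpMeasure n := by
  rw [bumpMeasure, lintegral_withDensity_eq_lintegral_mul_non_measurable₀ _
    ((bump n).continuous_normed.measurable.ennreal_ofReal.aemeasurable)
    (Eventually.of_forall fun _ => ENNReal.ofReal_lt_top), moll_apply]
  refine (enorm_integral_le_lintegral_enorm _).trans (lintegral_mono fun t => ?_)
  simp only [Pi.mul_apply]
  rw [enorm_smul, Real.enorm_of_nonneg ((bump n).nonneg_normed t)]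

/-- Mollification does not increase `L^p` norms, by Jensen's inequality. -/
theorem eLpNorm_moll_le (n : ℕ) {g : ℂ → E} {p : ℝ≥0∞} (hp : 1 ≤ p) (hp' : p ≠ ⊤)
    (hg : AEStronglyMeasurable g) : eLpNorm (moll n g) p volume ≤ eLpNorm g p volume := by
  have hp0 : p ≠ 0 := (zero_lt_one.trans_le hp).ne'
  have hpr : 0 < p.toReal := ENNReal.toReal_pos hp0 hp'
  have hac : bumpMeasure n ≪ volume := withDensity_absolutelyContinuous _ _
  have hgx : ∀ x : ℂ, AEStronglyMeasurable (fun t => g (x - t)) (bumpMeasure n) := fun x =>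
    (hg.comp_quasiMeasurePreserving
      (quasiMeasurePreserving_sub_left_of_right_invariant volume x)).mono_ac hac
  rw [eLpNorm_eq_lintegral_rpow_enorm_toReal hp0 hp',
    eLpNorm_eq_lintegral_rpow_enorm_toReal hp0 hp']
  gcongr ?_ ^ _
  calc ∫⁻ x, ‖moll n g x‖ₑ ^ p.toReal
      ≤ ∫⁻ x, ∫⁻ t, ‖g (x - t)‖ₑ ^ p.toReal ∂bumpMeasure n := by
        refine lintegral_mono fun x => ?_
        have h := eLpNorm_le_eLpNorm_of_exponent_le hp (hgx x)
        rw [eLpNorm_one_eq_lintegral_enorm, eLpNorm_eq_lintegral_rpow_enorm_toReal hp0 hp'] at h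
        calc ‖moll n g x‖ₑ ^ p.toReal
            ≤ ((∫⁻ t, ‖g (x - t)‖ₑ ^ p.toReal ∂bumpMeasure n) ^ (1 / p.toReal)) ^ p.toReal := by
              gcongr
              exact (enorm_moll_le n g x).trans h
          _ = _ := by rw [← ENNReal.rpow_mul, one_div_mul_cancel hpr.ne', ENNReal.rpow_one]
    _ = ∫⁻ t, (∫⁻ x, ‖g (x - t)‖ₑ ^ p.toReal) ∂bumpMeasure n := by
        refine lintegral_lintegral_swap (μ := volume) (ν := bumpMeasure n) ?_
        have h1 : AEStronglyMeasurable (fun q : ℂ × ℂ => g (q.1 - q.2))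
            ((volume : Measure ℂ).prod (bumpMeasure n)) := by
          refine (hg.comp_quasiMeasurePreserving
            (quasiMeasurePreserving_sub_of_right_invariant volume volume)).mono_ac ?_
          exact Measure.AbsolutelyContinuous.prod Measure.AbsolutelyContinuous.rfl hac
        exact h1.enorm.pow_const _
    _ = ∫⁻ t, (∫⁻ x, ‖g x‖ₑ ^ p.toReal) ∂bumpMeasure n := by
        refine lintegral_congr fun t => ?_
        exact lintegral_sub_right_eq_self (fun x => ‖g x‖ₑ ^ p.toReal) t
    _ = ∫⁻ x, ‖g x‖ₑ ^ p.toReal := by simp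

theorem tendsto_eLpNorm_moll_sub [CompleteSpace E] {g : ℂ → E} {p : ℝ≥0∞} (hp : 1 ≤ p)
    (hp' : p ≠ ⊤) (hg : MemLp g p volume) :
    Tendsto (fun n => eLpNorm (moll n g - g) p volume) atTop (𝓝 0) := by
  have hp0 : p ≠ 0 := (zero_lt_one.trans_le hp).ne'
  rw [ENNReal.tendsto_nhds_zero]
  intro ε hε
  obtain ⟨δ, hδ0, hδ⟩ : ∃ δ : ℝ, 0 < δ ∧ ENNReal.ofReal δ ≤ ε / 3 := by
    obtain ⟨δ, hδ0, hδ⟩ := ENNReal.lt_iff_exists_nnreal_btwn.1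
      (ENNReal.div_pos hε.ne' (by norm_num : (3 : ℝ≥0∞) ≠ ⊤))
    refine ⟨δ, by exact_mod_cast hδ0, ?_⟩
    rw [ENNReal.ofReal_coe_nnreal]
    exact hδ.le
  obtain ⟨h, hhc, hhs, hgh⟩ := hg.exist_eLpNorm_sub_le hp' hp hδ0
  have hh : MemLp h p volume := hhs.continuous.memLp_of_hasCompactSupport hhc
  have hgl := hg.locallyIntegrable hp
  have hhl := hh.locallyIntegrable hp
  -- the mollifications of `h` converge uniformly, with supports in a fixed compact set
  have hh0 : Tendsto (fun n => eLpNorm (moll n h - h) p volume) atTop (𝓝 0) := by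
    set K := Metric.cthickening 1 (tsupport h) with hKdef
    have hK : IsCompact K := hhc.isCompact.cthickening
    have hKs : ∀ n, Function.support (moll n h - h) ⊆ K := by
      intro n x hx
      by_contra hxK
      have hball : ∀ y ∈ Metric.ball x (bump n).rOut, h y = 0 := by
        intro y hy
        by_contra hy0
        apply hxK
        refine Metric.mem_cthickening_of_dist_le x y 1 _ (subset_tsupport h hy0) ?_
        rw [Metric.mem_ball, bump_rOut] at hy
        rw [dist_comm]
        refine hy.le.trans ?_
        rw [div_le_one (by positivity)]
        linarith [(n.cast_nonneg : (0 : ℝ) ≤ n)]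
      have hx0 : h x = 0 := hball x (Metric.mem_ball_self (bump n).rOut_pos)
      have h2 : moll n h x = h x := ContDiffBump.normed_convolution_eq_right
        (fun y hy => (hball y hy).trans hx0.symm)
      simp [h2] at hx
    have huc : UniformContinuous h := hhc.uniformContinuous_of_continuous hhs.continuous
    rw [ENNReal.tendsto_nhds_zero]
    intro ε' hε'
    have hc : volume K ^ (p.toReal)⁻¹ ≠ ⊤ :=
      ENNReal.rpow_ne_top_of_nonneg (by positivity) hK.measure_lt_top.ne
    obtain ⟨η, hη0, hη⟩ : ∃ η : ℝ, 0 < η ∧ volume K ^ (p.toReal)⁻¹ * ENNReal.ofReal η ≤ ε' := by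
      have ht : Tendsto (fun η : ℝ => volume K ^ (p.toReal)⁻¹ * ENNReal.ofReal η) (𝓝[>] 0)
          (𝓝 0) := by
        have h1 := ENNReal.Tendsto.const_mul (a := volume K ^ (p.toReal)⁻¹)
          (ENNReal.tendsto_ofReal (tendsto_id (α := ℝ) (x := 𝓝 0))) (Or.inr hc)
        simp only [ENNReal.ofReal_zero, mul_zero, id] at h1
        exact h1.mono_left nhdsWithin_le_nhds
      obtain ⟨η, h1, h2⟩ := ((ENNReal.tendsto_nhds_zero.1 ht ε' hε').and
        self_mem_nhdsWithin).exists
      exact ⟨η, h2, h1⟩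
    obtain ⟨r, hr0, hr⟩ := Metric.uniformContinuous_iff.1 huc η hη0
    filter_upwards [tendsto_bump_rOut.eventually_lt_const hr0] with n hn
    rw [← eLpNorm_restrict_eq_of_support_subset (hKs n)]
    refine (eLpNorm_le_of_ae_bound (C := η) (Eventually.of_forall fun x => ?_)).trans ?_
    · rw [Pi.sub_apply, ← dist_eq_norm]
      exact ContDiffBump.dist_normed_convolution_le hhs.continuous.aestronglyMeasurable
        fun y hy => (hr ((Metric.mem_ball.1 hy).trans hn)).le
    · rwa [Measure.restrict_apply_univ]
  filter_upwards [ENNReal.tendsto_nhds_zero.1 hh0 (ε / 3)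
    (ENNReal.div_pos hε.ne' (by norm_num))] with n hn
  have hm : ∀ {f : ℂ → E}, LocallyIntegrable f → AEStronglyMeasurable (moll n f) volume :=
    fun hf => (contDiff_moll n hf).continuous.aestronglyMeasurable
  have hsplit : moll n g - g = moll n (g - h) + (moll n h - h) - (g - h) := by
    ext x
    simp only [Pi.sub_apply, Pi.add_apply, moll_sub n hgl hhl]
    abel
  have hghm : AEStronglyMeasurable (g - h) volume :=
    hg.aestronglyMeasurable.sub hh.aestronglyMeasurable
  calc eLpNorm (moll n g - g) p volume
      ≤ eLpNorm (moll n (g - h) + (moll n h - h)) p volume + eLpNorm (g - h) p volume := by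
        rw [hsplit]
        exact eLpNorm_sub_le ((hm (hgl.sub hhl)).add ((hm hhl).sub hh.aestronglyMeasurable)) hghm hp
    _ ≤ (eLpNorm (moll n (g - h)) p volume + eLpNorm (moll n h - h) p volume)
          + eLpNorm (g - h) p volume := by
        gcongr
        exact eLpNorm_add_le (hm (hgl.sub hhl)) ((hm hhl).sub hh.aestronglyMeasurable) hp
    _ ≤ (ε / 3 + ε / 3) + ε / 3 := by
        gcongr
        · exact (eLpNorm_moll_le n hp hp' hghm).trans (hgh.trans hδ)
        · exact hgh.trans hδ
    _ = ε := by rw [ENNReal.add_thirds]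

/-- On points whose neighbourhoods of radius `1 / (n + 1)` lie in `U`, the derivative of the
mollification is the mollification of the weak derivative. -/
theorem fderiv_moll_apply [CompleteSpace E] {U L : Set ℂ} {v : ℂ} {f f' : ℂ → E}
    (h : IsWeakDeriv U v f f') (hL : LocallyIntegrable (L.indicator f)) (n : ℕ) {x : ℂ}
    (hxU : Metric.closedBall x (1 / ((n : ℝ) + 1)) ⊆ U)
    (hxL : Metric.closedBall x (1 / ((n : ℝ) + 1)) ⊆ L) :
    fderiv ℝ (moll n (L.indicator f)) x v = moll n (L.indicator f') x := by
  set ρ := (bump n).normed volume with hρ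
  have hρs : ContDiff ℝ ∞ ρ := (bump n).contDiff_normed (n := (⊤ : ℕ∞))
  have hρ1 : ContDiff ℝ 1 ρ := hρs.of_le (by exact_mod_cast le_top)
  have hρd : Differentiable ℝ ρ := hρ1.differentiable one_ne_zero
  have hρc : HasCompactSupport ρ := (bump n).hasCompactSupport_normed
  set ψ : ℂ → ℝ := fun y => ρ (x - y) with hψ
  have hψs : ContDiff ℝ ∞ ψ := hρs.comp (contDiff_const.sub contDiff_id)
  have hψf : ∀ y, fderiv ℝ ψ y v = - fderiv ℝ ρ (x - y) v := by
    intro y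
    have h1 : HasFDerivAt ψ ((fderiv ℝ ρ (x - y)).comp (-ContinuousLinearMap.id ℝ ℂ)) y :=
      (hρd (x - y)).hasFDerivAt.comp y ((hasFDerivAt_id y).const_sub x)
    rw [h1.fderiv]
    simp
  have hψ0 : ∀ y, y ∉ Metric.closedBall x (1 / ((n : ℝ) + 1)) → ψ y = 0 := by
    intro y hy
    have h1 : x - y ∉ Function.support ρ := by
      rw [hρ, (bump n).support_normed_eq]
      intro h2
      apply hy
      rw [mem_ball_zero_iff, bump_rOut] at h2
      rw [Metric.mem_closedBall, dist_comm, dist_eq_norm]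
      exact h2.le
    simpa using h1
  have hψsupp : tsupport ψ ⊆ Metric.closedBall x (1 / ((n : ℝ) + 1)) :=
    closure_minimal (fun y hy => by_contra fun h' => hy (hψ0 y h')) Metric.isClosed_closedBall
  have hψc : HasCompactSupport ψ :=
    (isCompact_closedBall x _).of_isClosed_subset (isClosed_tsupport ψ) hψsupp
  have hψf0 : ∀ y, y ∉ Metric.closedBall x (1 / ((n : ℝ) + 1)) → fderiv ℝ ψ y v = 0 := by
    intro y hy
    have : y ∉ tsupport (fderiv ℝ ψ) := fun h' => hy (hψsupp (tsupport_fderiv_subset ℝ h'))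
    rw [image_eq_zero_of_notMem_tsupport this]
    rfl
  have hd := HasCompactSupport.hasFDerivAt_convolution_left
    (lsmul ℝ ℝ : ℝ →L[ℝ] E →L[ℝ] E) hρc hρ1 hL x
  have hex : ConvolutionExistsAt (fderiv ℝ ρ) (L.indicator f) x
      ((lsmul ℝ ℝ : ℝ →L[ℝ] E →L[ℝ] E).precompL ℂ) volume :=
    (hρc.fderiv ℝ).convolutionExists_left _ (hρ1.continuous_fderiv one_ne_zero) hL x
  have e1 : fderiv ℝ (moll n (L.indicator f)) x v
      = ∫ t, fderiv ℝ ρ t v • L.indicator f (x - t) := by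
    rw [show fderiv ℝ (moll n (L.indicator f)) x = _ from hd.fderiv, convolution_def,
      ContinuousLinearMap.integral_apply hex]
    rfl
  have e2 : ∫ t, fderiv ℝ ρ t v • L.indicator f (x - t)
      = ∫ y, fderiv ℝ ρ (x - y) v • L.indicator f y := by
    rw [← integral_sub_left_eq_self _ volume x]
    simp only [sub_sub_cancel]
  have e3 : ∫ y, fderiv ℝ ρ (x - y) v • L.indicator f y
      = - ∫ y in U, fderiv ℝ ψ y v • f y := by
    rw [← setIntegral_eq_integral_of_forall_compl_eq_zero (s := U), ← integral_neg]
    · refine integral_congr_ae (Eventually.of_forall fun y => ?_)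
      simp only
      by_cases hy : y ∈ Metric.closedBall x (1 / ((n : ℝ) + 1))
      · rw [indicator_of_mem (hxL hy), hψf, neg_smul, neg_neg]
      · have h1 := hψf0 y hy
        rw [hψf, neg_eq_zero] at h1
        rw [h1, hψf0 y hy, zero_smul, zero_smul, neg_zero]
    · intro y hy
      have h1 := hψf0 y fun h' => hy (hxU h')
      rw [hψf, neg_eq_zero] at h1
      rw [h1, zero_smul]
  have e4 : ∫ y in U, ψ y • f' y = moll n (L.indicator f') x := by
    rw [moll_apply, ← integral_sub_left_eq_self _ volume x]
    simp only [sub_sub_cancel]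
    refine Eq.trans ?_ (setIntegral_eq_integral_of_forall_compl_eq_zero (s := U) ?_)
    · refine integral_congr_ae (Eventually.of_forall fun y => ?_)
      simp only
      by_cases hy : y ∈ Metric.closedBall x (1 / ((n : ℝ) + 1))
      · rw [indicator_of_mem (hxL hy)]
      · change ψ y • f' y = ψ y • _
        rw [hψ0 y hy, zero_smul, zero_smul]
    · intro y hy
      change ψ y • _ = _
      rw [hψ0 y fun h' => hy (hxU h'), zero_smul]
  rw [e1, e2, e3, h.2.2 ψ hψs hψc (hψsupp.trans hxU), neg_neg, e4]

end Mollification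

/-! ### Weak derivatives -/

section WeakDerivatives

variable {E F : Type*} [NormedAddCommGroup E] [NormedSpace ℝ E]
  [NormedAddCommGroup F] [NormedSpace ℝ F]
  {Ω U : Set ℂ} {v : ℂ} {f f' g g' : ℂ → E}

theorem fderiv_apply_eq_zero_of_notMem {ψ : ℂ → ℝ} {x : ℂ} (hx : x ∉ tsupport ψ) (v : ℂ) :
    fderiv ℝ ψ x v = 0 := by
  have : x ∉ tsupport (fderiv ℝ ψ) := fun h' => hx (tsupport_fderiv_subset ℝ h')
  rw [image_eq_zero_of_notMem_tsupport this]
  rfl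

theorem integrable_smul_of_locallyIntegrableOn (hf : LocallyIntegrableOn f Ω) {K : Set ℂ}
    (hK : IsCompact K) (hKΩ : K ⊆ Ω) {a : ℂ → ℝ} (ha : Continuous a) (ha0 : ∀ x ∉ K, a x = 0) :
    Integrable fun x => a x • f x := by
  rw [← integrableOn_iff_integrable_of_support_subset (s := K)]
  · exact (hf.integrableOn_compact_subset hKΩ hK).continuousOn_smul ha.continuousOn hK
  · intro x hx
    by_contra hxK
    exact hx (by simp [ha0 x hxK])

theorem setIntegral_smul_eq {K : Set ℂ} (hKΩ : K ⊆ Ω) {a : ℂ → ℝ} (ha0 : ∀ x ∉ K, a x = 0)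
    (f : ℂ → E) : ∫ x in Ω, a x • f x = ∫ x, a x • f x :=
  setIntegral_eq_integral_of_forall_compl_eq_zero fun x hx => by
    rw [ha0 x fun h => hx (hKΩ h), zero_smul]

theorem continuous_fderiv_apply {E : Type*} [NormedAddCommGroup E] [NormedSpace ℝ E]
    {ψ : ℂ → E} (hψ : ContDiff ℝ ∞ ψ) (v : ℂ) :
    Continuous fun x => fderiv ℝ ψ x v :=
  (hψ.continuous_fderiv (by simp)).clm_apply continuous_const

theorem isWeakDeriv_iff : IsWeakDeriv Ω v f f' ↔
    LocallyIntegrableOn f Ω ∧ LocallyIntegrableOn f' Ω ∧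
      ∀ ψ : ℂ → ℝ, ContDiff ℝ ∞ ψ → HasCompactSupport ψ → tsupport ψ ⊆ Ω →
        ∫ x, fderiv ℝ ψ x v • f x = - ∫ x, ψ x • f' x := by
  refine and_congr Iff.rfl (and_congr Iff.rfl (forall_congr' fun ψ => ?_))
  refine forall_congr' fun h1 => forall_congr' fun h2 => forall_congr' fun h3 => ?_
  rw [setIntegral_smul_eq h3 fun x hx => fderiv_apply_eq_zero_of_notMem hx v,
    setIntegral_smul_eq h3 fun x hx => image_eq_zero_of_notMem_tsupport hx]

theorem IsWeakDeriv.mono (h : IsWeakDeriv Ω v f f') (hU : U ⊆ Ω) : IsWeakDeriv U v f f' := by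
  rw [isWeakDeriv_iff] at h ⊢
  exact ⟨h.1.mono_set hU, h.2.1.mono_set hU, fun ψ h1 h2 h3 => h.2.2 ψ h1 h2 (h3.trans hU)⟩

theorem IsWeakDeriv.congr (h : IsWeakDeriv Ω v f f') (hfg : f =ᵐ[volume.restrict Ω] g)
    (hfg' : f' =ᵐ[volume.restrict Ω] g') : IsWeakDeriv Ω v g g' := by
  refine ⟨h.1.congr hfg, h.2.1.congr hfg', fun ψ h1 h2 h3 => ?_⟩
  rw [← integral_congr_ae (hfg.mono fun x hx => by simp only [hx] :
      (fun x => fderiv ℝ ψ x v • f x) =ᵐ[volume.restrict Ω] fun x => fderiv ℝ ψ x v • g x),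
    ← integral_congr_ae (hfg'.mono fun x hx => by simp only [hx] :
      (fun x => ψ x • f' x) =ᵐ[volume.restrict Ω] fun x => ψ x • g' x), h.2.2 ψ h1 h2 h3]

theorem IsWeakDeriv.ae_eq [CompleteSpace E] (hΩ : IsOpen Ω) (h : IsWeakDeriv Ω v f f')
    (h' : IsWeakDeriv Ω v f g') : f' =ᵐ[volume.restrict Ω] g' := by
  have h1 : ∀ᵐ x, x ∈ Ω → (f' - g') x = 0 := by
    refine hΩ.ae_eq_zero_of_integral_contDiff_smul_eq_zero (h.2.1.sub h'.2.1) fun ψ h1 h2 h3 => ?_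
    have i1 := integrable_smul_of_locallyIntegrableOn h.2.1 h2 h3 h1.continuous
      fun x hx => image_eq_zero_of_notMem_tsupport hx
    have i2 := integrable_smul_of_locallyIntegrableOn h'.2.1 h2 h3 h1.continuous
      fun x hx => image_eq_zero_of_notMem_tsupport hx
    have e1 := (isWeakDeriv_iff.1 h).2.2 ψ h1 h2 h3
    have e2 := (isWeakDeriv_iff.1 h').2.2 ψ h1 h2 h3
    simp only [Pi.sub_apply, smul_sub]
    rw [integral_sub i1 i2, sub_eq_zero]
    exact neg_injective (e1.symm.trans e2)
  rw [EventuallyEq, ae_restrict_iff' hΩ.measurableSet]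
  filter_upwards [h1] with x hx hxΩ
  exact sub_eq_zero.1 (hx hxΩ)

theorem IsWeakDeriv.sub (h : IsWeakDeriv Ω v f f') (h' : IsWeakDeriv Ω v g g') :
    IsWeakDeriv Ω v (fun x => f x - g x) (fun x => f' x - g' x) := by
  rw [isWeakDeriv_iff]
  refine ⟨h.1.sub h'.1, h.2.1.sub h'.2.1, fun ψ h1 h2 h3 => ?_⟩
  have key : ∀ {a : ℂ → ℝ}, Continuous a → (∀ x ∉ tsupport ψ, a x = 0) →
      ∀ {f g : ℂ → E}, LocallyIntegrableOn f Ω → LocallyIntegrableOn g Ω →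
      ∫ x, a x • (f x - g x) = (∫ x, a x • f x) - ∫ x, a x • g x := by
    intro a ha ha0 f g hf hg
    simp only [smul_sub]
    exact integral_sub (integrable_smul_of_locallyIntegrableOn hf h2 h3 ha ha0)
      (integrable_smul_of_locallyIntegrableOn hg h2 h3 ha ha0)
  rw [key (continuous_fderiv_apply h1 v) (fun x hx => fderiv_apply_eq_zero_of_notMem hx v) h.1 h'.1,
    key h1.continuous (fun x hx => image_eq_zero_of_notMem_tsupport hx) h.2.1 h'.2.1,
    (isWeakDeriv_iff.1 h).2.2 ψ h1 h2 h3, (isWeakDeriv_iff.1 h').2.2 ψ h1 h2 h3]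
  abel

theorem IsWeakDeriv.clm_comp [CompleteSpace E] [CompleteSpace F] (h : IsWeakDeriv Ω v f f')
    (T : E →L[ℝ] F) : IsWeakDeriv Ω v (fun x => T (f x)) (fun x => T (f' x)) := by
  rw [isWeakDeriv_iff]
  refine ⟨T.locallyIntegrableOn_comp h.1, T.locallyIntegrableOn_comp h.2.1, fun ψ h1 h2 h3 => ?_⟩
  simp only [← map_smul]
  rw [T.integral_comp_comm (integrable_smul_of_locallyIntegrableOn h.1 h2 h3
      (continuous_fderiv_apply h1 v) fun x hx => fderiv_apply_eq_zero_of_notMem hx v),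
    T.integral_comp_comm (integrable_smul_of_locallyIntegrableOn h.2.1 h2 h3 h1.continuous
      fun x hx => image_eq_zero_of_notMem_tsupport hx),
    (isWeakDeriv_iff.1 h).2.2 ψ h1 h2 h3, map_neg]

theorem isWeakDeriv_of_contDiff (hf : ContDiff ℝ 1 f) :
    IsWeakDeriv Ω v f fun x => fderiv ℝ f x v := by
  have hf' : Continuous fun x => fderiv ℝ f x v :=
    (hf.continuous_fderiv one_ne_zero).clm_apply continuous_const
  have hl := (hf.continuous.locallyIntegrable (μ := volume)).locallyIntegrableOn univ
  have hl' := (hf'.locallyIntegrable (μ := volume)).locallyIntegrableOn univ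
  rw [isWeakDeriv_iff]
  refine ⟨hl.mono_set (subset_univ _), hl'.mono_set (subset_univ _), fun ψ h1 h2 h3 => ?_⟩
  rw [integral_smul_fderiv_eq_neg_fderiv_smul_of_integrable, neg_neg]
  · exact integrable_smul_of_locallyIntegrableOn hl h2 (subset_univ _)
      (continuous_fderiv_apply h1 v) fun x hx => fderiv_apply_eq_zero_of_notMem hx v
  · exact integrable_smul_of_locallyIntegrableOn hl' h2 (subset_univ _) h1.continuous
      fun x hx => image_eq_zero_of_notMem_tsupport hx
  · exact integrable_smul_of_locallyIntegrableOn hl h2 (subset_univ _) h1.continuous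
      fun x hx => image_eq_zero_of_notMem_tsupport hx
  · exact fun x _ => (h1.differentiable (by simp)) x
  · exact fun x _ => (hf.differentiable one_ne_zero) x

theorem isWeakDeriv_const (c : E) : IsWeakDeriv Ω v (fun _ => c) (fun _ => 0) := by
  simpa using isWeakDeriv_of_contDiff (Ω := Ω) (v := v) (contDiff_const (c := c))

theorem tendsto_integral_smul_of_eLpNorm {K : Set ℂ} (hK : IsCompact K) {G : ℕ → ℂ → E}
    (hf : IntegrableOn f K) (hG : ∀ n, Continuous (G n))
    (h : Tendsto (fun n => eLpNorm (G n - f) 1 (volume.restrict K)) atTop (𝓝 0))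
    {a : ℂ → ℝ} (ha : Continuous a) (ha0 : ∀ x ∉ K, a x = 0) :
    Tendsto (fun n => ∫ x, a x • G n x) atTop (𝓝 (∫ x, a x • f x)) := by
  simp only [← setIntegral_smul_eq subset_rfl ha0]
  obtain ⟨C, hC⟩ := hK.exists_bound_of_continuousOn ha.continuousOn
  refine tendsto_integral_of_L1' _ (hf.continuousOn_smul ha.continuousOn hK).aestronglyMeasurable
    (Eventually.of_forall fun n => (ha.smul (hG n)).continuousOn.integrableOn_compact hK) ?_
  have h0 : Tendsto (fun n => ENNReal.ofReal C * eLpNorm (G n - f) 1 (volume.restrict K)) atTop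
      (𝓝 0) := by
    simpa using ENNReal.Tendsto.const_mul h (Or.inr ENNReal.ofReal_ne_top)
  refine tendsto_of_tendsto_of_tendsto_of_le_of_le tendsto_const_nhds h0 (fun _ => zero_le)
    fun n => eLpNorm_le_mul_eLpNorm_of_ae_le_mul ?_ 1
  refine (ae_restrict_iff' hK.measurableSet).2 (Eventually.of_forall fun x hx => ?_)
  simp only [Pi.sub_apply, ← smul_sub, norm_smul]
  exact mul_le_mul_of_nonneg_right (hC x hx) (norm_nonneg _)

/-- Weak derivatives pass to the limit in `L¹_loc`. -/
theorem isWeakDeriv_of_tendsto (hf : LocallyIntegrableOn f Ω) (hf' : LocallyIntegrableOn f' Ω)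
    (h : ∀ K ⊆ Ω, IsCompact K → ∃ G : ℕ → ℂ → E, (∀ n, ContDiff ℝ 1 (G n)) ∧
      Tendsto (fun n => eLpNorm (G n - f) 1 (volume.restrict K)) atTop (𝓝 0) ∧
      Tendsto (fun n => eLpNorm (fun x => fderiv ℝ (G n) x v - f' x) 1 (volume.restrict K))
        atTop (𝓝 0)) : IsWeakDeriv Ω v f f' := by
  rw [isWeakDeriv_iff]
  refine ⟨hf, hf', fun ψ h1 h2 h3 => ?_⟩
  obtain ⟨G, hG, ht, ht'⟩ := h (tsupport ψ) h3 h2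
  have l1 := tendsto_integral_smul_of_eLpNorm h2 (hf.integrableOn_compact_subset h3 h2)
    (fun n => (hG n).continuous) ht (continuous_fderiv_apply h1 v)
    fun x hx => fderiv_apply_eq_zero_of_notMem hx v
  have l2 := tendsto_integral_smul_of_eLpNorm h2 (hf'.integrableOn_compact_subset h3 h2)
    (fun n => ((hG n).continuous_fderiv one_ne_zero).clm_apply continuous_const) ht' h1.continuous
    fun x hx => image_eq_zero_of_notMem_tsupport hx
  refine tendsto_nhds_unique l1 (l2.neg.congr fun n => ?_)
  exact ((isWeakDeriv_iff.1 (isWeakDeriv_of_contDiff (Ω := univ) (hG n))).2.2 ψ h1 h2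
    (subset_univ _)).symm

/-- Smooth approximation on a compact subset `K` of `Ω`, by mollification: one sequence of smooth
functions converges to `f` in all senses in which `f` is regular. -/
theorem exists_smooth_approx [CompleteSpace E] (hΩ : IsOpen Ω) (hf : LocallyIntegrableOn f Ω)
    {K : Set ℂ} (hK : IsCompact K) (hKΩ : K ⊆ Ω) : ∃ G : ℕ → ℂ → E, (∀ n, ContDiff ℝ ∞ (G n)) ∧
      (∀ᵐ x ∂volume.restrict K, Tendsto (fun n => G n x) atTop (𝓝 (f x))) ∧
      (∀ C : ℝ, 0 ≤ C → (∀ᵐ x ∂volume.restrict Ω, ‖f x‖ ≤ C) → ∀ n x, ‖G n x‖ ≤ C) ∧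
      (∀ p : ℝ≥0∞, 1 ≤ p → p ≠ ⊤ → (∀ L ⊆ Ω, IsCompact L → MemLp f p (volume.restrict L)) →
        Tendsto (fun n => eLpNorm (G n - f) p (volume.restrict K)) atTop (𝓝 0)) ∧
      ∀ (v : ℂ) (f' : ℂ → E), (∀ x ∈ Ω, ∃ U, IsOpen U ∧ x ∈ U ∧ IsWeakDeriv U v f f') →
        ∀ p : ℝ≥0∞, 1 ≤ p → p ≠ ⊤ → (∀ L ⊆ Ω, IsCompact L → MemLp f' p (volume.restrict L)) →
        Tendsto (fun n => eLpNorm (fun x => fderiv ℝ (G n) x v - f' x) p (volume.restrict K))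
          atTop (𝓝 0) := by
  obtain ⟨L, hL, hKL, hLΩ⟩ := exists_compact_between hK hΩ hKΩ
  have hLm := hL.measurableSet
  have hfL : Integrable (L.indicator f) :=
    (integrable_indicator_iff hLm).2 (hf.integrableOn_compact_subset hLΩ hL)
  have hfl := hfL.locallyIntegrable
  have hind : ∀ g : ℂ → E, ∀ x ∈ K, L.indicator g x = g x := fun g x hx =>
    indicator_of_mem (interior_subset (hKL hx)) g
  have hconv : ∀ (g : ℂ → E) (p : ℝ≥0∞), 1 ≤ p → p ≠ ⊤ → MemLp g p (volume.restrict L) →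
      Tendsto (fun n => eLpNorm (moll n (L.indicator g) - g) p (volume.restrict K)) atTop
        (𝓝 0) := by
    intro g p hp hp' hg
    have h0 : MemLp (L.indicator g) p volume := (memLp_indicator_iff_restrict hLm).2 hg
    have h1 := tendsto_eLpNorm_moll_sub hp hp' h0
    refine tendsto_of_tendsto_of_tendsto_of_le_of_le tendsto_const_nhds h1 (fun _ => zero_le) ?_
    intro n
    refine le_trans (le_of_eq (eLpNorm_congr_ae ?_)) (eLpNorm_restrict_le _ p volume K)
    refine (ae_restrict_iff' hK.measurableSet).2 (Eventually.of_forall fun x hx => ?_)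
    simp only [Pi.sub_apply, hind g x hx]
  refine ⟨fun n => moll n (L.indicator f), fun n => contDiff_moll n hfl, ?_, ?_, ?_, ?_⟩
  · refine (ae_restrict_iff' hK.measurableSet).2 ?_
    filter_upwards [ae_tendsto_moll hfl] with x hx hxK
    rwa [hind f x hxK] at hx
  · intro C hC hfC n x
    refine norm_moll_le n ?_ x
    filter_upwards [(ae_restrict_iff' hΩ.measurableSet).1 hfC] with y hy
    by_cases hyL : y ∈ L
    · rw [indicator_of_mem hyL]
      exact hy (hLΩ hyL)
    · rw [indicator_of_notMem hyL]
      simpa using hC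
  · exact fun p hp hp' hfp => hconv f p hp hp' (hfp L hLΩ hL)
  · intro v f' hloc p hp hp' hfp
    choose! U hU hxU hUf using hloc
    obtain ⟨δ₁, hδ₁, hδU⟩ := lebesgue_number_lemma_of_metric (c := fun x : Ω => U x) hK
      (fun x => hU x x.2) (fun x hx => mem_iUnion.2 ⟨⟨x, hKΩ hx⟩, hxU x (hKΩ hx)⟩)
    obtain ⟨δ₂, hδ₂, hδL⟩ := hK.exists_thickening_subset_open isOpen_interior hKL
    refine (hconv f' p hp hp' (hfp L hLΩ hL)).congr' ?_
    filter_upwards [tendsto_bump_rOut.eventually_lt_const (lt_min hδ₁ hδ₂)] with n hn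
    rw [bump_rOut] at hn
    refine eLpNorm_congr_ae ?_
    refine (ae_restrict_iff' hK.measurableSet).2 (Eventually.of_forall fun x hx => ?_)
    obtain ⟨y, hy⟩ := hδU x hx
    simp only [Pi.sub_apply]
    rw [fderiv_moll_apply (hUf y y.2) hfl n]
    · exact (Metric.closedBall_subset_ball (hn.trans_le (min_le_left _ _))).trans hy
    · exact ((Metric.closedBall_subset_ball (hn.trans_le (min_le_right _ _))).trans
        (Metric.ball_subset_thickening hx δ₂)).trans (hδL.trans interior_subset)

theorem memLp_one_of_locallyIntegrableOn {E : Type*} [NormedAddCommGroup E] {f : ℂ → E}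
    (hf : LocallyIntegrableOn f Ω) :
    ∀ L ⊆ Ω, IsCompact L → MemLp f 1 (volume.restrict L) := fun _ hL hLc =>
  memLp_one_iff_integrable.2 (hf.integrableOn_compact_subset hL hLc)

/-- Being a weak derivative is a local property. -/
theorem isWeakDeriv_of_locally [CompleteSpace E] (hΩ : IsOpen Ω)
    (h : ∀ x ∈ Ω, ∃ U, IsOpen U ∧ x ∈ U ∧ IsWeakDeriv U v f f') : IsWeakDeriv Ω v f f' := by
  have hl : ∀ g : ℂ → E, (∀ x ∈ Ω, ∃ U, IsOpen U ∧ x ∈ U ∧ LocallyIntegrableOn g U) →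
      LocallyIntegrableOn g Ω := by
    intro g hg x hx
    obtain ⟨U, hU, hxU, hgU⟩ := hg x hx
    have := hgU x hxU
    rw [hU.nhdsWithin_eq hxU] at this
    rwa [hΩ.nhdsWithin_eq hx]
  have hf : LocallyIntegrableOn f Ω := hl f fun x hx =>
    let ⟨U, hU, hxU, hf⟩ := h x hx; ⟨U, hU, hxU, hf.1⟩
  have hf' : LocallyIntegrableOn f' Ω := hl f' fun x hx =>
    let ⟨U, hU, hxU, hf⟩ := h x hx; ⟨U, hU, hxU, hf.2.1⟩
  refine isWeakDeriv_of_tendsto hf hf' fun K hKΩ hK => ?_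
  obtain ⟨G, hG, -, -, h1, h2⟩ := exists_smooth_approx hΩ hf hK hKΩ
  exact ⟨G, fun n => (hG n).of_le (by exact_mod_cast le_top),
    h1 1 le_rfl ENNReal.one_ne_top (memLp_one_of_locallyIntegrableOn hf),
    h2 v f' h 1 le_rfl ENNReal.one_ne_top (memLp_one_of_locallyIntegrableOn hf')⟩

end WeakDerivatives

/-! ### Product and chain rules -/

section Calculus

variable {Ω : Set ℂ} {v : ℂ}

/-- Dominated convergence for bounded factors converging almost everywhere, against a fixed
integrable weight. -/
theorem tendsto_lintegral_enorm_sub_mul {α : Type*} [MeasurableSpace α] {μ : Measure α}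
    {E F : Type*} [NormedAddCommGroup E] [NormedAddCommGroup F] {G : ℕ → α → E} {g : α → E}
    {h : α → F} {C : ℝ} (hG : ∀ n, AEStronglyMeasurable (G n) μ) (hC : ∀ n, ∀ᵐ x ∂μ, ‖G n x‖ ≤ C)
    (hlim : ∀ᵐ x ∂μ, Tendsto (fun n => G n x) atTop (𝓝 (g x))) (hh : Integrable h μ) :
    Tendsto (fun n => ∫⁻ x, ‖G n x - g x‖ₑ * ‖h x‖ₑ ∂μ) atTop (𝓝 0) := by
  have hg : AEStronglyMeasurable g μ := aestronglyMeasurable_of_tendsto_ae _ hG hlim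
  have hgC : ∀ᵐ x ∂μ, ‖g x‖ ≤ C := by
    filter_upwards [ae_all_iff.2 hC, hlim] with x hx hl
    exact le_of_tendsto hl.norm (Eventually.of_forall hx)
  rw [← lintegral_zero (μ := μ)]
  refine tendsto_lintegral_of_dominated_convergence' (fun x => ENNReal.ofReal (2 * C) * ‖h x‖ₑ)
    (fun n => ((hG n).sub hg).enorm.mul hh.aestronglyMeasurable.enorm) (fun n => ?_) ?_ ?_
  · filter_upwards [hC n, hgC] with x h1 h2
    gcongr
    rw [← ofReal_norm]
    refine ENNReal.ofReal_le_ofReal ((norm_sub_le _ _).trans (by linarith))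
  · rw [lintegral_const_mul' _ _ ENNReal.ofReal_ne_top]
    exact ENNReal.mul_ne_top ENNReal.ofReal_ne_top hh.2.ne
  · filter_upwards [hlim] with x hx
    have h1 : Tendsto (fun n => ‖G n x - g x‖ₑ) atTop (𝓝 0) := by
      have := (hx.sub_const (g x)).enorm
      simpa using this
    simpa using ENNReal.Tendsto.mul_const h1 (Or.inr enorm_ne_top)

/-- A product of convergent bounded factors and `L¹`-convergent factors converges in `L¹`. -/
theorem tendsto_eLpNorm_mul_sub {α : Type*} [MeasurableSpace α] {μ : Measure α}
    {G H : ℕ → α → ℂ} {g h : α → ℂ} {C : ℝ} (hG : ∀ n, AEStronglyMeasurable (G n) μ)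
    (hC : ∀ n, ∀ᵐ x ∂μ, ‖G n x‖ ≤ C)
    (hlim : ∀ᵐ x ∂μ, Tendsto (fun n => G n x) atTop (𝓝 (g x))) (hh : Integrable h μ)
    (hH : ∀ n, AEStronglyMeasurable (H n) μ)
    (hlim' : Tendsto (fun n => eLpNorm (fun x => H n x - h x) 1 μ) atTop (𝓝 0)) :
    Tendsto (fun n => eLpNorm (fun x => G n x * H n x - g x * h x) 1 μ) atTop (𝓝 0) := by
  simp only [eLpNorm_one_eq_lintegral_enorm] at hlim' ⊢
  have h1 := tendsto_lintegral_enorm_sub_mul hG hC hlim hh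
  have h2 := ENNReal.Tendsto.const_mul (a := ENNReal.ofReal C) hlim'
    (Or.inr ENNReal.ofReal_ne_top)
  rw [mul_zero] at h2
  have h3 := h2.add h1
  rw [add_zero] at h3
  refine tendsto_of_tendsto_of_tendsto_of_le_of_le tendsto_const_nhds h3 (fun _ => zero_le) ?_
  intro n
  have hm : AEMeasurable (fun x => ENNReal.ofReal C * ‖H n x - h x‖ₑ) μ :=
    ((hH n).sub hh.aestronglyMeasurable).enorm.const_mul _
  simp only
  rw [← lintegral_const_mul' _ _ ENNReal.ofReal_ne_top, ← lintegral_add_left' hm]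
  refine lintegral_mono_ae ?_
  filter_upwards [hC n] with x hx
  calc ‖G n x * H n x - g x * h x‖ₑ = ‖G n x * (H n x - h x) + (G n x - g x) * h x‖ₑ := by
        congr 1; ring
    _ ≤ ‖G n x * (H n x - h x)‖ₑ + ‖(G n x - g x) * h x‖ₑ := enorm_add_le _ _
    _ ≤ _ := by
        rw [enorm_mul, enorm_mul]
        gcongr
        rw [← ofReal_norm]
        exact ENNReal.ofReal_le_ofReal hx

theorem tendsto_eLpNorm_sub_of_bounded {μ : Measure ℂ} [IsFiniteMeasure μ]
    {G : ℕ → ℂ → ℂ} {g : ℂ → ℂ} {C : ℝ} (hG : ∀ n, AEStronglyMeasurable (G n) μ)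
    (hC : ∀ n, ∀ᵐ x ∂μ, ‖G n x‖ ≤ C)
    (hlim : ∀ᵐ x ∂μ, Tendsto (fun n => G n x) atTop (𝓝 (g x))) :
    Tendsto (fun n => eLpNorm (G n - g) 1 μ) atTop (𝓝 0) := by
  have h := tendsto_lintegral_enorm_sub_mul (h := fun _ => (1 : ℝ)) hG hC hlim
    (integrable_const _)
  simpa [eLpNorm_one_eq_lintegral_enorm] using h

theorem tendsto_eLpNorm_add {α : Type*} [MeasurableSpace α] {μ : Measure α} {F G : ℕ → α → ℂ}
    (hF : ∀ n, AEStronglyMeasurable (F n) μ) (hG : ∀ n, AEStronglyMeasurable (G n) μ)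
    (h1 : Tendsto (fun n => eLpNorm (F n) 1 μ) atTop (𝓝 0))
    (h2 : Tendsto (fun n => eLpNorm (G n) 1 μ) atTop (𝓝 0)) :
    Tendsto (fun n => eLpNorm (F n + G n) 1 μ) atTop (𝓝 0) := by
  have h3 := h1.add h2
  rw [add_zero] at h3
  exact tendsto_of_tendsto_of_tendsto_of_le_of_le tendsto_const_nhds h3 (fun _ => zero_le)
    fun n => eLpNorm_add_le (hF n) (hG n) le_rfl

theorem locallyIntegrableOn_bdd_mul (hΩ : IsOpen Ω) {f g : ℂ → ℂ} {C : ℝ}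
    (hf : LocallyIntegrableOn f Ω) (hg : AEStronglyMeasurable g (volume.restrict Ω))
    (hC : ∀ᵐ x ∂volume.restrict Ω, ‖g x‖ ≤ C) : LocallyIntegrableOn (fun x => g x * f x) Ω := by
  rw [locallyIntegrableOn_iff hΩ.isLocallyClosed] at hf ⊢
  intro K hKΩ hK
  exact (hf K hKΩ hK).bdd_mul (hg.mono_set hKΩ) (ae_restrict_of_ae_restrict_of_subset hKΩ hC)

/-- The Leibniz rule for bounded weakly differentiable functions. -/
theorem IsWeakDeriv.mul (hΩ : IsOpen Ω) {f g f' g' : ℂ → ℂ} {C : ℝ} (hC0 : 0 ≤ C)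
    (hf : IsWeakDeriv Ω v f f') (hg : IsWeakDeriv Ω v g g')
    (hfC : ∀ᵐ x ∂volume.restrict Ω, ‖f x‖ ≤ C) (hgC : ∀ᵐ x ∂volume.restrict Ω, ‖g x‖ ≤ C) :
    IsWeakDeriv Ω v (fun x => f x * g x) (fun x => g x * f' x + f x * g' x) := by
  have hfm := hf.1.aestronglyMeasurable
  have hgm := hg.1.aestronglyMeasurable
  refine isWeakDeriv_of_tendsto (locallyIntegrableOn_bdd_mul hΩ hg.1 hfm hfC)
    ((locallyIntegrableOn_bdd_mul hΩ hf.2.1 hgm hgC).add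
      (locallyIntegrableOn_bdd_mul hΩ hg.2.1 hfm hfC)) fun K hKΩ hK => ?_
  have : IsFiniteMeasure (volume.restrict K) := ⟨by simpa using hK.measure_lt_top⟩
  obtain ⟨F, hFs, hFlim, hFC, -, hFd⟩ := exists_smooth_approx hΩ hf.1 hK hKΩ
  obtain ⟨G, hGs, hGlim, hGC, -, hGd⟩ := exists_smooth_approx hΩ hg.1 hK hKΩ
  replace hFC := hFC C hC0 hfC
  replace hGC := hGC C hC0 hgC
  replace hFd := hFd v f' (fun x hx => ⟨Ω, hΩ, hx, hf⟩) 1 le_rfl ENNReal.one_ne_top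
    (memLp_one_of_locallyIntegrableOn hf.2.1)
  replace hGd := hGd v g' (fun x hx => ⟨Ω, hΩ, hx, hg⟩) 1 le_rfl ENNReal.one_ne_top
    (memLp_one_of_locallyIntegrableOn hg.2.1)
  have hFm := fun n => (hFs n).continuous.aestronglyMeasurable (μ := volume.restrict K)
  have hGm := fun n => (hGs n).continuous.aestronglyMeasurable (μ := volume.restrict K)
  have hFdm := fun n => (continuous_fderiv_apply (hFs n) v).aestronglyMeasurable
    (μ := volume.restrict K)
  have hGdm := fun n => (continuous_fderiv_apply (hGs n) v).aestronglyMeasurable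
    (μ := volume.restrict K)
  have hf'K := hf.2.1.integrableOn_compact_subset hKΩ hK
  have hg'K := hg.2.1.integrableOn_compact_subset hKΩ hK
  refine ⟨fun n x => F n x * G n x,
    fun n => ((hFs n).mul (hGs n)).of_le (by exact_mod_cast le_top), ?_, ?_⟩
  · refine tendsto_eLpNorm_sub_of_bounded (C := C * C) (fun n => (hFm n).mul (hGm n))
      (fun n => Eventually.of_forall fun x => ?_) ?_
    · rw [norm_mul]
      exact mul_le_mul (hFC n x) (hGC n x) (norm_nonneg _) hC0
    · filter_upwards [hFlim, hGlim] with x h1 h2 using h1.mul h2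
  · have t1 := tendsto_eLpNorm_mul_sub hGm (fun n => Eventually.of_forall (hGC n)) hGlim hf'K
      hFdm hFd
    have t2 := tendsto_eLpNorm_mul_sub hFm (fun n => Eventually.of_forall (hFC n)) hFlim hg'K
      hGdm hGd
    have hgK := hgm.mono_set hKΩ
    have hfK := hfm.mono_set hKΩ
    refine (tendsto_eLpNorm_add
      (fun n => ((hGm n).mul (hFdm n)).sub (hgK.mul hf'K.aestronglyMeasurable))
      (fun n => ((hFm n).mul (hGdm n)).sub (hfK.mul hg'K.aestronglyMeasurable)) t1 t2).congr ?_
    intro n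
    congr 1
    ext x
    have hd : fderiv ℝ (fun x => F n x * G n x) x v
        = F n x * fderiv ℝ (G n) x v + G n x * fderiv ℝ (F n) x v := by
      rw [fderiv_fun_mul ((hFs n).differentiable (by simp) x) ((hGs n).differentiable (by simp) x)]
      simp
    simp only [Pi.add_apply, Pi.mul_apply, Pi.sub_apply, hd]
    ring

theorem norm_exp_I_mul (r : ℝ) : ‖Complex.exp (Complex.I * r)‖ = 1 := by
  rw [mul_comm, Complex.norm_exp_ofReal_mul_I]

theorem continuous_exp_I_mul : Continuous fun r : ℝ => Complex.exp (Complex.I * r) := by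
  fun_prop

/-- The chain rule for `e^{iφ}`. -/
theorem IsWeakDeriv.exp_I_mul (hΩ : IsOpen Ω) {φ φ' : ℂ → ℝ} (h : IsWeakDeriv Ω v φ φ') :
    IsWeakDeriv Ω v (fun x => Complex.exp (Complex.I * φ x))
      (fun x => Complex.exp (Complex.I * φ x) * (Complex.I * φ' x)) := by
  have hm : AEStronglyMeasurable (fun x => Complex.exp (Complex.I * φ x)) (volume.restrict Ω) :=
    continuous_exp_I_mul.comp_aestronglyMeasurable h.1.aestronglyMeasurable
  have hC : ∀ᵐ x ∂volume.restrict Ω, ‖Complex.exp (Complex.I * φ x)‖ ≤ 1 :=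
    Eventually.of_forall fun x => (norm_exp_I_mul _).le
  have h' : IsWeakDeriv Ω v (fun x => Complex.I * φ x) (fun x => Complex.I * φ' x) := by
    simpa using h.clm_comp
      ((ContinuousLinearMap.mul ℝ ℂ Complex.I).comp Complex.ofRealCLM)
  have hloc : LocallyIntegrableOn (fun _ => (1 : ℂ)) Ω := locallyIntegrableOn_const 1
  refine isWeakDeriv_of_tendsto
    (by simpa using locallyIntegrableOn_bdd_mul hΩ hloc hm hC)
    (locallyIntegrableOn_bdd_mul hΩ h'.2.1 hm hC) fun K hKΩ hK => ?_
  have : IsFiniteMeasure (volume.restrict K) := ⟨by simpa using hK.measure_lt_top⟩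
  obtain ⟨F, hFs, hFlim, -, -, hFd⟩ := exists_smooth_approx hΩ h.1 hK hKΩ
  replace hFd := hFd v φ' (fun x hx => ⟨Ω, hΩ, hx, h⟩) 1 le_rfl ENNReal.one_ne_top
    (memLp_one_of_locallyIntegrableOn h.2.1)
  have hFm := fun n => (continuous_exp_I_mul.comp (hFs n).continuous).aestronglyMeasurable
    (μ := volume.restrict K)
  have hFdm := fun n => (continuous_fderiv_apply (hFs n) v).aestronglyMeasurable
    (μ := volume.restrict K)
  have hFe : ∀ᵐ x ∂volume.restrict K,
      Tendsto (fun n => Complex.exp (Complex.I * F n x)) atTop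
        (𝓝 (Complex.exp (Complex.I * φ x))) := by
    filter_upwards [hFlim] with x hx
    exact (continuous_exp_I_mul.tendsto _).comp hx
  have hφ'K := h.2.1.integrableOn_compact_subset hKΩ hK
  have hd : ∀ n x, HasFDerivAt (fun x => Complex.exp (Complex.I * F n x))
      (Complex.exp (Complex.I * F n x) • (Complex.I • (Complex.ofRealCLM.comp
        (fderiv ℝ (F n) x)))) x := by
    intro n x
    have h1 : HasFDerivAt (fun x => ((F n x : ℝ) : ℂ))
        (Complex.ofRealCLM.comp (fderiv ℝ (F n) x)) x :=
      Complex.ofRealCLM.hasFDerivAt.comp x ((hFs n).differentiable (by simp) x).hasFDerivAt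
    exact (h1.const_mul Complex.I).cexp
  refine ⟨fun n x => Complex.exp (Complex.I * F n x), fun n => ?_, ?_, ?_⟩
  · have h1 : ContDiff ℝ ∞ fun x => ((F n x : ℝ) : ℂ) :=
      Complex.ofRealCLM.contDiff.comp (hFs n)
    exact ((contDiff_const.mul h1).cexp).of_le (by exact_mod_cast le_top)
  · exact tendsto_eLpNorm_sub_of_bounded (C := 1) hFm
      (fun n => Eventually.of_forall fun x => (norm_exp_I_mul _).le) hFe
  · have t := tendsto_eLpNorm_mul_sub (H := fun n x => Complex.I * fderiv ℝ (F n) x v)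
      (h := fun x => Complex.I * φ' x) hFm
      (fun n => Eventually.of_forall fun x => (norm_exp_I_mul _).le) hFe
      (hφ'K.ofReal.const_mul Complex.I)
      (fun n => (Complex.continuous_ofReal.comp_aestronglyMeasurable (hFdm n)).const_mul _)
      (hFd.congr fun n => by
        refine eLpNorm_congr_norm_ae (Eventually.of_forall fun x => ?_)
        rw [← mul_sub, norm_mul, Complex.norm_I, one_mul, ← Complex.ofReal_sub,
          Complex.norm_real])
    refine t.congr fun n => ?_
    congr 1
    ext x
    rw [(hd n x).fderiv]
    simp

/-- A weak derivative of an `𝕊¹`-valued function is tangent to the circle. -/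
theorem IsWeakDeriv.eq_of_norm_eq_one (hΩ : IsOpen Ω) {u u' : ℂ → ℂ} (h : IsWeakDeriv Ω v u u')
    (hu : ∀ᵐ x ∂volume.restrict Ω, ‖u x‖ = 1) :
    ∀ᵐ x ∂volume.restrict Ω, u' x = u x * (Complex.I * ((starRingEnd ℂ (u x) * u' x).im : ℝ)) := by
  have hc : IsWeakDeriv Ω v (fun x => starRingEnd ℂ (u x)) (fun x => starRingEnd ℂ (u' x)) := by
    simpa using h.clm_comp Complex.conjCLE.toContinuousLinearMap
  have hm := h.mul hΩ zero_le_one hc (hu.mono fun x hx => hx.le)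
    (hu.mono fun x hx => by simp [hx])
  have h1 : IsWeakDeriv Ω v (fun x => u x * starRingEnd ℂ (u x)) (fun _ => 0) := by
    refine (isWeakDeriv_const (1 : ℂ)).congr ?_ EventuallyEq.rfl
    filter_upwards [hu] with x hx
    rw [Complex.mul_conj, Complex.normSq_eq_norm_sq, hx]
    simp
  filter_upwards [hm.ae_eq hΩ h1, hu] with x hx hux
  have h2 : u x * starRingEnd ℂ (u x) = 1 := by
    rw [Complex.mul_conj, Complex.normSq_eq_norm_sq, hux]
    simp
  have h3 : (starRingEnd ℂ (u x) * u' x).re = 0 := by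
    have := congrArg Complex.re hx
    simp only [Complex.add_re, Complex.mul_re, Complex.conj_re, Complex.conj_im,
      Complex.zero_re] at this
    rw [Complex.mul_re, Complex.conj_re, Complex.conj_im]
    linarith
  have h4 : Complex.I * ((starRingEnd ℂ (u x) * u' x).im : ℝ) = starRingEnd ℂ (u x) * u' x := by
    apply Complex.ext <;> simp [h3, - Complex.mul_re, - Complex.mul_im, Complex.I_mul_re,
      Complex.I_mul_im]
  rw [h4, ← mul_assoc, h2, one_mul]

/-- The weak derivative of a lifting `φ` of `u` is the angular part of the weak derivative
of `u`. -/
theorem ae_eq_of_eq_exp (hΩ : IsOpen Ω) {u u' : ℂ → ℂ} {φ φ' : ℂ → ℝ} (hu : IsWeakDeriv Ω v u u')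
    (hφ : IsWeakDeriv Ω v φ φ')
    (h : ∀ᵐ x ∂volume.restrict Ω, u x = Complex.exp (Complex.I * φ x)) :
    ∀ᵐ x ∂volume.restrict Ω, u' x = u x * (Complex.I * φ' x) := by
  have h1 := (hφ.exp_I_mul hΩ).congr (h.mono fun x hx => hx.symm) EventuallyEq.rfl
  filter_upwards [hu.ae_eq hΩ h1, h] with x h2 h3
  rw [h2, h3]

/-- If the weak derivative of `φ` is the angular part of that of `u`, then `u e^{-iφ}` has
vanishing weak derivative. -/
theorem isWeakDeriv_mul_exp_neg (hΩ : IsOpen Ω) {u u' : ℂ → ℂ} {φ : ℂ → ℝ}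
    (hu : IsWeakDeriv Ω v u u') (hu1 : ∀ᵐ x ∂volume.restrict Ω, ‖u x‖ = 1)
    (hφ : IsWeakDeriv Ω v φ fun x => (starRingEnd ℂ (u x) * u' x).im) :
    IsWeakDeriv Ω v (fun x => u x * Complex.exp (Complex.I * ((-φ x : ℝ) : ℂ))) (fun _ => 0) := by
  have hn : IsWeakDeriv Ω v (fun x => -φ x) fun x => -(starRingEnd ℂ (u x) * u' x).im := by
    simpa using hφ.clm_comp (-ContinuousLinearMap.id ℝ ℝ)
  refine (hu.mul hΩ zero_le_one (hn.exp_I_mul hΩ) (hu1.mono fun x hx => hx.le)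
    (Eventually.of_forall fun x => (norm_exp_I_mul _).le)).congr EventuallyEq.rfl ?_
  filter_upwards [hu.eq_of_norm_eq_one hΩ hu1] with x hx
  nth_rw 1 [hx]
  push_cast
  ring

end Calculus

/-! ### Functions with vanishing gradient -/

section Constant

variable {E : Type*} [NormedAddCommGroup E] [NormedSpace ℝ E] {Ω : Set ℂ}

theorem ae_of_locally {X : Type*} [TopologicalSpace X] [SecondCountableTopology X]
    [MeasurableSpace X] {μ : Measure X} {S : Set X} {P : X → Prop}
    (h : ∀ z ∈ S, ∃ U, IsOpen U ∧ z ∈ U ∧ ∀ᵐ x ∂μ, x ∈ U → x ∈ S → P x) :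
    ∀ᵐ x ∂μ, x ∈ S → P x := by
  rw [ae_iff]
  refine measure_null_of_locally_null _ fun z hz => ?_
  simp only [mem_ofPred_eq, Classical.not_imp] at hz
  obtain ⟨U, hU, hzU, hUP⟩ := h z hz.1
  refine ⟨U ∩ {x | ¬ (x ∈ S → P x)}, ?_, ?_⟩
  · exact inter_mem (mem_nhdsWithin_of_mem_nhds (hU.mem_nhds hzU)) self_mem_nhdsWithin
  · rw [ae_iff] at hUP
    refine measure_mono_null (fun x hx => ?_) hUP
    simp only [mem_ofPred_eq, Classical.not_imp] at hx ⊢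
    exact ⟨hx.1, hx.2⟩

theorem eq_of_ae_eq_const {α : Type*} {U V : Set ℂ} {f : ℂ → α} {a b : α} (hU : IsOpen U)
    (hV : IsOpen V) {z : ℂ} (hzU : z ∈ U) (hzV : z ∈ V) (ha : ∀ᵐ x, x ∈ U → f x = a)
    (hb : ∀ᵐ x, x ∈ V → f x = b) : a = b := by
  have h0 : 0 < volume (U ∩ V) := (hU.inter hV).measure_pos volume ⟨z, hzU, hzV⟩
  obtain ⟨x, ⟨hxU, hxV⟩, hxa, hxb⟩ : ∃ x ∈ U ∩ V, (x ∈ U → f x = a) ∧ (x ∈ V → f x = b) := by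
    by_contra hcon
    push Not at hcon
    have h1 : ∀ᵐ x, x ∉ U ∩ V := by
      filter_upwards [ha, hb] with x h1 h2 hx
      exact (hcon x hx h1).2 (h2 (hcon x hx h1).1)
    exact h0.ne' (measure_eq_zero_iff_ae_notMem.2 h1)
  exact (hxa hxU).symm.trans (hxb hxV)

theorem exists_ae_eq_const_of_locally {α : Type*} [Nonempty α] {f : ℂ → α}
    (hc : IsPreconnected Ω)
    (h : ∀ z ∈ Ω, ∃ U, IsOpen U ∧ z ∈ U ∧ ∃ c, ∀ᵐ x, x ∈ U → f x = c) :
    ∃ c, ∀ᵐ x, x ∈ Ω → f x = c := by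
  rcases Ω.eq_empty_or_nonempty with rfl | ⟨z₀, hz₀⟩
  · exact ⟨Classical.arbitrary α, by simp⟩
  choose! U hU hzU c hUc using h
  refine ⟨c z₀, ae_of_locally fun z hz => ⟨U z, hU z hz, hzU z hz, ?_⟩⟩
  suffices h : c z = c z₀ by
    filter_upwards [hUc z hz] with x hx hxU _
    rw [hx hxU, h]
  by_contra hne
  have hA : IsOpen (⋃ w ∈ {w ∈ Ω | c w = c z₀}, U w) :=
    isOpen_biUnion fun w hw => hU w hw.1
  have hB : IsOpen (⋃ w ∈ {w ∈ Ω | c w ≠ c z₀}, U w) :=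
    isOpen_biUnion fun w hw => hU w hw.1
  obtain ⟨x, -, hxA, hxB⟩ := hc _ _ hA hB (fun w hw => by
      by_cases hcw : c w = c z₀
      · exact Or.inl (mem_biUnion (show w ∈ {w ∈ Ω | c w = c z₀} from ⟨hw, hcw⟩) (hzU w hw))
      · exact Or.inr (mem_biUnion (show w ∈ {w ∈ Ω | c w ≠ c z₀} from ⟨hw, hcw⟩) (hzU w hw)))
    ⟨z₀, hz₀, mem_biUnion (show z₀ ∈ {w ∈ Ω | c w = c z₀} from ⟨hz₀, rfl⟩) (hzU z₀ hz₀)⟩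
    ⟨z, hz, mem_biUnion (show z ∈ {w ∈ Ω | c w ≠ c z₀} from ⟨hz, hne⟩) (hzU z hz)⟩
  simp only [mem_iUnion] at hxA hxB
  obtain ⟨w, hw, hxw⟩ := hxA
  obtain ⟨w', hw', hxw'⟩ := hxB
  exact hw'.2 ((eq_of_ae_eq_const (hU w hw.1) (hU w' hw'.1) hxw hxw' (hUc w hw.1)
    (hUc w' hw'.1)).symm.trans hw.2)

/-- A function with vanishing weak gradient on a connected open set is constant: its
mollifications are locally constant. -/
theorem exists_ae_eq_const [CompleteSpace E] {f : ℂ → E} (hΩ : IsOpen Ω) (hc : IsPreconnected Ω)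
    (h1 : IsWeakDeriv Ω 1 f fun _ => 0) (h2 : IsWeakDeriv Ω Complex.I f fun _ => 0) :
    ∃ c, ∀ᵐ x ∂volume.restrict Ω, f x = c := by
  simp only [ae_restrict_iff' hΩ.measurableSet]
  refine exists_ae_eq_const_of_locally hc fun z hz => ?_
  obtain ⟨r, hr, hrΩ⟩ := Metric.isOpen_iff.1 hΩ z hz
  refine ⟨Metric.ball z (r / 4), Metric.isOpen_ball, Metric.mem_ball_self (by positivity), ?_⟩
  set L := Metric.closedBall z (r / 2) with hL
  have hLΩ : L ⊆ Ω := (Metric.closedBall_subset_ball (by linarith)).trans hrΩ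
  have hfl : LocallyIntegrable (L.indicator f) :=
    ((integrable_indicator_iff Metric.isClosed_closedBall.measurableSet).2
      (h1.1.integrableOn_compact_subset hLΩ (isCompact_closedBall z _))).locallyIntegrable
  have hcst : ∀ᶠ n in atTop, ∀ x ∈ Metric.ball z (r / 4),
      moll n (L.indicator f) x = moll n (L.indicator f) z := by
    filter_upwards [tendsto_bump_rOut.eventually_lt_const (show 0 < r / 4 by positivity)]
      with n hn x hx
    rw [bump_rOut] at hn
    have hd : ∀ y ∈ Metric.ball z (r / 4), fderiv ℝ (moll n (L.indicator f)) y = 0 := by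
      intro y hy
      have hyL : Metric.closedBall y (1 / ((n : ℝ) + 1)) ⊆ L :=
        Metric.closedBall_subset_closedBall' (by linarith [Metric.mem_ball.1 hy])
      have e1 := fderiv_moll_apply h1 hfl n (hyL.trans hLΩ) hyL
      have e2 := fderiv_moll_apply h2 hfl n (hyL.trans hLΩ) hyL
      have hz0 : moll n (L.indicator fun _ => (0 : E)) y = 0 := by
        simp [moll_apply]
      rw [hz0] at e1 e2
      ext w
      rw [← Complex.re_add_im w, map_add]
      have h3 : (w.re : ℂ) = w.re • (1 : ℂ) := by simp
      have h4 : (w.im : ℂ) * Complex.I = w.im • Complex.I := by simp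
      rw [h3, h4, map_smul, map_smul, e1, e2]
      simp
    exact (convex_ball z (r / 4)).is_const_of_fderivWithin_eq_zero
      ((contDiff_moll n hfl).differentiable (by simp)).differentiableOn
      (fun y hy => by rw [fderivWithin_of_isOpen Metric.isOpen_ball hy, hd y hy]) hx
      (Metric.mem_ball_self (by positivity))
  have hlim := ae_tendsto_moll hfl
  have hne : (volume.restrict (Metric.ball z (r / 4))) ≠ 0 := by
    rw [Ne, Measure.restrict_eq_zero]
    exact (Metric.measure_ball_pos volume z (by positivity)).ne'
  have : (ae (volume.restrict (Metric.ball z (r / 4)))).NeBot := ae_neBot.2 hne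
  obtain ⟨y, hy, hyB⟩ := ((ae_restrict_of_ae hlim).and
    (ae_restrict_mem (μ := volume) (s := Metric.ball z (r / 4)) measurableSet_ball)).exists
  refine ⟨L.indicator f y, ?_⟩
  filter_upwards [hlim] with x hx hxB
  have hxL : x ∈ L := Metric.ball_subset_closedBall
    (Metric.ball_subset_ball (by linarith) hxB)
  rw [indicator_of_mem hxL] at hx
  refine tendsto_nhds_unique hx (hy.congr' ?_)
  filter_upwards [hcst] with n hn
  rw [hn x hxB, hn y hyB]

end Constant

/-! ### Restrictions to lines -/

section Lines

/-- The coordinates `(s, t) ↦ T (s + i (γ s + t))` of the plane, in which the graph of `γ`, moved by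
the isometry `T`, is the line `t = 0`, and in which the lines of direction `T i` are vertical. -/
noncomputable def graphChart (T : ℂ ≃ₗᵢ[ℝ] ℂ) (γ : ℝ → ℝ) (hγ : Continuous γ) : ℝ × ℝ ≃ₜ ℂ where
  toFun p := T ⟨p.1, γ p.1 + p.2⟩
  invFun z := ((T.symm z).re, (T.symm z).im - γ (T.symm z).re)
  left_inv p := by simp
  right_inv z := by simp
  continuous_toFun := by
    have : (fun p : ℝ × ℝ => T ⟨p.1, γ p.1 + p.2⟩)
        = fun p : ℝ × ℝ => T ((p.1 : ℂ) + ((γ p.1 + p.2 : ℝ) : ℂ) * Complex.I) := by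
      ext p
      rw [← Complex.mk_eq_add_mul_I]
    rw [this]
    fun_prop
  continuous_invFun := by fun_prop

variable {T : ℂ ≃ₗᵢ[ℝ] ℂ} {γ : ℝ → ℝ} {hγ : Continuous γ}

theorem graphChart_apply (p : ℝ × ℝ) : graphChart T γ hγ p = T ⟨p.1, γ p.1 + p.2⟩ := rfl

theorem graphChart_line (s t τ : ℝ) :
    graphChart T γ hγ (s, t + τ) = graphChart T γ hγ (s, t) + τ • T Complex.I := by
  rw [graphChart_apply, graphChart_apply, ← map_smul, ← map_add]
  congr 1
  apply Complex.ext <;> simp [add_assoc]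

theorem measurePreserving_graphChart :
    MeasurePreserving (graphChart T γ hγ) volume volume := by
  have h1 : MeasurePreserving (fun p : ℝ × ℝ => (p.1, γ p.1 + p.2)) volume volume :=
    (MeasurePreserving.id volume).skew_product (g := fun s t => γ s + t)
      (by fun_prop) (Eventually.of_forall fun s => (measurePreserving_add_left volume (γ s)).map_eq)
  have h2 := T.measurePreserving.comp
    ((Complex.volume_preserving_equiv_real_prod.symm _).comp h1)
  exact h2

/-- A sequence tending to `0` in `L¹` of a product has a subsequence whose integrals over almost
all lines parallel to either axis tend to `0`. -/
theorem exists_subseq_tendsto_marginals {α β : Type*} [MeasurableSpace α] [MeasurableSpace β]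
    {μ : Measure α} {ν : Measure β} [SFinite μ] [SFinite ν] {H : ℕ → α × β → ℝ≥0∞}
    (hm : ∀ n, AEMeasurable (H n) (μ.prod ν))
    (h : Tendsto (fun n => ∫⁻ p, H n p ∂μ.prod ν) atTop (𝓝 0)) :
    ∃ k : ℕ → ℕ, StrictMono k ∧
      (∀ᵐ s ∂μ, Tendsto (fun n => ∫⁻ t, H (k n) (s, t) ∂ν) atTop (𝓝 0)) ∧
      ∀ᵐ t ∂ν, Tendsto (fun n => ∫⁻ s, H (k n) (s, t) ∂μ) atTop (𝓝 0) := by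
  obtain ⟨k, hk, hkH⟩ := extraction_forall_of_eventually
    (P := fun n m => ∫⁻ p, H m p ∂μ.prod ν ≤ (2⁻¹ : ℝ≥0∞) ^ n)
    fun n => ENNReal.tendsto_nhds_zero.1 h _ (ENNReal.pow_pos (by simp) n)
  have hsum : ∑' n, ∫⁻ p, H (k n) p ∂μ.prod ν ≠ ⊤ := by
    refine ne_top_of_le_ne_top ?_ (ENNReal.tsum_le_tsum hkH)
    rw [ENNReal.tsum_geometric]
    simp
  refine ⟨k, hk, ?_, ?_⟩
  · have e : ∑' n, ∫⁻ p, H (k n) p ∂μ.prod ν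
        = ∫⁻ s, ∑' n, ∫⁻ t, H (k n) (s, t) ∂ν ∂μ := by
      rw [lintegral_tsum fun n => (hm (k n)).lintegral_prod_right']
      exact tsum_congr fun n => lintegral_prod _ (hm (k n))
    rw [e] at hsum
    filter_upwards [ae_lt_top' (AEMeasurable.tsum
      fun n => (hm (k n)).lintegral_prod_right') hsum] with s hs
    exact ENNReal.tendsto_atTop_zero_of_tsum_ne_top hs.ne
  · have hm' : ∀ n, AEMeasurable (fun t => ∫⁻ s, H (k n) (s, t) ∂μ) ν :=
      fun n => (hm (k n)).prod_swap.lintegral_prod_right'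
    have e : ∑' n, ∫⁻ p, H (k n) p ∂μ.prod ν
        = ∫⁻ t, ∑' n, ∫⁻ s, H (k n) (s, t) ∂μ ∂ν := by
      rw [lintegral_tsum hm']
      exact tsum_congr fun n => lintegral_prod_symm _ (hm (k n))
    rw [e] at hsum
    filter_upwards [ae_lt_top' (AEMeasurable.tsum
      hm') hsum] with t ht
    exact ENNReal.tendsto_atTop_zero_of_tsum_ne_top ht.ne

theorem graphChart_restrict (A B : Set ℝ) :
    MeasurePreserving (graphChart T γ hγ)
      ((volume.restrict (A)).prod (volume.restrict (B)))
      (volume.restrict (graphChart T γ hγ '' (A ×ˢ B))) := by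
  have h := (measurePreserving_graphChart (T := T) (γ := γ) (hγ := hγ)).restrict_preimage_emb
    (graphChart T γ hγ).measurableEmbedding (graphChart T γ hγ '' (A ×ˢ B))
  rwa [preimage_image_eq _ (graphChart T γ hγ).injective, Measure.volume_eq_prod,
    ← Measure.prod_restrict] at h

theorem tendsto_integral_Ioc_of_lintegral {E : Type*} [NormedAddCommGroup E] [NormedSpace ℝ E]
    {c d : ℝ} {G : ℕ → ℝ → E} {g : ℝ → E} (hG : ∀ n, Continuous (G n))
    (hg : IntegrableOn g (Icc c d))
    (h : Tendsto (fun n => ∫⁻ t in Icc c d, ‖G n t - g t‖ₑ) atTop (𝓝 0)) {x y : ℝ}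
    (hx : x ∈ Icc c d) (hy : y ∈ Icc c d) :
    Tendsto (fun n => ∫ t in x..y, G n t) atTop (𝓝 (∫ t in x..y, g t)) := by
  have key : ∀ {x y : ℝ}, x ∈ Icc c d → y ∈ Icc c d →
      Tendsto (fun n => ∫ t in Ioc x y, G n t) atTop (𝓝 (∫ t in Ioc x y, g t)) := by
    intro x y hx hy
    have h1 := tendsto_setIntegral_of_L1' (μ := volume.restrict (Icc c d)) g
      hg.aestronglyMeasurable (F := G) (l := atTop)
      (Eventually.of_forall fun n => (hG n).continuousOn.integrableOn_Icc)
      (by simpa [eLpNorm_one_eq_lintegral_enorm] using h) (Ioc x y)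
    rwa [Measure.restrict_restrict_of_subset
      ((Ioc_subset_Icc_self).trans (Icc_subset_Icc hx.1 hy.2))] at h1
  exact (key hx hy).sub (key hy hx)

/-- On almost every line, a weakly differentiable function is an indefinite integral of its
weak derivative. -/
theorem IsWeakDeriv.ae_line {E : Type*} [NormedAddCommGroup E] [NormedSpace ℝ E] [CompleteSpace E]
    {Ω : Set ℂ} {f f' : ℂ → E} (hΩ : IsOpen Ω)
    (hf : IsWeakDeriv Ω (T Complex.I) f f') {a b c d : ℝ} (hcd : c < d)
    (hsub : graphChart T γ hγ '' (Icc a b ×ˢ Icc c d) ⊆ Ω) :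
    ∀ᵐ s ∂volume.restrict (Icc a b),
      IntegrableOn (fun t => f' (graphChart T γ hγ (s, t))) (Icc c d) ∧
      ∃ C, ∀ᵐ t ∂volume.restrict (Icc c d),
        f (graphChart T γ hγ (s, t)) = C + ∫ τ in c..t, f' (graphChart T γ hγ (s, τ)) := by
  set Θ := graphChart T γ hγ with hΘ
  set K := Θ '' (Icc a b ×ˢ Icc c d) with hK
  have hKc : IsCompact K := (isCompact_Icc.prod isCompact_Icc).image Θ.continuous
  have hmp : MeasurePreserving Θ ((volume.restrict (Icc a b)).prod (volume.restrict (Icc c d)))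
    (volume.restrict K) :=
    graphChart_restrict _ _
  obtain ⟨G, hGs, hGlim, -, -, hGd⟩ := exists_smooth_approx hΩ hf.1 hKc hsub
  replace hGd := hGd (T Complex.I) f' (fun x hx => ⟨Ω, hΩ, hx, hf⟩) 1 le_rfl ENNReal.one_ne_top
    (memLp_one_of_locallyIntegrableOn hf.2.1)
  have hf'K := hf.2.1.integrableOn_compact_subset hsub hKc
  have hdc := fun n => continuous_fderiv_apply (hGs n) (T Complex.I)
  simp only [eLpNorm_one_eq_lintegral_enorm] at hGd
  have hH : ∀ n, AEMeasurable (fun p => ‖fderiv ℝ (G n) (Θ p) (T Complex.I) - f' (Θ p)‖ₑ)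
      ((volume.restrict (Icc a b)).prod (volume.restrict (Icc c d))) := fun n =>
    (((hdc n).aestronglyMeasurable.sub hf'K.aestronglyMeasurable).comp_measurePreserving hmp).enorm
  obtain ⟨k, hk, hks, -⟩ := exists_subseq_tendsto_marginals hH (hGd.congr fun n =>
    (hmp.lintegral_comp_emb Θ.measurableEmbedding
      (fun x => ‖fderiv ℝ (G n) x (T Complex.I) - f' x‖ₑ)).symm)
  have hlim := Measure.ae_ae_of_ae_prod (hmp.quasiMeasurePreserving.ae hGlim)
  have hint := ((hmp.integrable_comp_emb Θ.measurableEmbedding).2 hf'K).prod_right_ae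
  filter_upwards [hks, hlim, hint] with s h1 h2 h3
  refine ⟨h3, ?_⟩
  have hline : Continuous fun t : ℝ => Θ (s, t) := Θ.continuous.comp (by fun_prop)
  have hder : ∀ n t, HasDerivAt (fun t => G n (Θ (s, t)))
      (fderiv ℝ (G n) (Θ (s, t)) (T Complex.I)) t := by
    intro n t
    have e : (fun t : ℝ => Θ (s, t)) = fun t : ℝ => Θ (s, 0) + t • T Complex.I := by
      ext t
      rw [hΘ, ← graphChart_line, zero_add]
    have h4 : HasDerivAt (fun t : ℝ => Θ (s, t)) (T Complex.I) t := by
      rw [e]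
      simpa using ((hasDerivAt_id t).smul_const (T Complex.I)).const_add (Θ (s, 0))
    exact (((hGs n).differentiable (by simp)) (Θ (s, t))).hasFDerivAt.comp_hasDerivAt t h4
  have hcont : ∀ n, Continuous fun t => fderiv ℝ (G n) (Θ (s, t)) (T Complex.I) :=
    fun n => (hdc n).comp hline
  have hftc : ∀ n t, G n (Θ (s, t)) = G n (Θ (s, c))
      + ∫ τ in c..t, fderiv ℝ (G n) (Θ (s, τ)) (T Complex.I) := by
    intro n t
    rw [intervalIntegral.integral_eq_sub_of_hasDerivAt (fun x _ => hder n x)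
      ((hcont n).intervalIntegrable _ _)]
    abel
  have hI : ∀ t ∈ Icc c d, Tendsto (fun n => ∫ τ in c..t,
      fderiv ℝ (G (k n)) (Θ (s, τ)) (T Complex.I)) atTop (𝓝 (∫ τ in c..t, f' (Θ (s, τ)))) :=
    fun t ht => tendsto_integral_Ioc_of_lintegral (fun n => hcont (k n)) h3 h1
      (left_mem_Icc.2 hcd.le) ht
  have hne : (volume.restrict (Icc c d)) ≠ 0 := by
    rw [Ne, Measure.restrict_eq_zero, Real.volume_Icc, ENNReal.ofReal_eq_zero]
    linarith
  have : (ae (volume.restrict (Icc c d))).NeBot := ae_neBot.2 hne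
  obtain ⟨t₀, ht₀, ht₀m⟩ := (h2.and (ae_restrict_mem (μ := volume) (s := Icc c d)
    measurableSet_Icc)).exists
  have hC : Tendsto (fun n => G (k n) (Θ (s, c))) atTop
      (𝓝 (f (Θ (s, t₀)) - ∫ τ in c..t₀, f' (Θ (s, τ)))) := by
    refine ((ht₀.comp hk.tendsto_atTop).sub (hI t₀ ht₀m)).congr fun n => ?_
    simp only [Function.comp_apply]
    rw [hftc (k n) t₀, add_sub_cancel_right]
  refine ⟨f (Θ (s, t₀)) - ∫ τ in c..t₀, f' (Θ (s, τ)), ?_⟩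
  filter_upwards [h2, ae_restrict_mem measurableSet_Icc] with t ht htm
  refine tendsto_nhds_unique (ht.comp hk.tendsto_atTop) ((hC.add (hI t htm)).congr fun n => ?_)
  simp only [Function.comp_apply]
  rw [hftc (k n) t]

end Lines

/-! ### Closed fields on a rectangle -/

section Rectangle

/-- The integrals over vertical lines of an `L²` function are in `L²`, by the Cauchy–Schwarz
inequality. -/
theorem memLp_marginal {α β E : Type*} [MeasurableSpace α] [MeasurableSpace β]
    [NormedAddCommGroup E] {μ : Measure α} {ν : Measure β} [IsFiniteMeasure μ] [IsFiniteMeasure ν]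
    {f : α × β → E} (hf : MemLp f 2 (μ.prod ν)) :
    MemLp (fun x => (∫⁻ t, ‖f (x, t)‖ₑ ∂ν).toReal) 2 μ := by
  have hm : AEMeasurable (fun x => ∫⁻ t, ‖f (x, t)‖ₑ ∂ν) μ :=
    hf.aestronglyMeasurable.enorm.lintegral_prod_right'
  refine ⟨hm.ennreal_toReal.aestronglyMeasurable, ?_⟩
  rw [eLpNorm_lt_top_iff_lintegral_rpow_enorm_lt_top (by norm_num) (by norm_num)]
  have hf2 := (eLpNorm_lt_top_iff_lintegral_rpow_enorm_lt_top (by norm_num) (by norm_num)).1 hf.2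
  rw [lintegral_prod _ (hf.aestronglyMeasurable.enorm.pow_const _)] at hf2
  refine lt_of_le_of_lt (b := ∫⁻ x, ν univ * ∫⁻ t, ‖f (x, t)‖ₑ ^ (2 : ℝ≥0∞).toReal ∂ν ∂μ) ?_ ?_
  · have hfx : ∀ᵐ x ∂μ, AEStronglyMeasurable (fun t => f (x, t)) ν :=
      hf.aestronglyMeasurable.prodMk_left
    refine lintegral_mono_ae ?_
    filter_upwards [hfx] with x hx
    have h1 := eLpNorm_le_eLpNorm_mul_rpow_measure_univ (p := 1) (q := 2) (by norm_num) hx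
    rw [eLpNorm_one_eq_lintegral_enorm,
      eLpNorm_eq_lintegral_rpow_enorm_toReal (by norm_num) (by norm_num)] at h1
    calc ‖(∫⁻ t, ‖f (x, t)‖ₑ ∂ν).toReal‖ₑ ^ (2 : ℝ≥0∞).toReal
        ≤ (∫⁻ t, ‖f (x, t)‖ₑ ∂ν) ^ (2 : ℝ≥0∞).toReal := by
          gcongr
          rw [Real.enorm_of_nonneg ENNReal.toReal_nonneg]
          exact ENNReal.ofReal_toReal_le
      _ ≤ _ := by
          grw [h1]
          rw [ENNReal.mul_rpow_of_nonneg _ _ (by norm_num), ← ENNReal.rpow_mul, ← ENNReal.rpow_mul,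
            mul_comm]
          norm_num
  · rw [lintegral_const_mul' _ _ (measure_ne_top ν univ)]
    exact ENNReal.mul_lt_top (measure_lt_top ν univ) hf2

/-- Integration by parts for an absolutely continuous function and a test function. -/
theorem integral_deriv_mul_primitive {h : ℝ → ℝ} {c d : ℝ} (hcd : c ≤ d)
    (hh : IntegrableOn h (Icc c d)) (C : ℝ) {ψ : ℝ → ℝ} (hψ : ContDiff ℝ 1 ψ)
    (hc : ψ c = 0) (hd : ψ d = 0) :
    ∫ t in c..d, deriv ψ t * (C + ∫ τ in c..t, h τ) = - ∫ t in c..d, ψ t * h t := by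
  have hi : IntervalIntegrable h volume c d :=
    (intervalIntegrable_iff_integrableOn_Icc_of_le hcd).2 hh
  set f : ℝ → ℝ := fun t => C + ∫ τ in c..t, h τ with hf
  have hac1 : AbsolutelyContinuousOnInterval (fun _ : ℝ => C) c d :=
    (contDiff_const (n := 1)).contDiffOn.absolutelyContinuousOnInterval
  have hac : AbsolutelyContinuousOnInterval f c d :=
    hac1.add (hi.absolutelyContinuousOnInterval_intervalIntegral left_mem_uIcc)
  have hψac : AbsolutelyContinuousOnInterval ψ c d := hψ.contDiffOn.absolutelyContinuousOnInterval
  have h1 := hψac.integral_mul_deriv_eq_deriv_mul hac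
  rw [hc, hd, zero_mul, zero_mul, sub_zero, zero_sub] at h1
  rw [← neg_eq_iff_eq_neg, ← h1]
  refine intervalIntegral.integral_congr_ae ?_
  filter_upwards [hi.ae_hasDerivAt_integral] with t ht htm
  have h2 := (ht (uIoc_subset_uIcc htm) c left_mem_uIcc).const_add C
  rw [h2.deriv]

variable {T : ℂ ≃ₗᵢ[ℝ] ℂ} {γ : ℝ → ℝ} {hγ : Continuous γ}

/-- A function which on almost every line is an indefinite integral of `f'` has weak
derivative `f'`. -/
theorem isWeakDeriv_of_ae_line {f f' : ℂ → ℝ} {a b c d : ℝ} (hcd : c < d)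
    (hf : LocallyIntegrableOn f (graphChart T γ hγ '' (Ioo a b ×ˢ Ioo c d)))
    (hf' : LocallyIntegrableOn f' (graphChart T γ hγ '' (Ioo a b ×ˢ Ioo c d)))
    (h : ∀ᵐ s ∂volume.restrict (Icc a b),
      IntegrableOn (fun t => f' (graphChart T γ hγ (s, t))) (Icc c d) ∧
      ∃ C, ∀ᵐ t ∂volume.restrict (Icc c d),
        f (graphChart T γ hγ (s, t)) = C + ∫ τ in c..t, f' (graphChart T γ hγ (s, τ))) :
    IsWeakDeriv (graphChart T γ hγ '' (Ioo a b ×ˢ Ioo c d)) (T Complex.I) f f' := by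
  set Θ := graphChart T γ hγ with hΘ
  set R := Θ '' (Ioo a b ×ˢ Ioo c d) with hR
  refine ⟨hf, hf', fun ψ h1 h2 h3 => ?_⟩
  have hmp : MeasurePreserving Θ volume volume := measurePreserving_graphChart
  have i1 : IntegrableOn (fun x => fderiv ℝ ψ x (T Complex.I) • f x) R :=
    (integrable_smul_of_locallyIntegrableOn hf h2 h3 (continuous_fderiv_apply h1 _)
      fun x hx => fderiv_apply_eq_zero_of_notMem hx _).integrableOn
  have i2 : IntegrableOn (fun x => ψ x • f' x) R :=
    (integrable_smul_of_locallyIntegrableOn hf' h2 h3 h1.continuous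
      fun x hx => image_eq_zero_of_notMem_tsupport hx).integrableOn
  have key : ∀ g : ℂ → ℝ, IntegrableOn g R →
      ∫ x in R, g x = ∫ s in Ioo a b, ∫ t in Ioo c d, g (Θ (s, t)) := by
    intro g hg
    rw [hR, hmp.setIntegral_image_emb Θ.measurableEmbedding, Measure.volume_eq_prod,
      setIntegral_prod]
    rw [← Measure.volume_eq_prod]
    have := (hmp.integrableOn_comp_preimage Θ.measurableEmbedding (s := R)).2 hg
    rwa [hR, preimage_image_eq _ Θ.injective] at this
  rw [key _ i1, key _ i2, ← integral_neg]
  refine integral_congr_ae ?_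
  have h' := ae_restrict_of_ae_restrict_of_subset Ioo_subset_Icc_self h
  filter_upwards [h'] with s ⟨hs1, C, hC⟩
  have hline : ∀ t : ℝ, HasDerivAt (fun t : ℝ => Θ (s, t)) (T Complex.I) t := by
    intro t
    have e : (fun t : ℝ => Θ (s, t)) = fun t : ℝ => Θ (s, 0) + t • T Complex.I := by
      ext t
      rw [hΘ, ← graphChart_line, zero_add]
    rw [e]
    simpa using ((hasDerivAt_id t).smul_const (T Complex.I)).const_add (Θ (s, 0))
  have hψs : ContDiff ℝ 1 fun t : ℝ => ψ (Θ (s, t)) := by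
    have e : (fun t : ℝ => Θ (s, t)) = fun t : ℝ => Θ (s, 0) + t • T Complex.I := by
      ext t
      rw [hΘ, ← graphChart_line, zero_add]
    have h4 : ContDiff ℝ 1 fun t : ℝ => Θ (s, t) := by
      rw [e]
      fun_prop
    exact (h1.of_le (by exact_mod_cast le_top)).comp h4
  have hd : ∀ t, deriv (fun t => ψ (Θ (s, t))) t = fderiv ℝ ψ (Θ (s, t)) (T Complex.I) := fun t =>
    (((h1.differentiable (by simp)) (Θ (s, t))).hasFDerivAt.comp_hasDerivAt t (hline t)).deriv
  have hout : ∀ t, t ∉ Ioo c d → ψ (Θ (s, t)) = 0 := by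
    intro t ht
    refine image_eq_zero_of_notMem_tsupport fun hmem => ht ?_
    obtain ⟨p, hp, hpe⟩ := h3 hmem
    rw [Θ.injective hpe] at hp
    exact hp.2
  have hmain := integral_deriv_mul_primitive hcd.le hs1 C hψs (hout c (by simp)) (hout d (by simp))
  rw [intervalIntegral.integral_of_le hcd.le, intervalIntegral.integral_of_le hcd.le,
    integral_Ioc_eq_integral_Ioo, integral_Ioc_eq_integral_Ioo] at hmain
  simp only [smul_eq_mul]
  rw [← hmain]
  refine integral_congr_ae ?_
  filter_upwards [ae_restrict_of_ae_restrict_of_subset Ioo_subset_Icc_self hC] with t ht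
  rw [hd, ht]

/-- Green's formula for the angular form `Im (ḡ dg)` of a smooth function `g`. -/
theorem green_angular_form {g : ℝ × ℝ → ℂ} (hg : ContDiff ℝ ∞ g) (x₀ x y₀ y : ℝ) :
    (∫ s in x₀..x, (starRingEnd ℂ (g (s, y₀)) * fderiv ℝ g (s, y₀) (1, 0)).im)
      + (∫ t in y₀..y, (starRingEnd ℂ (g (x, t)) * fderiv ℝ g (x, t) (0, 1)).im)
    = (∫ t in y₀..y, (starRingEnd ℂ (g (x₀, t)) * fderiv ℝ g (x₀, t) (0, 1)).im)
      + (∫ s in x₀..x, (starRingEnd ℂ (g (s, y)) * fderiv ℝ g (s, y) (1, 0)).im)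
      + ∫ s in x₀..x, ∫ t in y₀..y,
        2 * (starRingEnd ℂ (fderiv ℝ g (s, t) (1, 0)) * fderiv ℝ g (s, t) (0, 1)).im := by
  set B : ℂ →L[ℝ] ℂ →L[ℝ] ℝ := (ContinuousLinearMap.compL ℝ ℂ ℂ ℝ Complex.imCLM).comp
    ((ContinuousLinearMap.mul ℝ ℂ).comp Complex.conjCLE.toContinuousLinearMap) with hB
  have hBa : ∀ z w, B z w = (starRingEnd ℂ z * w).im := fun z w => rfl
  have hg1 : Differentiable ℝ g := hg.differentiable (by simp)
  have hg2 : ContDiff ℝ ∞ (fderiv ℝ g) := hg.fderiv_right (by simp)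
  have hg2d : Differentiable ℝ (fderiv ℝ g) := hg2.differentiable (by simp)
  have hD : ∀ (e p : ℝ × ℝ), HasFDerivAt (fun p => B (g p) (fderiv ℝ g p e))
      ((B (g p)).comp ((fderiv ℝ (fderiv ℝ g) p).flip e) +
        (B.flip (fderiv ℝ g p e)).comp (fderiv ℝ g p)) p := by
    intro e p
    have h1 : HasFDerivAt (fun p => fderiv ℝ g p e) ((fderiv ℝ (fderiv ℝ g) p).flip e) p := by
      have := (hg2d p).hasFDerivAt.clm_apply (hasFDerivAt_const e p)
      simpa using this
    have := B.hasFDerivAt_of_bilinear (hg1 p).hasFDerivAt h1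
    refine this.congr_fderiv ?_
    ext <;> simp
  have hsymm : ∀ p : ℝ × ℝ, fderiv ℝ (fderiv ℝ g) p (1, 0) (0, 1)
      = fderiv ℝ (fderiv ℝ g) p (0, 1) (1, 0) := fun p =>
    (hg.contDiffAt.isSymmSndFDerivAt
      (by
        rw [minSmoothness_of_isRCLikeNormedField]
        exact WithTop.coe_le_coe.2 (le_top : (2 : ℕ∞) ≤ ⊤))).eq _ _
  have hcont : ∀ e : ℝ × ℝ, Continuous fun p => B (g p) (fderiv ℝ g p e) := fun e =>
    continuous_iff_continuousAt.2 fun p => (hD e p).continuousAt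
  have hval : ∀ p : ℝ × ℝ,
      ((B (g p)).comp ((fderiv ℝ (fderiv ℝ g) p).flip (0, 1)) +
        (B.flip (fderiv ℝ g p (0, 1))).comp (fderiv ℝ g p)) (1, 0) +
      (-((B (g p)).comp ((fderiv ℝ (fderiv ℝ g) p).flip (1, 0)) +
        (B.flip (fderiv ℝ g p (1, 0))).comp (fderiv ℝ g p))) (0, 1)
      = 2 * (starRingEnd ℂ (fderiv ℝ g p (1, 0)) * fderiv ℝ g p (0, 1)).im := by
    intro p
    simp only [add_apply, ContinuousLinearMap.comp_apply,
      ContinuousLinearMap.flip_apply, neg_apply, hsymm, hBa]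
    simp only [Complex.mul_im, Complex.conj_re, Complex.conj_im]
    ring
  have hcv : Continuous fun p : ℝ × ℝ =>
      2 * (starRingEnd ℂ (fderiv ℝ g p (1, 0)) * fderiv ℝ g p (0, 1)).im := by
    have := hg2.continuous
    have h1 : Continuous fun p => fderiv ℝ g p (1, 0) := this.clm_apply continuous_const
    have h2 : Continuous fun p => fderiv ℝ g p (0, 1) := this.clm_apply continuous_const
    exact continuous_const.mul (Complex.continuous_im.comp
      ((Complex.continuous_conj.comp h1).mul h2))
  have h := integral2_divergence_prod_of_hasFDerivAt_off_countable
    (fun p => B (g p) (fderiv ℝ g p (0, 1))) (fun p => -B (g p) (fderiv ℝ g p (1, 0))) _ _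
    x₀ y₀ x y ∅ countable_empty (hcont _).continuousOn (hcont _).neg.continuousOn
    (fun p _ => hD (0, 1) p) (fun p _ => (hD (1, 0) p).neg) (by
      simp only [hval]
      exact hcv.continuousOn.integrableOn_compact (isCompact_uIcc.prod isCompact_uIcc))
  simp only [hval, intervalIntegral.integral_neg, hBa] at h
  linarith

end Rectangle

section RectanglePotential

theorem abs_intervalIntegral_le_toReal {g : ℝ → ℝ} {c d x y : ℝ} (hg : IntegrableOn g (Icc c d))
    (hx : x ∈ Icc c d) (hy : y ∈ Icc c d) :
    |∫ t in x..y, g t| ≤ (∫⁻ t in Icc c d, ‖g t‖ₑ).toReal := by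
  rw [← Real.norm_eq_abs, ← toReal_enorm]
  refine ENNReal.toReal_mono hg.2.ne ?_
  rw [← ofReal_norm, intervalIntegral.norm_intervalIntegral_eq, ofReal_norm]
  refine (enorm_integral_le_lintegral_enorm _).trans (lintegral_mono_set ?_)
  exact uIoc_subset_uIcc.trans (uIcc_subset_Icc hx hy)

/-- The `L¹` limit of fields `(P₁, P₂)` whose circulations along rectangles are the integrals of
functions `q` tending to `0` in `L¹` is a gradient: its circulation vanishes along almost every
rectangle, so that integration along two sides of a rectangle defines a potential. -/
theorem exists_potential_of_tendsto {a b c d : ℝ} (hab : a < b) (hcd : c < d) {f₁ f₂ : ℝ × ℝ → ℝ}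
    (hf₁ : Integrable f₁ ((volume.restrict (Icc a b)).prod (volume.restrict (Icc c d))))
    (hf₂ : Integrable f₂ ((volume.restrict (Icc a b)).prod (volume.restrict (Icc c d))))
    {P₁ P₂ q : ℕ → ℝ × ℝ → ℝ} (hP₁ : ∀ n, Continuous (P₁ n)) (hP₂ : ∀ n, Continuous (P₂ n))
    (hq : ∀ n, Continuous (q n))
    (h₁ : Tendsto (fun n => ∫⁻ p, ‖P₁ n p - f₁ p‖ₑ ∂(volume.restrict (Icc a b)).prod
      (volume.restrict (Icc c d))) atTop (𝓝 0))
    (h₂ : Tendsto (fun n => ∫⁻ p, ‖P₂ n p - f₂ p‖ₑ ∂(volume.restrict (Icc a b)).prod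
      (volume.restrict (Icc c d))) atTop (𝓝 0))
    (h₀ : Tendsto (fun n => ∫⁻ p, ‖q n p‖ₑ ∂(volume.restrict (Icc a b)).prod
      (volume.restrict (Icc c d))) atTop (𝓝 0))
    (hcirc : ∀ n x₀ x y₀ y, (∫ s in x₀..x, P₁ n (s, y₀)) + (∫ t in y₀..y, P₂ n (x, t))
      = (∫ t in y₀..y, P₂ n (x₀, t)) + (∫ s in x₀..x, P₁ n (s, y))
        + ∫ s in x₀..x, ∫ t in y₀..y, q n (s, t)) :
    ∃ φ : ℝ × ℝ → ℝ,
      AEStronglyMeasurable φ ((volume.restrict (Icc a b)).prod (volume.restrict (Icc c d))) ∧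
      (∃ A, ∀ᵐ p ∂(volume.restrict (Icc a b)).prod (volume.restrict (Icc c d)),
        |φ p| ≤ A + (∫⁻ t in Icc c d, ‖f₂ (p.1, t)‖ₑ).toReal) ∧
      (∀ᵐ x ∂volume.restrict (Icc a b), IntegrableOn (fun t => f₂ (x, t)) (Icc c d) ∧
        ∃ C, ∀ᵐ t ∂volume.restrict (Icc c d), φ (x, t) = C + ∫ τ in c..t, f₂ (x, τ)) ∧
      (∀ᵐ y ∂volume.restrict (Icc c d), IntegrableOn (fun s => f₁ (s, y)) (Icc a b) ∧
        ∃ C, ∀ᵐ s ∂volume.restrict (Icc a b), φ (s, y) = C + ∫ σ in a..s, f₁ (σ, y)) := by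
  set μ := volume.restrict (Icc a b) with hμ
  set ν := volume.restrict (Icc c d) with hν
  have hm₁ : ∀ n, AEMeasurable (fun p => ‖P₁ n p - f₁ p‖ₑ) (μ.prod ν) := fun n =>
    ((hP₁ n).aestronglyMeasurable.sub hf₁.aestronglyMeasurable).enorm
  have hm₂ : ∀ n, AEMeasurable (fun p => ‖P₂ n p - f₂ p‖ₑ) (μ.prod ν) := fun n =>
    ((hP₂ n).aestronglyMeasurable.sub hf₂.aestronglyMeasurable).enorm
  have hH : Tendsto (fun n => ∫⁻ p, (‖P₁ n p - f₁ p‖ₑ + ‖P₂ n p - f₂ p‖ₑ) ∂μ.prod ν) atTop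
      (𝓝 0) := by
    have := h₁.add h₂
    rw [add_zero] at this
    exact this.congr fun n => (lintegral_add_left' (hm₁ n) _).symm
  obtain ⟨k, hk, hks, hkt⟩ := exists_subseq_tendsto_marginals
    (fun n => (hm₁ n).add (hm₂ n)) hH
  set X : Set ℝ := {x | x ∈ Icc a b ∧ IntegrableOn (fun t => f₂ (x, t)) (Icc c d) ∧
    Tendsto (fun n => ∫⁻ t, ‖P₂ (k n) (x, t) - f₂ (x, t)‖ₑ ∂ν) atTop (𝓝 0)} with hX
  set Y : Set ℝ := {y | y ∈ Icc c d ∧ IntegrableOn (fun s => f₁ (s, y)) (Icc a b) ∧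
    Tendsto (fun n => ∫⁻ s, ‖P₁ (k n) (s, y) - f₁ (s, y)‖ₑ ∂μ) atTop (𝓝 0)} with hY
  have hXae : ∀ᵐ x ∂μ, x ∈ X := by
    filter_upwards [hks, hf₂.prod_right_ae, ae_restrict_mem measurableSet_Icc] with x h1 h2 h3
    refine ⟨h3, h2, tendsto_of_tendsto_of_tendsto_of_le_of_le tendsto_const_nhds h1
      (fun _ => zero_le) fun n => lintegral_mono fun t => ?_⟩
    exact le_add_self (a := ‖P₂ (k n) (x, t) - f₂ (x, t)‖ₑ)
      (b := ‖P₁ (k n) (x, t) - f₁ (x, t)‖ₑ)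
  have hYae : ∀ᵐ y ∂ν, y ∈ Y := by
    filter_upwards [hkt, hf₁.prod_left_ae, ae_restrict_mem measurableSet_Icc] with y h1 h2 h3
    refine ⟨h3, h2, tendsto_of_tendsto_of_tendsto_of_le_of_le tendsto_const_nhds h1
      (fun _ => zero_le) fun n => lintegral_mono fun t => ?_⟩
    exact le_self_add (a := ‖P₁ (k n) (t, y) - f₁ (t, y)‖ₑ)
      (b := ‖P₂ (k n) (t, y) - f₂ (t, y)‖ₑ)
  have hne : ∀ {a b : ℝ}, a < b → (ae (volume.restrict (Icc a b))).NeBot := by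
    intro a b hab
    rw [ae_neBot, Ne, Measure.restrict_eq_zero, Real.volume_Icc, ENNReal.ofReal_eq_zero]
    linarith
  obtain ⟨x₀, hx₀⟩ := @Eventually.exists _ _ _ (hne hab) hXae
  obtain ⟨y₀, hy₀⟩ := @Eventually.exists _ _ _ (hne hcd) hYae
  -- the integrals of the approximating fields along good lines converge
  have l₂ : ∀ x ∈ X, ∀ y ∈ Icc c d, ∀ y' ∈ Icc c d,
      Tendsto (fun n => ∫ t in y..y', P₂ (k n) (x, t)) atTop (𝓝 (∫ t in y..y', f₂ (x, t))) :=
    fun x hx y hy y' hy' => tendsto_integral_Ioc_of_lintegral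
      (fun n => (hP₂ (k n)).comp (by fun_prop)) hx.2.1 hx.2.2 hy hy'
  have l₁ : ∀ y ∈ Y, ∀ x ∈ Icc a b, ∀ x' ∈ Icc a b,
      Tendsto (fun n => ∫ s in x..x', P₁ (k n) (s, y)) atTop (𝓝 (∫ s in x..x', f₁ (s, y))) :=
    fun y hy x hx x' hx' => tendsto_integral_Ioc_of_lintegral
      (fun n => (hP₁ (k n)).comp (by fun_prop)) hy.2.1 hy.2.2 hx hx'
  have l₀ : ∀ x ∈ Icc a b, ∀ x' ∈ Icc a b, ∀ y ∈ Icc c d, ∀ y' ∈ Icc c d,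
      Tendsto (fun n => ∫ s in x..x', ∫ t in y..y', q n (s, t)) atTop (𝓝 0) := by
    intro x hx x' hx' y hy y' hy'
    rw [tendsto_zero_iff_enorm_tendsto_zero]
    refine tendsto_of_tendsto_of_tendsto_of_le_of_le tendsto_const_nhds h₀
      (fun _ => zero_le) fun n => ?_
    have e : ∀ {g : ℝ → ℝ} {x x' a b : ℝ}, x ∈ Icc a b → x' ∈ Icc a b →
        ‖∫ s in x..x', g s‖ₑ ≤ ∫⁻ s in Icc a b, ‖g s‖ₑ := by
      intro g x x' a b hx hx'
      rw [← ofReal_norm, intervalIntegral.norm_intervalIntegral_eq, ofReal_norm]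
      exact (enorm_integral_le_lintegral_enorm _).trans
        (lintegral_mono_set (uIoc_subset_uIcc.trans (uIcc_subset_Icc hx hx')))
    calc ‖∫ s in x..x', ∫ t in y..y', q n (s, t)‖ₑ
        ≤ ∫⁻ s in Icc a b, ‖∫ t in y..y', q n (s, t)‖ₑ := e hx hx'
      _ ≤ ∫⁻ s in Icc a b, ∫⁻ t in Icc c d, ‖q n (s, t)‖ₑ := lintegral_mono fun s => e hy hy'
      _ = ∫⁻ p, ‖q n p‖ₑ ∂μ.prod ν :=
        (lintegral_prod _ (hq n).aestronglyMeasurable.enorm).symm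
  -- the circulation of the limit field vanishes along good rectangles
  have hclosed : ∀ x ∈ X, ∀ y ∈ Y, (∫ s in x₀..x, f₁ (s, y₀)) + (∫ t in y₀..y, f₂ (x, t))
      = (∫ t in y₀..y, f₂ (x₀, t)) + ∫ s in x₀..x, f₁ (s, y) := by
    intro x hx y hy
    have r := ((l₂ x₀ hx₀ y₀ hy₀.1 y hy.1).add (l₁ y hy x₀ hx₀.1 x hx.1)).add
      ((l₀ x₀ hx₀.1 x hx.1 y₀ hy₀.1 y hy.1).comp hk.tendsto_atTop)
    rw [add_zero] at r
    exact tendsto_nhds_unique (((l₁ y₀ hy₀ x₀ hx₀.1 x hx.1).add (l₂ x hx y₀ hy₀.1 y hy.1)).congr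
      fun n => hcirc (k n) x₀ x y₀ y) r
  have hfst : ∀ᵐ p ∂μ.prod ν, p.1 ∈ X := Measure.quasiMeasurePreserving_fst.ae hXae
  have hsnd : ∀ᵐ p ∂μ.prod ν, p.2 ∈ Y := Measure.quasiMeasurePreserving_snd.ae hYae
  refine ⟨fun p => (∫ s in x₀..p.1, f₁ (s, y₀)) + ∫ t in y₀..p.2, f₂ (p.1, t), ?_,
    ⟨(∫⁻ s in Icc a b, ‖f₁ (s, y₀)‖ₑ).toReal, ?_⟩, ?_, ?_⟩
  · refine aestronglyMeasurable_of_tendsto_ae atTop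
      (f := fun n (p : ℝ × ℝ) => (∫ s in x₀..p.1, P₁ (k n) (s, y₀))
        + ∫ t in y₀..p.2, P₂ (k n) (p.1, t)) (fun n => ?_) ?_
    · refine Continuous.aestronglyMeasurable (Continuous.add ?_ ?_)
      · exact intervalIntegral.continuous_parametric_intervalIntegral_of_continuous
          (f := fun (_ : ℝ × ℝ) s => P₁ (k n) (s, y₀)) ((hP₁ (k n)).comp (by fun_prop))
          continuous_fst
      · exact intervalIntegral.continuous_parametric_intervalIntegral_of_continuous
          (f := fun (p : ℝ × ℝ) t => P₂ (k n) (p.1, t)) ((hP₂ (k n)).comp (by fun_prop))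
          continuous_snd
    · filter_upwards [hfst, hsnd] with p h1 h2
      exact (l₁ y₀ hy₀ x₀ hx₀.1 p.1 h1.1).add (l₂ p.1 h1 y₀ hy₀.1 p.2 h2.1)
  · filter_upwards [hfst, hsnd] with p h1 h2
    exact (abs_add_le _ _).trans (add_le_add (abs_intervalIntegral_le_toReal hy₀.2.1 hx₀.1 h1.1)
      (abs_intervalIntegral_le_toReal h1.2.1 hy₀.1 h2.1))
  · filter_upwards [hXae] with x hx
    refine ⟨hx.2.1, (∫ s in x₀..x, f₁ (s, y₀)) + ∫ t in y₀..c, f₂ (x, t), ?_⟩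
    filter_upwards [hYae] with y hy
    have hi : ∀ {z z'}, z ∈ Icc c d → z' ∈ Icc c d →
        IntervalIntegrable (fun t => f₂ (x, t)) volume z z' := fun hz hz' =>
      (hx.2.1.mono_set (uIcc_subset_Icc hz hz')).intervalIntegrable
    rw [add_assoc, intervalIntegral.integral_add_adjacent_intervals
      (hi hy₀.1 (left_mem_Icc.2 hcd.le)) (hi (left_mem_Icc.2 hcd.le) hy.1)]
  · filter_upwards [hYae] with y hy
    refine ⟨hy.2.1, (∫ t in y₀..y, f₂ (x₀, t)) + ∫ s in x₀..a, f₁ (s, y), ?_⟩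
    filter_upwards [hXae] with x hx
    have hi : ∀ {z z'}, z ∈ Icc a b → z' ∈ Icc a b →
        IntervalIntegrable (fun s => f₁ (s, y)) volume z z' := fun hz hz' =>
      (hy.2.1.mono_set (uIcc_subset_Icc hz hz')).intervalIntegrable
    rw [hclosed x hx y hy, add_assoc, intervalIntegral.integral_add_adjacent_intervals
      (hi hx₀.1 (left_mem_Icc.2 hab.le)) (hi (left_mem_Icc.2 hab.le) hx.1)]

end RectanglePotential

/-! ### Local liftings -/

section LocalLifting

/-- Products of `L²`-convergent sequences converge in `L¹`. -/
theorem tendsto_eLpNorm_mul_of_two {α : Type*} [MeasurableSpace α] {μ : Measure α}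
    {F G : ℕ → α → ℂ} {f g : α → ℂ} (hF : ∀ n, AEStronglyMeasurable (F n) μ)
    (hG : ∀ n, AEStronglyMeasurable (G n) μ) (hf : MemLp f 2 μ) (hg : MemLp g 2 μ)
    (h1 : Tendsto (fun n => eLpNorm (fun x => F n x - f x) 2 μ) atTop (𝓝 0))
    (h2 : Tendsto (fun n => eLpNorm (fun x => G n x - g x) 2 μ) atTop (𝓝 0)) :
    Tendsto (fun n => eLpNorm (fun x => F n x * G n x - f x * g x) 1 μ) atTop (𝓝 0) := by
  have hlim : Tendsto (fun n => eLpNorm (fun x => F n x - f x) 2 μ *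
      eLpNorm (fun x => G n x - g x) 2 μ + eLpNorm (fun x => F n x - f x) 2 μ * eLpNorm g 2 μ
      + eLpNorm f 2 μ * eLpNorm (fun x => G n x - g x) 2 μ) atTop (𝓝 0) := by
    have t1 := ENNReal.Tendsto.mul h1 (Or.inr ENNReal.zero_ne_top) h2 (Or.inr ENNReal.zero_ne_top)
    have t2 := ENNReal.Tendsto.mul_const h1 (Or.inr hg.2.ne)
    have t3 := ENNReal.Tendsto.const_mul h2 (Or.inr hf.2.ne)
    simpa using (t1.add t2).add t3
  refine tendsto_of_tendsto_of_tendsto_of_le_of_le tendsto_const_nhds hlim (fun _ => zero_le) ?_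
  intro n
  have m1 := (hF n).sub hf.aestronglyMeasurable
  have m2 := (hG n).sub hg.aestronglyMeasurable
  have e : (fun x => F n x * G n x - f x * g x)
      = ((F n - f) • (G n - g) + (F n - f) • g) + f • (G n - g) := by
    ext x
    simp only [Pi.add_apply, Pi.sub_apply, Pi.mul_apply, smul_eq_mul]
    ring
  simp only [e]
  refine (eLpNorm_add_le ((m1.smul m2).add (m1.smul hg.aestronglyMeasurable))
    (hf.aestronglyMeasurable.smul m2) le_rfl).trans ?_
  refine add_le_add ((eLpNorm_add_le (m1.smul m2) (m1.smul hg.aestronglyMeasurable)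
    le_rfl).trans (add_le_add ?_ ?_)) ?_
  · exact eLpNorm_smul_le_mul_eLpNorm m2 m1
  · exact eLpNorm_smul_le_mul_eLpNorm hg.aestronglyMeasurable m1
  · exact eLpNorm_smul_le_mul_eLpNorm m2 hf.aestronglyMeasurable

/-- The Cartesian coordinates of the plane. -/
noncomputable def cartesian : ℝ × ℝ ≃ₜ ℂ :=
  graphChart (LinearIsometryEquiv.refl ℝ ℂ) (fun _ => 0) continuous_const

theorem graphChart_refl :
    graphChart (LinearIsometryEquiv.refl ℝ ℂ) (fun _ => 0) continuous_const = cartesian := rfl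

theorem cartesian_apply (p : ℝ × ℝ) : cartesian p = ⟨p.1, p.2⟩ := by
  simp [cartesian, graphChart_apply]

theorem cartesian_eq_clm : (cartesian : ℝ × ℝ → ℂ) = Complex.equivRealProdCLM.symm := by
  ext p
  rw [cartesian_apply]
  apply Complex.ext <;> simp

/-- The reflection of the plane exchanging the coordinate axes. -/
noncomputable def axisSwap : ℂ ≃ₗᵢ[ℝ] ℂ :=
  Complex.conjLIE.trans (rotation ⟨Complex.I, by simp [Submonoid.unitSphere]⟩)

theorem axisSwap_apply (z : ℂ) : axisSwap z = Complex.I * starRingEnd ℂ z := rfl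

theorem axisSwap_I : axisSwap Complex.I = 1 := by simp [axisSwap_apply]

theorem graphChart_axisSwap (s t : ℝ) :
    graphChart axisSwap (fun _ => 0) continuous_const (s, t) = cartesian (t, s) := by
  rw [graphChart_apply, cartesian_apply, axisSwap_apply]
  apply Complex.ext <;> simp

theorem image_graphChart_axisSwap (S S' : Set ℝ) :
    graphChart axisSwap (fun _ => 0) continuous_const '' (S ×ˢ S') = cartesian '' (S' ×ˢ S) := by
  ext z
  constructor
  · rintro ⟨⟨s, t⟩, ⟨hs, ht⟩, rfl⟩
    exact ⟨(t, s), ⟨ht, hs⟩, (graphChart_axisSwap s t).symm⟩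
  · rintro ⟨⟨t, s⟩, ⟨ht, hs⟩, rfl⟩
    exact ⟨(s, t), ⟨hs, ht⟩, graphChart_axisSwap s t⟩

variable {Ω : Set ℂ} {u u₁ u₂ : ℂ → ℂ}

/-- For unimodular `u`, the angular part `Im (ū v)` of `v` is as integrable as `v`. -/
theorem memLp_im_conj_mul {μ : Measure ℂ} {v : ℂ → ℂ} (hu : AEStronglyMeasurable u μ)
    (hu1 : ∀ᵐ x ∂μ, ‖u x‖ = 1) {p : ℝ≥0∞} (hv : MemLp v p μ) :
    MemLp (fun x => (starRingEnd ℂ (u x) * v x).im) p μ := by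
  refine hv.of_le (Complex.continuous_im.comp_aestronglyMeasurable
    ((Complex.continuous_conj.comp_aestronglyMeasurable hu).mul hv.aestronglyMeasurable)) ?_
  filter_upwards [hu1] with x hx
  calc ‖(starRingEnd ℂ (u x) * v x).im‖ ≤ ‖starRingEnd ℂ (u x) * v x‖ := Complex.abs_im_le_norm _
    _ = ‖v x‖ := by rw [norm_mul, RCLike.norm_conj, hx, one_mul]

/-- The angular part `Im (ū ∇u)` of the gradient of an `𝕊¹`-valued function `u` in `H¹` is a
gradient on every rectangle: its curl `2 ∂₁u ∧ ∂₂u` vanishes since both partial derivatives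
are tangent to the circle. -/
theorem exists_local_potential (hΩ : IsOpen Ω) (h1 : IsWeakDeriv Ω 1 u u₁)
    (h2 : IsWeakDeriv Ω Complex.I u u₂) (hu1 : ∀ᵐ x ∂volume.restrict Ω, ‖u x‖ = 1)
    (hL1 : MemLp u₁ 2 (volume.restrict Ω)) (hL2 : MemLp u₂ 2 (volume.restrict Ω))
    {a b c d : ℝ} (hab : a < b) (hcd : c < d)
    (hsub : cartesian '' (Icc a b ×ˢ Icc c d) ⊆ Ω) :
    ∃ φ : ℂ → ℝ, MemLp φ 2 (volume.restrict (cartesian '' (Ioo a b ×ˢ Ioo c d))) ∧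
      IsWeakDeriv (cartesian '' (Ioo a b ×ˢ Ioo c d)) 1 φ
        (fun x => (starRingEnd ℂ (u x) * u₁ x).im) ∧
      IsWeakDeriv (cartesian '' (Ioo a b ×ˢ Ioo c d)) Complex.I φ
        (fun x => (starRingEnd ℂ (u x) * u₂ x).im) := by
  set K := cartesian '' (Icc a b ×ˢ Icc c d) with hK
  set R := cartesian '' (Ioo a b ×ˢ Ioo c d) with hR
  have hKc : IsCompact K := (isCompact_Icc.prod isCompact_Icc).image cartesian.continuous
  have hRo : IsOpen R := cartesian.isOpenMap _ (isOpen_Ioo.prod isOpen_Ioo)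
  have hRK : R ⊆ K := image_mono (prod_mono Ioo_subset_Icc_self Ioo_subset_Icc_self)
  have hmp : MeasurePreserving cartesian
      ((volume.restrict (Icc a b)).prod (volume.restrict (Icc c d))) (volume.restrict K) :=
    graphChart_restrict _ _
  have hum : AEStronglyMeasurable u (volume.restrict Ω) := h1.1.aestronglyMeasurable
  set F₁ : ℂ → ℝ := fun x => (starRingEnd ℂ (u x) * u₁ x).im with hF₁
  set F₂ : ℂ → ℝ := fun x => (starRingEnd ℂ (u x) * u₂ x).im with hF₂
  have hF₁L : MemLp F₁ 2 (volume.restrict Ω) := memLp_im_conj_mul hum hu1 hL1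
  have hF₂L : MemLp F₂ 2 (volume.restrict Ω) := memLp_im_conj_mul hum hu1 hL2
  have hfinK : IsFiniteMeasure (volume.restrict K) := ⟨by simpa using hKc.measure_lt_top⟩
  have hres : ∀ {E : Type} [NormedAddCommGroup E] {f : ℂ → E}, MemLp f 2 (volume.restrict Ω) →
      MemLp f 2 (volume.restrict K) := fun hf => hf.mono_measure (Measure.restrict_mono hsub le_rfl)
  -- smooth approximation of `u` on the rectangle
  obtain ⟨G, hGs, hGlim, hGC, -, hGd⟩ := exists_smooth_approx hΩ h1.1 hKc hsub
  replace hGC := hGC 1 zero_le_one (hu1.mono fun x hx => hx.le)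
  have hG1 := hGd 1 u₁ (fun x hx => ⟨Ω, hΩ, hx, h1⟩) 2 (by norm_num) (by norm_num)
    fun L hL _ => hL1.mono_measure (Measure.restrict_mono hL le_rfl)
  have hG2 := hGd Complex.I u₂ (fun x hx => ⟨Ω, hΩ, hx, h2⟩) 2 (by norm_num) (by norm_num)
    fun L hL _ => hL2.mono_measure (Measure.restrict_mono hL le_rfl)
  have hG1' := hGd 1 u₁ (fun x hx => ⟨Ω, hΩ, hx, h1⟩) 1 le_rfl ENNReal.one_ne_top
    (memLp_one_of_locallyIntegrableOn h1.2.1)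
  have hG2' := hGd Complex.I u₂ (fun x hx => ⟨Ω, hΩ, hx, h2⟩) 1 le_rfl ENNReal.one_ne_top
    (memLp_one_of_locallyIntegrableOn h2.2.1)
  have hdc := fun n v => continuous_fderiv_apply (hGs n) v
  have hGcc : ∀ n, Continuous fun x => starRingEnd ℂ (G n x) := fun n =>
    Complex.continuous_conj.comp (hGs n).continuous
  -- the approximating fields converge
  have hP : ∀ (v : ℂ) (w : ℂ → ℂ), IntegrableOn w K →
      Tendsto (fun n => eLpNorm (fun x => fderiv ℝ (G n) x v - w x) 1 (volume.restrict K)) atTop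
        (𝓝 0) →
      Tendsto (fun n => ∫⁻ p, ‖(starRingEnd ℂ (G n (cartesian p)) *
          fderiv ℝ (G n) (cartesian p) v).im - (starRingEnd ℂ (u (cartesian p)) *
          w (cartesian p)).im‖ₑ ∂(volume.restrict (Icc a b)).prod (volume.restrict (Icc c d)))
        atTop (𝓝 0) := by
    intro v w hw ht
    have t := tendsto_eLpNorm_mul_sub (G := fun n x => starRingEnd ℂ (G n x))
      (g := fun x => starRingEnd ℂ (u x)) (C := 1)
      (fun n => (hGcc n).aestronglyMeasurable)
      (fun n => Eventually.of_forall fun x => by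
        simpa using hGC n x)
      (hGlim.mono fun x hx => (Complex.continuous_conj.tendsto _).comp hx) hw
      (fun n => (hdc n v).aestronglyMeasurable) ht
    simp only [eLpNorm_one_eq_lintegral_enorm] at t
    refine tendsto_of_tendsto_of_tendsto_of_le_of_le tendsto_const_nhds t (fun _ => zero_le) ?_
    intro n
    simp only
    rw [hmp.lintegral_comp_emb cartesian.measurableEmbedding (fun x =>
      ‖(starRingEnd ℂ (G n x) * fderiv ℝ (G n) x v).im - (starRingEnd ℂ (u x) * w x).im‖ₑ)]
    refine lintegral_mono fun x => ?_
    rw [← Complex.sub_im, ← ofReal_norm, ← ofReal_norm]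
    exact ENNReal.ofReal_le_ofReal (Complex.abs_im_le_norm _)
  have hQ : Tendsto (fun n => ∫⁻ p, ‖2 * (starRingEnd ℂ (fderiv ℝ (G n) (cartesian p) 1) *
      fderiv ℝ (G n) (cartesian p) Complex.I).im‖ₑ
      ∂(volume.restrict (Icc a b)).prod (volume.restrict (Icc c d))) atTop (𝓝 0) := by
    have t := tendsto_eLpNorm_mul_of_two (F := fun n x => starRingEnd ℂ (fderiv ℝ (G n) x 1))
      (f := fun x => starRingEnd ℂ (u₁ x)) (G := fun n x => fderiv ℝ (G n) x Complex.I) (g := u₂)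
      (μ := volume.restrict K)
      (fun n => (Complex.continuous_conj.comp (hdc n 1)).aestronglyMeasurable)
      (fun n => (hdc n Complex.I).aestronglyMeasurable)
      ((hres hL1).of_le (Complex.continuous_conj.comp_aestronglyMeasurable
        (hres hL1).aestronglyMeasurable) (Eventually.of_forall fun x => by simp))
      (hres hL2)
      (hG1.congr fun n => eLpNorm_congr_norm_ae (Eventually.of_forall fun x => by
        rw [← map_sub, RCLike.norm_conj])) hG2
    simp only [eLpNorm_one_eq_lintegral_enorm] at t
    have t' := ENNReal.Tendsto.const_mul (a := 2) t (Or.inr (by norm_num))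
    rw [mul_zero] at t'
    refine tendsto_of_tendsto_of_tendsto_of_le_of_le tendsto_const_nhds t' (fun _ => zero_le) ?_
    intro n
    simp only
    rw [hmp.lintegral_comp_emb cartesian.measurableEmbedding (fun x =>
      ‖2 * (starRingEnd ℂ (fderiv ℝ (G n) x 1) * fderiv ℝ (G n) x Complex.I).im‖ₑ),
      ← lintegral_const_mul' _ _ (by norm_num)]
    refine lintegral_mono_ae ?_
    have e1 := ae_restrict_of_ae_restrict_of_subset hsub (h1.eq_of_norm_eq_one hΩ hu1)
    have e2 := ae_restrict_of_ae_restrict_of_subset hsub (h2.eq_of_norm_eq_one hΩ hu1)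
    filter_upwards [e1, e2] with x hx1 hx2
    have hz : (starRingEnd ℂ (u₁ x) * u₂ x).im = 0 := by
      rw [hx1, hx2]
      simp only [map_mul, Complex.conj_I, Complex.conj_ofReal, Complex.mul_im, Complex.mul_re,
        Complex.conj_re, Complex.conj_im, Complex.I_re, Complex.I_im, Complex.ofReal_re,
        Complex.ofReal_im, Complex.neg_re, Complex.neg_im]
      ring
    rw [enorm_mul]
    refine mul_le_mul' (by simp [enorm_eq_nnnorm]) ?_
    rw [← sub_zero (Complex.im _), ← hz, ← Complex.sub_im, ← ofReal_norm, ← ofReal_norm]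
    exact ENNReal.ofReal_le_ofReal (Complex.abs_im_le_norm _)
  -- the potential
  have hgs : ∀ n, ContDiff ℝ ∞ fun p => G n (cartesian p) := by
    intro n
    rw [cartesian_eq_clm]
    exact (hGs n).comp Complex.equivRealProdCLM.symm.contDiff
  have hgd : ∀ n p k, fderiv ℝ (fun p => G n (cartesian p)) p k
      = fderiv ℝ (G n) (cartesian p) (Complex.equivRealProdCLM.symm k) := by
    intro n p k
    rw [cartesian_eq_clm]
    have h3 := ((hGs n).differentiable (by simp) (Complex.equivRealProdCLM.symm p)).hasFDerivAt.comp
      p Complex.equivRealProdCLM.symm.hasFDerivAt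
    rw [show fderiv ℝ (fun p => G n (Complex.equivRealProdCLM.symm p)) p = _ from h3.fderiv]
    rfl
  have hk1 : Complex.equivRealProdCLM.symm (1, 0) = 1 := by apply Complex.ext <;> simp
  have hk2 : Complex.equivRealProdCLM.symm (0, 1) = Complex.I := by apply Complex.ext <;> simp
  have hint : ∀ {F : ℂ → ℝ}, MemLp F 2 (volume.restrict Ω) → Integrable (fun p => F (cartesian p))
      ((volume.restrict (Icc a b)).prod (volume.restrict (Icc c d))) := fun hF =>
    (hmp.integrable_comp_emb cartesian.measurableEmbedding).2 ((hres hF).integrable (by norm_num))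
  have hcc : Continuous cartesian := cartesian.continuous
  obtain ⟨φ, hφm, ⟨A, hφA⟩, hφ2, hφ1⟩ := exists_potential_of_tendsto hab hcd (hint hF₁L) (hint hF₂L)
    (fun n => Complex.continuous_im.comp (((hGcc n).comp hcc).mul ((hdc n 1).comp hcc)))
    (fun n => Complex.continuous_im.comp (((hGcc n).comp hcc).mul ((hdc n Complex.I).comp hcc)))
    (fun n => continuous_const.mul (Complex.continuous_im.comp
      ((Complex.continuous_conj.comp ((hdc n 1).comp hcc)).mul ((hdc n Complex.I).comp hcc))))
    (hP 1 u₁ (h1.2.1.integrableOn_compact_subset hsub hKc) hG1')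
    (hP Complex.I u₂ (h2.2.1.integrableOn_compact_subset hsub hKc) hG2') hQ
    (fun n x₀ x y₀ y => by
      have := green_angular_form (hgs n) x₀ x y₀ y
      simp only [hgd, hk1, hk2] at this
      exact this)
  have hΦc : ∀ p, φ (cartesian.symm (cartesian p)) = φ p := fun p => by
    rw [Homeomorph.symm_apply_apply]
  have hΦm : AEStronglyMeasurable (fun z => φ (cartesian.symm z)) (volume.restrict K) := by
    rw [← hmp.map_eq, cartesian.measurableEmbedding.aestronglyMeasurable_map_iff]
    exact hφm.congr (Eventually.of_forall fun p => (hΦc p).symm)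
  have hΦL : MemLp (fun z => φ (cartesian.symm z)) 2 (volume.restrict K) := by
    have hF₂c : MemLp (fun p => F₂ (cartesian p)) 2
        ((volume.restrict (Icc a b)).prod (volume.restrict (Icc c d))) :=
      (hres hF₂L).comp_measurePreserving hmp
    have hφL : MemLp φ 2 ((volume.restrict (Icc a b)).prod (volume.restrict (Icc c d))) := by
      refine ((memLp_const A).add ((memLp_marginal hF₂c).comp_fst _)).of_le hφm ?_
      filter_upwards [hφA] with p hp
      exact hp.trans (le_abs_self _)
    have h3 := (hmp.symm cartesian.toMeasurableEquiv)
    exact hφL.comp_measurePreserving h3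
  have hΦR : MemLp (fun z => φ (cartesian.symm z)) 2 (volume.restrict R) :=
    hΦL.mono_measure (Measure.restrict_mono hRK le_rfl)
  have hΦl : LocallyIntegrableOn (fun z => φ (cartesian.symm z)) R :=
    IntegrableOn.locallyIntegrableOn
      ((hΦL.integrable (by norm_num)).mono_measure (Measure.restrict_mono hRK le_rfl))
  have hFl : ∀ {F : ℂ → ℝ}, MemLp F 2 (volume.restrict Ω) → LocallyIntegrableOn F R := fun hF =>
    IntegrableOn.locallyIntegrableOn
      (((hres hF).integrable (by norm_num)).mono_measure (Measure.restrict_mono hRK le_rfl))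
  refine ⟨fun z => φ (cartesian.symm z), hΦR, ?_, ?_⟩
  · have := isWeakDeriv_of_ae_line (T := axisSwap) (γ := fun _ => 0) (hγ := continuous_const)
      (f := fun z => φ (cartesian.symm z)) (f' := F₁) (a := c) (b := d) hab
      (by rwa [image_graphChart_axisSwap]) (by rw [image_graphChart_axisSwap]; exact hFl hF₁L)
      (by simpa only [graphChart_axisSwap, hΦc] using hφ1)
    rwa [image_graphChart_axisSwap, axisSwap_I] at this
  · have := isWeakDeriv_of_ae_line (T := LinearIsometryEquiv.refl ℝ ℂ) (γ := fun _ => 0)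
      (hγ := continuous_const) (f := fun z => φ (cartesian.symm z)) (f' := F₂) (a := a) (b := b)
      hcd (by rwa [graphChart_refl]) (by rw [graphChart_refl]; exact hFl hF₂L)
      (by simpa only [graphChart_refl, hΦc] using hφ2)
    rwa [graphChart_refl, LinearIsometryEquiv.coe_refl, id] at this

end LocalLifting

/-! ### Gluing local liftings -/

section Gluing

variable {Ω : Set ℂ} {u u₁ u₂ : ℂ → ℂ}

/-- On small balls, the potential of `Im (ū ∇u)` is a lifting of `u` after addition of a constant,
because `u e^{-iφ}` has vanishing gradient. -/
theorem exists_local_lifting (hΩ : IsOpen Ω) (h1 : IsWeakDeriv Ω 1 u u₁)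
    (h2 : IsWeakDeriv Ω Complex.I u u₂) (hu1 : ∀ᵐ x ∂volume.restrict Ω, ‖u x‖ = 1)
    (hL1 : MemLp u₁ 2 (volume.restrict Ω)) (hL2 : MemLp u₂ 2 (volume.restrict Ω))
    {z : ℂ} {ρ : ℝ} (hρ : 0 < ρ) (hsub : Metric.closedBall z (2 * ρ) ⊆ Ω) :
    ∃ φ : ℂ → ℝ, MemLp φ 2 (volume.restrict (Metric.ball z ρ)) ∧
      IsWeakDeriv (Metric.ball z ρ) 1 φ (fun x => (starRingEnd ℂ (u x) * u₁ x).im) ∧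
      IsWeakDeriv (Metric.ball z ρ) Complex.I φ (fun x => (starRingEnd ℂ (u x) * u₂ x).im) ∧
      ∀ᵐ x ∂volume.restrict (Metric.ball z ρ), u x = Complex.exp (Complex.I * φ x) := by
  have hsq : cartesian '' (Icc (z.re - ρ) (z.re + ρ) ×ˢ Icc (z.im - ρ) (z.im + ρ)) ⊆ Ω := by
    rintro _ ⟨⟨x, y⟩, ⟨⟨hx1, hx2⟩, hy1, hy2⟩, rfl⟩
    refine hsub ?_
    rw [Metric.mem_closedBall, dist_eq_norm, cartesian_apply]
    refine (Complex.norm_le_abs_re_add_abs_im _).trans ?_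
    simp only [Complex.sub_re, Complex.sub_im]
    dsimp only at hx1 hx2 hy1 hy2
    have e1 : |x - z.re| ≤ ρ := abs_le.2 ⟨by linarith, by linarith⟩
    have e2 : |y - z.im| ≤ ρ := abs_le.2 ⟨by linarith, by linarith⟩
    linarith
  obtain ⟨φ, hφL, hφ1, hφ2⟩ := exists_local_potential hΩ h1 h2 hu1 hL1 hL2
    (by linarith) (by linarith) hsq
  have hball : Metric.ball z ρ ⊆
      cartesian '' (Ioo (z.re - ρ) (z.re + ρ) ×ˢ Ioo (z.im - ρ) (z.im + ρ)) := by
    intro x hx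
    rw [Metric.mem_ball, dist_eq_norm] at hx
    have e1 := abs_lt.1 ((Complex.abs_re_le_norm (x - z)).trans_lt hx)
    have e2 := abs_lt.1 ((Complex.abs_im_le_norm (x - z)).trans_lt hx)
    rw [Complex.sub_re] at e1
    rw [Complex.sub_im] at e2
    exact ⟨(x.re, x.im), ⟨⟨by linarith, by linarith⟩, by linarith, by linarith⟩,
      cartesian_apply _⟩
  have hbΩ : Metric.ball z ρ ⊆ Ω :=
    (Metric.ball_subset_closedBall.trans (Metric.closedBall_subset_closedBall (by linarith))).trans
      hsub
  replace hφL := hφL.mono_measure (Measure.restrict_mono hball le_rfl)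
  replace hφ1 := hφ1.mono hball
  replace hφ2 := hφ2.mono hball
  have hub := ae_restrict_of_ae_restrict_of_subset hbΩ hu1
  obtain ⟨c, hc⟩ := exists_ae_eq_const Metric.isOpen_ball (convex_ball z ρ).isPreconnected
    (isWeakDeriv_mul_exp_neg Metric.isOpen_ball (h1.mono hbΩ) hub hφ1)
    (isWeakDeriv_mul_exp_neg Metric.isOpen_ball (h2.mono hbΩ) hub hφ2)
  have hne : (ae (volume.restrict (Metric.ball z ρ))).NeBot := by
    rw [ae_neBot, Ne, Measure.restrict_eq_zero]
    exact (Metric.measure_ball_pos volume z hρ).ne'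
  have hc1 : ‖c‖ = 1 := by
    obtain ⟨x, hx1, hx2⟩ := (hc.and hub).exists
    rw [← hx1, norm_mul, hx2, norm_exp_I_mul, one_mul]
  have hcexp : Complex.exp (Complex.I * c.arg) = c := by
    have := Complex.norm_mul_exp_arg_mul_I c
    rwa [hc1, Complex.ofReal_one, one_mul, mul_comm] at this
  have hfin : IsFiniteMeasure (volume.restrict (Metric.ball z ρ)) :=
    ⟨by rw [Measure.restrict_apply_univ]; exact measure_ball_lt_top⟩
  refine ⟨fun x => φ x - (-c.arg), hφL.sub (memLp_const _), ?_, ?_, ?_⟩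
  · simpa using hφ1.sub (isWeakDeriv_const (-c.arg))
  · simpa using hφ2.sub (isWeakDeriv_const (-c.arg))
  · filter_upwards [hc] with x hx
    rw [sub_neg_eq_add, Complex.ofReal_add, mul_add, Complex.exp_add, hcexp, ← hx, mul_comm,
      mul_assoc, ← Complex.exp_add]
    simp

/-- Functions given on the members of an open cover, which agree almost everywhere on
intersections, come from one function. -/
theorem exists_ae_glue {α : Type*} [Inhabited α] {U : ℂ → Set ℂ} {ψ : ℂ → ℂ → α}
    (hU : ∀ z ∈ Ω, IsOpen (U z))
    (h : ∀ z ∈ Ω, ∀ w ∈ Ω, ∀ᵐ x, x ∈ U z → x ∈ U w → ψ z x = ψ w x) :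
    ∃ φ : ℂ → α, ∀ z ∈ Ω, ∀ᵐ x, x ∈ U z → φ x = ψ z x := by
  classical
  obtain ⟨T, hTΩ, hTc, hT⟩ : ∃ T ⊆ Ω, T.Countable ∧ ⋃ z ∈ T, U z = ⋃ z ∈ Ω, U z := by
    obtain ⟨T, hTc, hT⟩ := TopologicalSpace.isOpen_iUnion_countable (fun z : Ω => U z)
      fun z => hU z z.2
    refine ⟨(↑) '' T, Subtype.coe_image_subset _ _, hTc.image _, ?_⟩
    rw [biUnion_image, hT, biUnion_eq_iUnion]
  refine ⟨fun x => if hx : ∃ w ∈ T, x ∈ U w then ψ hx.choose x else default, fun z hz => ?_⟩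
  have h' : ∀ᵐ x, ∀ w ∈ T, x ∈ U w → x ∈ U z → ψ w x = ψ z x :=
    (ae_ball_iff hTc).2 fun w hw => h w (hTΩ hw) z hz
  filter_upwards [h'] with x hx hxz
  have hex : ∃ w ∈ T, x ∈ U w := by
    have h1 : x ∈ ⋃ z ∈ T, U z := by
      rw [hT]
      exact mem_biUnion hz hxz
    simpa using h1
  rw [dif_pos hex]
  exact hx _ hex.choose_spec.1 hex.choose_spec.2 hxz

/-- A continuous function with values in `2πℤ` is constant on a preconnected set. -/
theorem eq_of_exp_I_mul_eq_one {S : Set ℂ} (hS : IsPreconnected S) {f : ℂ → ℝ}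
    (hf : ContinuousOn f S) (h : ∀ x ∈ S, Complex.exp (Complex.I * f x) = 1) {x y : ℂ}
    (hx : x ∈ S) (hy : y ∈ S) : f x = f y := by
  have hle : ∀ {x y : ℂ}, x ∈ S → y ∈ S → f y ≤ f x := by
    intro x y hx hy
    by_contra! hlt
    obtain ⟨n, hn⟩ : ∃ n : ℤ, f y - f x = n * (2 * Real.pi) := by
      have h1 : Complex.exp (((f y - f x : ℝ) : ℂ) * Complex.I) = 1 := by
        rw [Complex.ofReal_sub, sub_mul, Complex.exp_sub, mul_comm, h y hy, mul_comm, h x hx,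
          div_one]
      obtain ⟨n, hn⟩ := Complex.exp_eq_one_iff.1 h1
      refine ⟨n, ?_⟩
      have := congrArg Complex.im hn
      simpa [mul_assoc] using this
    have hn1 : 1 ≤ n := by
      by_contra! hn0
      have : (n : ℝ) ≤ 0 := by exact_mod_cast Int.lt_add_one_iff.1 hn0
      nlinarith [Real.pi_pos]
    have hn1' : (1 : ℝ) ≤ n := by exact_mod_cast hn1
    obtain ⟨z, hz, hfz⟩ := hS.intermediate_value hx hy hf
      (show f x + Real.pi ∈ Icc (f x) (f y) from
        ⟨by linarith [Real.pi_pos], by nlinarith [Real.pi_pos]⟩)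
    have h2 := h z hz
    rw [hfz, Complex.ofReal_add, mul_add, Complex.exp_add, h x hx, one_mul, mul_comm,
      Complex.exp_pi_mul_I] at h2
    norm_num at h2
  exact le_antisymm (hle hy hx) (hle hx hy)

/-- The weight, as a function of `x`, of the local averages around `y`: a cone with apex at `y`,
supported in the ball whose radius is an eighth of the distance of `y` to the complement of `Ω`.
Unlike the indicator function of that ball, it depends continuously on `y`. -/
noncomputable def coneWeight (Ω : Set ℂ) (y x : ℂ) : ℝ :=
  max 0 (Metric.infDist y Ωᶜ / 8 - dist x y)

theorem continuous_coneWeight_left (x : ℂ) : Continuous fun y => coneWeight Ω y x := by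
  unfold coneWeight
  have := Metric.continuous_infDist_pt (Ωᶜ)
  fun_prop

theorem continuous_coneWeight_right (y : ℂ) : Continuous (coneWeight Ω y) := by
  unfold coneWeight
  fun_prop

theorem coneWeight_nonneg (y x : ℂ) : 0 ≤ coneWeight Ω y x := le_max_left _ _

theorem coneWeight_le (y x : ℂ) : coneWeight Ω y x ≤ Metric.infDist y Ωᶜ / 8 :=
  max_le (div_nonneg Metric.infDist_nonneg (by norm_num)) (sub_le_self _ dist_nonneg)

theorem coneWeight_eq_zero {y x : ℂ} (h : x ∉ Metric.ball y (Metric.infDist y Ωᶜ / 8)) :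
    coneWeight Ω y x = 0 :=
  max_eq_left (by simpa using h)

theorem integrable_coneWeight_mul {g : ℂ → ℝ} (hg : Integrable g) (y : ℂ) :
    Integrable fun x => coneWeight Ω y x * g x :=
  hg.bdd_mul (continuous_coneWeight_right y).aestronglyMeasurable
    (Eventually.of_forall fun x => by
      rw [Real.norm_of_nonneg (coneWeight_nonneg y x)]
      exact coneWeight_le y x)

theorem continuous_integral_coneWeight {g : ℂ → ℝ} (hg : Integrable g) :
    Continuous fun y => ∫ x, coneWeight Ω y x * g x := by
  refine continuous_iff_continuousAt.2 fun y₀ => ?_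
  refine continuousAt_of_dominated (bound := fun x => (Metric.infDist y₀ Ωᶜ / 8 + 1) * ‖g x‖)
    (Eventually.of_forall fun y => (integrable_coneWeight_mul hg y).aestronglyMeasurable) ?_
    (hg.norm.const_mul _)
    (Eventually.of_forall fun x => ((continuous_coneWeight_left x).mul_const _).continuousAt)
  have hev : ∀ᶠ y in 𝓝 y₀, Metric.infDist y Ωᶜ / 8 < Metric.infDist y₀ Ωᶜ / 8 + 1 :=
    ((Metric.continuous_infDist_pt Ωᶜ).div_const 8).continuousAt.eventually_lt_const
      (lt_add_one _)
  filter_upwards [hev] with y hy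
  refine Eventually.of_forall fun x => ?_
  rw [norm_mul, Real.norm_of_nonneg (coneWeight_nonneg y x)]
  exact mul_le_mul_of_nonneg_right ((coneWeight_le y x).trans hy.le) (norm_nonneg _)

/-- On a simply connected `Ω` the local liftings can be corrected by constants in `2πℤ` so as to
agree. The exponentials of their weighted averages do not depend on these constants, and form a
continuous circle-valued function on `Ω`; a continuous logarithm of it selects the constants. -/
theorem exists_lifting_loc (hΩ : IsOpen Ω) (hb : Bornology.IsBounded Ω)
    (hsc : IsSimplyConnected Ω) (h1 : IsWeakDeriv Ω 1 u u₁)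
    (h2 : IsWeakDeriv Ω Complex.I u u₂) (hu1 : ∀ᵐ x ∂volume.restrict Ω, ‖u x‖ = 1)
    (hL1 : MemLp u₁ 2 (volume.restrict Ω)) (hL2 : MemLp u₂ 2 (volume.restrict Ω)) :
    ∃ φ : ℂ → ℝ, IsWeakDeriv Ω 1 φ (fun x => (starRingEnd ℂ (u x) * u₁ x).im) ∧
      IsWeakDeriv Ω Complex.I φ (fun x => (starRingEnd ℂ (u x) * u₂ x).im) ∧
      (∀ᵐ x ∂volume.restrict Ω, u x = Complex.exp (Complex.I * φ x)) ∧
      ∀ z ∈ Ω, ∃ U, IsOpen U ∧ z ∈ U ∧ MemLp φ 2 (volume.restrict U) := by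
  have hcne : (Ωᶜ).Nonempty := by
    rw [nonempty_compl]
    rintro rfl
    exact NormedSpace.unbounded_univ ℝ ℂ hb
  set d : ℂ → ℝ := fun z => Metric.infDist z Ωᶜ with hd
  have hdpos : ∀ z ∈ Ω, 0 < d z := fun z hz =>
    (hΩ.isClosed_compl.notMem_iff_infDist_pos hcne).1 (by simpa using hz)
  have hdball : ∀ z, Metric.ball z (d z) ⊆ Ω := fun z x hx => by
    by_contra hxΩ
    have h3 := Metric.infDist_le_dist_of_mem (x := z) (show x ∈ Ωᶜ from hxΩ)
    rw [Metric.mem_ball, dist_comm] at hx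
    exact absurd hx (not_lt.2 h3)
  have hdlip : ∀ z w, d z ≤ d w + dist z w := fun z w => Metric.infDist_le_infDist_add_dist
  have hloc : ∀ z ∈ Ω, ∃ φ : ℂ → ℝ, MemLp φ 2 (volume.restrict (Metric.ball z (d z / 4))) ∧
      IsWeakDeriv (Metric.ball z (d z / 4)) 1 φ (fun x => (starRingEnd ℂ (u x) * u₁ x).im) ∧
      IsWeakDeriv (Metric.ball z (d z / 4)) Complex.I φ
        (fun x => (starRingEnd ℂ (u x) * u₂ x).im) ∧
      ∀ᵐ x ∂volume.restrict (Metric.ball z (d z / 4)), u x = Complex.exp (Complex.I * φ x) :=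
    fun z hz => exists_local_lifting hΩ h1 h2 hu1 hL1 hL2 (by linarith [hdpos z hz])
      ((Metric.closedBall_subset_ball (by linarith [hdpos z hz])).trans (hdball z))
  choose! φ hφL hφ1 hφ2 hφu using hloc
  set B : ℂ → Set ℂ := fun z => Metric.ball z (d z / 4) with hB
  set U : ℂ → Set ℂ := fun z => Metric.ball z (d z / 16) with hU
  have hUB : ∀ z ∈ Ω, U z ⊆ B z := fun z hz =>
    Metric.ball_subset_ball (by linarith [hdpos z hz])
  have hUΩ : ∀ z ∈ Ω, U z ⊆ Ω := fun z hz =>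
    (Metric.ball_subset_ball (by linarith [hdpos z hz])).trans (hdball z)
  have hzU : ∀ z ∈ Ω, z ∈ U z := fun z hz =>
    Metric.mem_ball_self (by linarith [hdpos z hz])
  -- the averages around a point of `U z` only involve the values on `B z`
  have hyB : ∀ z ∈ Ω, ∀ y ∈ U z, Metric.ball y (d y / 8) ⊆ B z := by
    intro z hz y hy
    refine Metric.ball_subset_ball' ?_
    have h3 := hdlip y z
    have h4 : dist y z < d z / 16 := hy
    linarith [hdpos z hz]
  -- two local liftings differ by a constant
  have hdiff : ∀ z ∈ Ω, ∀ w ∈ Ω, ∃ c : ℝ, (∀ᵐ x, x ∈ B z ∩ B w → φ z x = φ w x + c) ∧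
      ((B z ∩ B w).Nonempty → Complex.exp (Complex.I * c) = 1) := by
    intro z hz w hw
    have hBo : IsOpen (B z ∩ B w) := Metric.isOpen_ball.inter Metric.isOpen_ball
    have e1 := ((hφ1 z hz).mono (inter_subset_left (t := B w))).sub
      ((hφ1 w hw).mono (inter_subset_right (s := B z)))
    have e2 := ((hφ2 z hz).mono (inter_subset_left (t := B w))).sub
      ((hφ2 w hw).mono (inter_subset_right (s := B z)))
    simp only [sub_self] at e1 e2
    obtain ⟨c, hc⟩ := exists_ae_eq_const hBo
      ((convex_ball z _).inter (convex_ball w _)).isPreconnected e1 e2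
    refine ⟨c, ?_, fun hne => ?_⟩
    · filter_upwards [(ae_restrict_iff' hBo.measurableSet).1 hc] with x hx hxB
      rw [← hx hxB]
      ring
    · have hne' : (ae (volume.restrict (B z ∩ B w))).NeBot := by
        rw [ae_neBot, Ne, Measure.restrict_eq_zero]
        exact (hBo.measure_pos volume hne).ne'
      obtain ⟨x, hxc, hxz, hxw⟩ := (hc.and
        ((ae_restrict_of_ae_restrict_of_subset inter_subset_left (hφu z hz)).and
        (ae_restrict_of_ae_restrict_of_subset inter_subset_right (hφu w hw)))).exists
      rw [← hxc, Complex.ofReal_sub, mul_sub, Complex.exp_sub, ← hxz, ← hxw, div_self]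
      rw [hxz]
      exact Complex.exp_ne_zero _
  -- local averages
  set φB : ℂ → ℂ → ℝ := fun z => (B z).indicator (φ z) with hφB
  have hφBi : ∀ z ∈ Ω, Integrable (φB z) := fun z hz => by
    have : IsFiniteMeasure (volume.restrict (B z)) :=
      ⟨by rw [Measure.restrict_apply_univ]; exact measure_ball_lt_top⟩
    exact (integrable_indicator_iff measurableSet_ball).2 ((hφL z hz).integrable (by norm_num))
  have hΩi : Integrable (Ω.indicator fun _ => (1 : ℝ)) :=
    (integrable_indicator_iff hΩ.measurableSet).2
      (integrableOn_const hb.measure_lt_top.ne)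
  set N : ℂ → ℝ := fun y => ∫ x, coneWeight Ω y x * Ω.indicator (fun _ => (1 : ℝ)) x with hN
  have hNpos : ∀ y ∈ Ω, 0 < N y := by
    intro y hy
    have hnn : ∀ x, 0 ≤ coneWeight Ω y x * Ω.indicator (fun _ => (1 : ℝ)) x := fun x =>
      mul_nonneg (coneWeight_nonneg y x) (indicator_nonneg (fun _ _ => zero_le_one) x)
    refine (integral_pos_iff_support_of_nonneg hnn (integrable_coneWeight_mul hΩi y)).2 ?_
    refine (Metric.measure_ball_pos volume y (show 0 < d y / 8 by linarith [hdpos y hy])).trans_le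
      (measure_mono fun x hx => ?_)
    have hxΩ : x ∈ Ω := hdball y (Metric.ball_subset_ball (by linarith [hdpos y hy]) hx)
    have h3 : coneWeight Ω y x = d y / 8 - dist x y :=
      max_eq_right (by linarith [Metric.mem_ball.1 hx])
    rw [Function.mem_support, indicator_of_mem hxΩ, mul_one, h3]
    linarith [Metric.mem_ball.1 hx]
  set A : ℂ → ℂ → ℝ := fun z y => (∫ x, coneWeight Ω y x * φB z x) / N y with hA
  have hAc : ∀ z ∈ Ω, ContinuousOn (A z) Ω := fun z hz =>
    (continuous_integral_coneWeight (hφBi z hz)).continuousOn.div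
      (continuous_integral_coneWeight hΩi).continuousOn fun y hy => (hNpos y hy).ne'
  have hAdiff : ∀ z ∈ Ω, ∀ w ∈ Ω, ∀ c : ℝ, (∀ᵐ x, x ∈ B z ∩ B w → φ z x = φ w x + c) →
      ∀ y ∈ U z ∩ U w, A z y = A w y + c := by
    intro z hz w hw c hc y hy
    have hyΩ := hUΩ z hz hy.1
    have e1 : ∫ x, coneWeight Ω y x * φB z x = (∫ x, coneWeight Ω y x * φB w x) + c * N y := by
      rw [hN, ← integral_const_mul, ← integral_add (integrable_coneWeight_mul (hφBi w hw) y)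
        ((integrable_coneWeight_mul hΩi y).const_mul c)]
      refine integral_congr_ae ?_
      filter_upwards [hc] with x hx
      by_cases hxy : x ∈ Metric.ball y (d y / 8)
      · have hxz := hyB z hz y hy.1 hxy
        have hxw := hyB w hw y hy.2 hxy
        have hxΩ : x ∈ Ω := hdball y (Metric.ball_subset_ball (by linarith [hdpos y hyΩ]) hxy)
        simp only [hφB, indicator_of_mem hxz, indicator_of_mem hxw, indicator_of_mem hxΩ,
          hx ⟨hxz, hxw⟩]
        ring
      · simp only [coneWeight_eq_zero hxy, zero_mul, mul_zero, add_zero]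
    simp only [hA]
    rw [e1, add_div, mul_div_assoc, div_self (hNpos y hyΩ).ne', mul_one]
  -- the exponential of the averages is independent of the choices, and continuous
  set v : ℂ → ℂ := fun y => Complex.exp (Complex.I * A y y) with hv
  have hvU : ∀ z ∈ Ω, ∀ y ∈ U z, v y = Complex.exp (Complex.I * A z y) := by
    intro z hz y hy
    have hyΩ := hUΩ z hz hy
    obtain ⟨c, hc, hc1⟩ := hdiff y hyΩ z hz
    have e1 := hAdiff y hyΩ z hz c hc y ⟨hzU y hyΩ, hy⟩
    simp only [hv]
    rw [e1, Complex.ofReal_add, mul_add, Complex.exp_add,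
      hc1 ⟨y, hUB y hyΩ (hzU y hyΩ), hUB z hz hy⟩, mul_one]
  have hvc : ContinuousOn v Ω := by
    intro z hz
    have e1 : ContinuousAt (fun y => Complex.exp (Complex.I * A z y)) z :=
      continuous_exp_I_mul.continuousAt.comp ((hAc z hz).continuousAt (hΩ.mem_nhds hz))
    refine (e1.congr ?_).continuousWithinAt
    filter_upwards [Metric.isOpen_ball.mem_nhds (hzU z hz)] with y hy
    exact (hvU z hz y hy).symm
  obtain ⟨Θ, hΘc, hΘ⟩ := Complex.exists_continuousOn_eqOn_exp_comp hsc hΩ hvc (by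
    rintro ⟨y, -, hy⟩
    exact Complex.exp_ne_zero _ hy)
  set θ : ℂ → ℝ := fun y => (Θ y).im with hθ
  have hθc : ContinuousOn θ Ω := Complex.continuous_im.comp_continuousOn hΘc
  have hθv : ∀ y ∈ Ω, Complex.exp (Complex.I * θ y) = v y := by
    intro y hy
    have e1 : Complex.exp (Θ y) = v y := hΘ hy
    have e2 : (Θ y).re = 0 := by
      have := congrArg norm e1
      simp only [hv] at this
      rwa [norm_exp_I_mul, Complex.norm_exp, Real.exp_eq_one_iff] at this
    rw [← e1]
    congr 1
    apply Complex.ext <;> simp [hθ, e2]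
  have hconst : ∀ z ∈ Ω, ∀ y ∈ U z, θ y - A z y = θ z - A z z := by
    intro z hz y hy
    refine eq_of_exp_I_mul_eq_one (convex_ball z (d z / 16)).isPreconnected
      (f := fun y => θ y - A z y)
      ((hθc.mono (hUΩ z hz)).sub ((hAc z hz).mono (hUΩ z hz))) (fun x hx => ?_) hy (hzU z hz)
    rw [Complex.ofReal_sub, mul_sub, Complex.exp_sub, hθv x (hUΩ z hz hx), hvU z hz x hx,
      div_self (Complex.exp_ne_zero _)]
  obtain ⟨ψ, hψ⟩ := exists_ae_glue (Ω := Ω) (U := U)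
    (ψ := fun z x => φ z x - (A z z - θ z)) (fun z _ => Metric.isOpen_ball) (by
      intro z hz w hw
      rcases (U z ∩ U w).eq_empty_or_nonempty with he | ⟨y, hy⟩
      · refine Eventually.of_forall fun x hx hx' => ?_
        exact absurd (show x ∈ U z ∩ U w from ⟨hx, hx'⟩) (by simp [he])
      · obtain ⟨c, hc, -⟩ := hdiff z hz w hw
        have e1 := hAdiff z hz w hw c hc y hy
        have e2 := hconst z hz y hy.1
        have e3 := hconst w hw y hy.2
        filter_upwards [hc] with x hx hxz hxw
        rw [hx ⟨hUB z hz hxz, hUB w hw hxw⟩]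
        linarith)
  have hψ' : ∀ z ∈ Ω, (fun x => φ z x - (A z z - θ z)) =ᵐ[volume.restrict (U z)] ψ := by
    intro z hz
    refine (ae_restrict_iff' measurableSet_ball).2 ?_
    filter_upwards [hψ z hz] with x hx hxU
    exact (hx hxU).symm
  refine ⟨ψ, ?_, ?_, ?_, ?_⟩
  · refine isWeakDeriv_of_locally hΩ fun z hz => ⟨U z, Metric.isOpen_ball, hzU z hz, ?_⟩
    refine (((hφ1 z hz).mono (hUB z hz)).sub (isWeakDeriv_const (A z z - θ z))).congr (hψ' z hz) ?_
    simp only [sub_zero]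
    rfl
  · refine isWeakDeriv_of_locally hΩ fun z hz => ⟨U z, Metric.isOpen_ball, hzU z hz, ?_⟩
    refine (((hφ2 z hz).mono (hUB z hz)).sub (isWeakDeriv_const (A z z - θ z))).congr (hψ' z hz) ?_
    simp only [sub_zero]
    rfl
  · rw [ae_restrict_iff' hΩ.measurableSet]
    refine ae_of_locally fun z hz => ⟨U z, Metric.isOpen_ball, hzU z hz, ?_⟩
    have e1 := (ae_restrict_iff' measurableSet_ball).1 (hφu z hz)
    have e2 : Complex.exp (Complex.I * ((A z z - θ z : ℝ) : ℂ)) = 1 := by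
      rw [Complex.ofReal_sub, mul_sub, Complex.exp_sub, hθv z hz]
      exact div_self (Complex.exp_ne_zero _)
    filter_upwards [hψ z hz, e1] with x hx hx' hxU _
    rw [hx hxU, hx' (hUB z hz hxU), Complex.ofReal_sub, mul_sub, Complex.exp_sub, e2, div_one]
  · intro z hz
    refine ⟨U z, Metric.isOpen_ball, hzU z hz, ?_⟩
    have : IsFiniteMeasure (volume.restrict (U z)) :=
      ⟨by rw [Measure.restrict_apply_univ]; exact measure_ball_lt_top⟩
    exact (memLp_congr_ae (hψ' z hz)).1
      (((hφL z hz).mono_measure (Measure.restrict_mono (hUB z hz) le_rfl)).sub (memLp_const _))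

end Gluing

/-! ### Boundary charts, arc length and the outer normal -/

section Charts

variable {Ω : Set ℂ} {T : ℂ ≃ₗᵢ[ℝ] ℂ} {γ : ℝ → ℝ}

/-- In the coordinates of `graphChart`, the set `Ω` is the upper half of the square of half side `a`
centred at `(s₀, 0)`. -/
structure IsBoundaryChart (Ω : Set ℂ) (T : ℂ ≃ₗᵢ[ℝ] ℂ) (γ : ℝ → ℝ) (hγ : ContDiff ℝ 1 γ)
    (s₀ a : ℝ) : Prop where
  pos : 0 < a
  mem_iff : ∀ s ∈ Icc (s₀ - a) (s₀ + a), ∀ t ∈ Icc (-a) a,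
    (graphChart T γ hγ.continuous (s, t) ∈ Ω ↔ 0 < t)

/-- Every boundary point has a chart centred at it: the ball in the definition of `IsC11` contains
a square in the coordinates `(s, t)`. -/
theorem IsC11.exists_isBoundaryChart (hΩ : IsC11 Ω) {p : ℂ} (hp : p ∈ frontier Ω) :
    ∃ (T : ℂ ≃ₗᵢ[ℝ] ℂ) (γ : ℝ → ℝ) (hγ : ContDiff ℝ 1 γ) (s₀ a : ℝ),
      IsBoundaryChart Ω T γ hγ s₀ a ∧ graphChart T γ hγ.continuous (s₀, 0) = p := by
  obtain ⟨r, hr, e, he, γ, hγ, -, hE⟩ := hΩ.2 p hp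
  obtain ⟨w, rfl⟩ : ∃ w : Circle, (w : ℂ) = e := ⟨⟨e, mem_sphere_zero_iff_norm.2 he⟩, rfl⟩
  set T : ℂ ≃ₗᵢ[ℝ] ℂ := rotation w with hT
  set Θ := graphChart T γ hγ.continuous with hΘ
  have hTs : ∀ z, T.symm z = starRingEnd ℂ w * z := by
    intro z
    rw [LinearIsometryEquiv.symm_apply_eq, hT, rotation_apply]
    have : (w : ℂ) * starRingEnd ℂ w = 1 := by
      simp [Complex.mul_conj, Complex.normSq_eq_norm_sq, he]
    linear_combination (-z) * this
  have hmem : ∀ q : ℝ × ℝ, Θ q ∈ Metric.ball p r → (Θ q ∈ Ω ↔ 0 < q.2) := by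
    intro q hq
    have h1 : T.symm (Θ q) = ⟨q.1, γ q.1 + q.2⟩ := by
      rw [hΘ, graphChart_apply, LinearIsometryEquiv.symm_apply_apply]
    have h2 : Θ q ∈ Ω ∩ Metric.ball p r ↔ Θ q ∈ {z ∈ Metric.ball p r |
      γ ((starRingEnd ℂ w * z).re) < (starRingEnd ℂ w * z).im} := by rw [hE]
    simp only [← hTs] at h2
    rw [mem_inter_iff, mem_ofPred_eq, h1] at h2
    simpa [hq] using h2
  obtain ⟨q, rfl⟩ := Θ.surjective p
  have hpre : Θ ⁻¹' Metric.ball (Θ q) r ∈ 𝓝 q :=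
    Θ.continuous.continuousAt.preimage_mem_nhds (Metric.ball_mem_nhds _ hr)
  rw [hΩ.1.frontier_eq, Set.mem_sdiff] at hp
  have hq2 : q.2 = 0 := by
    refine le_antisymm ?_ ?_
    · have := mt (hmem q (Metric.mem_ball_self hr)).2 hp.2
      exact not_lt.1 this
    · by_contra! hlt
      have h1 : Θ '' {x | x.2 < 0} ∈ 𝓝 (Θ q) :=
        (Θ.isOpenMap _ (isOpen_lt continuous_snd continuous_const)).mem_nhds
          (mem_image_of_mem Θ hlt)
      obtain ⟨_, ⟨hz1, x, hx, rfl⟩, hz2⟩ := mem_closure_iff_nhds.1 hp.1 _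
        (inter_mem (Metric.ball_mem_nhds _ hr) h1)
      exact absurd ((hmem x hz1).1 hz2) (not_lt.2 (le_of_lt hx))
  obtain ⟨a, ha, hsub⟩ := Metric.nhds_basis_closedBall.mem_iff.1 hpre
  refine ⟨T, γ, hγ, q.1, a, ⟨ha, fun s hs t ht => hmem (s, t) (hsub ?_)⟩, ?_⟩
  · rw [Metric.mem_closedBall, Prod.dist_eq, max_le_iff, Real.dist_eq, Real.dist_eq, hq2]
    exact ⟨abs_le.2 ⟨by linarith [hs.1], by linarith [hs.2]⟩, by simpa [abs_le] using ht⟩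
  · rw [← hq2]

variable {hγ : ContDiff ℝ 1 γ} {s₀ a : ℝ}

/-- The part of the plane described by a boundary chart. -/
def chartBox (T : ℂ ≃ₗᵢ[ℝ] ℂ) (γ : ℝ → ℝ) (hγ : ContDiff ℝ 1 γ) (s₀ a : ℝ) : Set ℂ :=
  graphChart T γ hγ.continuous '' (Ioo (s₀ - a) (s₀ + a) ×ˢ Ioo (-a) a)

theorem isOpen_chartBox : IsOpen (chartBox T γ hγ s₀ a) :=
  (graphChart T γ hγ.continuous).isOpenMap _ (isOpen_Ioo.prod isOpen_Ioo)

theorem IsBoundaryChart.mem_frontier_iff (h : IsBoundaryChart Ω T γ hγ s₀ a) (hΩ : IsOpen Ω)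
    {s t : ℝ} (hs : s ∈ Ioo (s₀ - a) (s₀ + a)) (ht : t ∈ Ioo (-a) a) :
    graphChart T γ hγ.continuous (s, t) ∈ frontier Ω ↔ t = 0 := by
  set Θ := graphChart T γ hγ.continuous with hΘ
  have hm := h.mem_iff s (Ioo_subset_Icc_self hs) t (Ioo_subset_Icc_self ht)
  rw [hΩ.frontier_eq, Set.mem_sdiff, hm, not_lt]
  constructor
  · rintro ⟨h1, h2⟩
    refine le_antisymm h2 ?_
    by_contra! hlt
    have h3 : Θ '' (Ioo (s₀ - a) (s₀ + a) ×ˢ Ioo (-a) 0) ∈ 𝓝 (Θ (s, t)) :=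
      (Θ.isOpenMap _ (isOpen_Ioo.prod isOpen_Ioo)).mem_nhds
        (mem_image_of_mem Θ ⟨hs, ht.1, hlt⟩)
    obtain ⟨_, ⟨x, hx, rfl⟩, hz2⟩ := mem_closure_iff_nhds.1 h1 _ h3
    have := (h.mem_iff x.1 (Ioo_subset_Icc_self hx.1) x.2
      ⟨hx.2.1.le, hx.2.2.le.trans h.pos.le⟩).1 hz2
    exact absurd this (not_lt.2 hx.2.2.le)
  · rintro rfl
    refine ⟨?_, le_rfl⟩
    have h1 : Tendsto (fun t : ℝ => Θ (s, t)) (𝓝[>] 0) (𝓝 (Θ (s, 0))) :=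
      ((Θ.continuous.comp (Continuous.prodMk_right s)).tendsto 0).mono_left nhdsWithin_le_nhds
    refine mem_closure_of_tendsto h1 ?_
    filter_upwards [Ioc_mem_nhdsGT h.pos] with t ht
    exact (h.mem_iff s (Ioo_subset_Icc_self hs) t ⟨by linarith [ht.1, h.pos], ht.2⟩).2 ht.1

theorem IsBoundaryChart.frontier_inter (h : IsBoundaryChart Ω T γ hγ s₀ a) (hΩ : IsOpen Ω) :
    frontier Ω ∩ chartBox T γ hγ s₀ a =
      (fun s => graphChart T γ hγ.continuous (s, 0)) '' Ioo (s₀ - a) (s₀ + a) := by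
  ext z
  constructor
  · rintro ⟨hz, ⟨s, t⟩, ⟨hs, ht⟩, rfl⟩
    rw [h.mem_frontier_iff hΩ hs ht] at hz
    dsimp only at hz
    exact ⟨s, hs, by rw [hz]⟩
  · rintro ⟨s, hs, rfl⟩
    have h0 : (0 : ℝ) ∈ Ioo (-a) a := ⟨by linarith [h.pos], h.pos⟩
    exact ⟨(h.mem_frontier_iff hΩ hs h0).2 rfl, (s, 0), ⟨hs, h0⟩, rfl⟩

theorem exists_lipschitzOnWith_graph (T : ℂ ≃ₗᵢ[ℝ] ℂ) (hγ : ContDiff ℝ 1 γ) (x y : ℝ) :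
    ∃ K, LipschitzOnWith K (fun s => graphChart T γ hγ.continuous (s, 0)) (Icc x y) := by
  refine LocallyLipschitzOn.exists_lipschitzOnWith_of_compact isCompact_Icc
    (LocallyLipschitz.locallyLipschitzOn ?_)
  have h1 : ContDiff ℝ 1 fun s : ℝ => T ((s : ℂ) + ((γ s : ℝ) : ℂ) * Complex.I) := by
    have h2 : ContDiff ℝ 1 fun s : ℝ => (s : ℂ) := Complex.ofRealCLM.contDiff
    exact T.contDiff.comp (h2.add ((Complex.ofRealCLM.contDiff.comp hγ).mul contDiff_const))
  have h3 : (fun s => graphChart T γ hγ.continuous (s, 0))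
      = fun s : ℝ => T ((s : ℂ) + ((γ s : ℝ) : ℂ) * Complex.I) := by
    ext s
    rw [graphChart_apply, add_zero, ← Complex.mk_eq_add_mul_I]
  rw [h3]
  exact h1.locallyLipschitz

/-- The parametrization of the boundary by `s` is Lipschitz, so that a property of almost every `s`
holds `μH[1]`-almost everywhere on the boundary. -/
theorem IsBoundaryChart.arcLength_null (h : IsBoundaryChart Ω T γ hγ s₀ a) (hΩ : IsOpen Ω)
    {P : ℂ → Prop} (hP : ∀ᵐ s, s ∈ Ioo (s₀ - a) (s₀ + a) →
      P (graphChart T γ hγ.continuous (s, 0))) :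
    ∀ᵐ z ∂(μH[1] : Measure ℂ), z ∈ chartBox T γ hγ s₀ a → z ∈ frontier Ω → P z := by
  obtain ⟨K, hK⟩ := exists_lipschitzOnWith_graph T hγ (s₀ - a) (s₀ + a)
  have h1 : (μH[1] : Measure ℝ)
      {s | ¬ (s ∈ Ioo (s₀ - a) (s₀ + a) → P (graphChart T γ hγ.continuous (s, 0)))} = 0 := by
    rw [hausdorffMeasure_real]
    exact hP
  have h2 := (hK.mono (s := {s | ¬ (s ∈ Ioo (s₀ - a) (s₀ + a) →
    P (graphChart T γ hγ.continuous (s, 0)))}) (fun s hs => by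
      simp only [mem_ofPred_eq, Classical.not_imp] at hs
      exact Ioo_subset_Icc_self hs.1)).hausdorffMeasure_image_le (d := 1) zero_le_one
  rw [h1, mul_zero, nonpos_iff_eq_zero] at h2
  refine ae_iff.2 (measure_mono_null ?_ h2)
  intro z hz
  simp only [mem_ofPred_eq, Classical.not_imp] at hz
  obtain ⟨hz1, hz2, hz3⟩ := hz
  have : z ∈ frontier Ω ∩ chartBox T γ hγ s₀ a := ⟨hz2, hz1⟩
  rw [h.frontier_inter hΩ] at this
  obtain ⟨s, hs, rfl⟩ := this
  exact ⟨s, Classical.not_imp.2 ⟨hs, hz3⟩, rfl⟩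

theorem mem_chartBox (ha : 0 < a) :
    graphChart T γ hγ.continuous (s₀, 0) ∈ chartBox T γ hγ s₀ a :=
  ⟨(s₀, 0), ⟨⟨by linarith, by linarith⟩, by linarith, by linarith⟩, rfl⟩

theorem isFiniteMeasure_arcLength (hΩ : IsC11 Ω) (hb : Bornology.IsBounded Ω) :
    IsFiniteMeasure (arcLength Ω) := by
  refine ⟨?_⟩
  rw [arcLength, Measure.restrict_apply_univ]
  have hc : IsCompact (frontier Ω) :=
    Metric.isCompact_of_isClosed_isBounded isClosed_frontier
      (hb.closure.subset frontier_subset_closure)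
  refine hc.measure_lt_top_of_nhdsWithin fun p hp => ?_
  obtain ⟨T, γ, hγ, s₀, a, h, rfl⟩ := hΩ.exists_isBoundaryChart hp
  refine ⟨frontier Ω ∩ chartBox T γ hγ s₀ a, inter_mem_nhdsWithin _
    (isOpen_chartBox.mem_nhds (mem_chartBox h.pos)), ?_⟩
  obtain ⟨K, hK⟩ := exists_lipschitzOnWith_graph T hγ (s₀ - a) (s₀ + a)
  rw [h.frontier_inter hΩ.1]
  refine ((hK.mono Ioo_subset_Icc_self).hausdorffMeasure_image_le zero_le_one).trans_lt ?_
  rw [hausdorffMeasure_real, Real.volume_Ioo]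
  exact ENNReal.mul_lt_top (by simp) ENNReal.ofReal_lt_top

theorem IsOuterUnitNormal.eq {p n n' : ℂ} (h : IsOuterUnitNormal Ω p n)
    (h' : IsOuterUnitNormal Ω p n') : n = n' := by
  have hn := real_inner_self_eq_norm_sq n
  have hn' := real_inner_self_eq_norm_sq n'
  rw [h.1] at hn
  rw [h'.1] at hn'
  by_contra hne
  -- the direction `n - n'` would both enter and leave `Ω`
  have hpos : 0 < ‖n - n'‖ ^ 2 := by
    have := norm_pos_iff.2 (sub_ne_zero.2 hne)
    positivity
  rw [← real_inner_self_eq_norm_sq, inner_sub_left, inner_sub_right, inner_sub_right,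
    real_inner_comm n n', hn, hn'] at hpos
  have h1 := (h.2 (n - n')).1 (by rw [inner_sub_left, hn, real_inner_comm]; linarith)
  have h2 := (h'.2 (n - n')).2 (by rw [inner_sub_left, hn']; linarith)
  obtain ⟨t, ht1, ht2⟩ := (h1.and h2).exists
  exact ht1 ht2

/-- The normal of the graph of `γ` is the outer unit normal of `Ω`. -/
theorem IsBoundaryChart.isOuterUnitNormal (h : IsBoundaryChart Ω T γ hγ s₀ a) {s : ℝ}
    (hs : s ∈ Ioo (s₀ - a) (s₀ + a)) :
    IsOuterUnitNormal Ω (graphChart T γ hγ.continuous (s, 0))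
      ((Real.sqrt (1 + deriv γ s ^ 2))⁻¹ • T ⟨deriv γ s, -1⟩) := by
  set Θ := graphChart T γ hγ.continuous with hΘ
  set R := Real.sqrt (1 + deriv γ s ^ 2) with hR
  have hRpos : 0 < R := Real.sqrt_pos.2 (by positivity)
  have hnorm : ‖(⟨deriv γ s, -1⟩ : ℂ)‖ = R := by
    rw [hR, Complex.norm_eq_sqrt_sq_add_sq]
    congr 1
    ring
  refine ⟨?_, fun v => ?_⟩
  · rw [norm_smul, T.norm_map, hnorm, Real.norm_of_nonneg (inv_nonneg.2 hRpos.le)]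
    exact inv_mul_cancel₀ hRpos.ne'
  set w := T.symm v with hw
  have hv : v = T w := by rw [hw, LinearIsometryEquiv.apply_symm_apply]
  have hinner : inner ℝ v (R⁻¹ • T ⟨deriv γ s, -1⟩) = R⁻¹ * (w.re * deriv γ s - w.im) := by
    rw [inner_smul_right, hv, LinearIsometryEquiv.inner_map_map, Complex.inner]
    congr 1
    simp
    ring
  -- the second coordinate along the half-line of direction `v`
  set k : ℝ → ℝ := fun t => γ s + t * w.im - γ (s + t * w.re) with hk
  have hpath : ∀ t : ℝ, Θ (s, 0) + t * v = Θ (s + t * w.re, k t) := by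
    intro t
    have e1 : (t : ℂ) * v = T (t • w) := by rw [map_smul, ← hv, Complex.real_smul]
    rw [hΘ, graphChart_apply, graphChart_apply, e1, ← map_add]
    congr 1
    apply Complex.ext <;> simp [hk]
  have hkd : HasDerivAt k (w.im - w.re * deriv γ s) 0 := by
    have e1 : HasDerivAt (fun t : ℝ => s + t * w.re) w.re 0 := by
      simpa using ((hasDerivAt_id (0 : ℝ)).mul_const w.re).const_add s
    have e2 : HasDerivAt γ (deriv γ s) (s + 0 * w.re) := by
      rw [zero_mul, add_zero]
      exact (hγ.differentiable one_ne_zero s).hasDerivAt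
    have e3 : HasDerivAt (fun t : ℝ => γ (s + t * w.re)) (deriv γ s * w.re) 0 :=
      HasDerivAt.comp (0 : ℝ) (h₂ := γ) e2 e1
    have e4 : HasDerivAt (fun t : ℝ => γ s + t * w.im) w.im 0 := by
      simpa using ((hasDerivAt_id (0 : ℝ)).mul_const w.im).const_add (γ s)
    rw [mul_comm w.re]
    exact e4.sub e3
  have hk0 : k 0 = 0 := by simp [hk]
  have hslope : Tendsto (fun t => t⁻¹ * k t) (𝓝[>] 0) (𝓝 (w.im - w.re * deriv γ s)) := by
    have := (hasDerivAt_iff_tendsto_slope.1 hkd).mono_left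
      (nhdsWithin_mono 0 fun t (ht : 0 < t) => ht.ne')
    refine this.congr fun t => ?_
    rw [slope_def_field, hk0]
    ring
  have hcont : ContinuousAt k 0 := hkd.continuousAt
  have hmem : ∀ᶠ t : ℝ in 𝓝[>] (0 : ℝ), (Θ (s, 0) + t * v ∈ Ω ↔ 0 < k t) := by
    have e1 : ∀ᶠ t : ℝ in 𝓝 0, s + t * w.re ∈ Icc (s₀ - a) (s₀ + a) := by
      have : ContinuousAt (fun t : ℝ => s + t * w.re) 0 := by fun_prop
      refine this.eventually_mem (Icc_mem_nhds ?_ ?_) <;> simp [hs.1, hs.2]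
    have e2 : ∀ᶠ t : ℝ in 𝓝 0, k t ∈ Icc (-a) a := by
      refine hcont.eventually_mem (Icc_mem_nhds ?_ ?_) <;> rw [hk0]
      · linarith [h.pos]
      · exact h.pos
    filter_upwards [nhdsWithin_le_nhds e1, nhdsWithin_le_nhds e2] with t h1 h2
    rw [hpath]
    exact h.mem_iff _ h1 _ h2
  rw [hinner]
  constructor
  · intro hpos
    have e1 := pos_of_mul_pos_right hpos (inv_nonneg.2 hRpos.le)
    filter_upwards [hmem, hslope.eventually_lt_const (show w.im - w.re * deriv γ s < 0 by linarith),
      self_mem_nhdsWithin] with t h1 h2 (h3 : 0 < t)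
    rw [h1, not_lt]
    by_contra! h4
    exact absurd (mul_pos (inv_pos.2 h3) h4) (not_lt.2 h2.le)
  · intro hneg
    have e1 : w.re * deriv γ s - w.im < 0 := by
      by_contra! h4
      exact absurd (mul_nonneg (inv_nonneg.2 hRpos.le) h4) (not_le.2 hneg)
    filter_upwards [hmem, hslope.eventually_const_lt (show 0 < w.im - w.re * deriv γ s by linarith),
      self_mem_nhdsWithin] with t h1 h2 (h3 : 0 < t)
    rw [h1]
    exact pos_of_mul_pos_right h2 (inv_nonneg.2 h3.le)

theorem outerNormal_eq {p n : ℂ} (h : IsOuterUnitNormal Ω p n) : outerNormal Ω p = n :=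
  (Classical.epsilon_spec (p := IsOuterUnitNormal Ω p) ⟨n, h⟩).eq h

theorem IsC11.norm_outerNormal (hΩ : IsC11 Ω) {p : ℂ} (hp : p ∈ frontier Ω) :
    ‖outerNormal Ω p‖ = 1 := by
  obtain ⟨T, γ, hγ, s₀, a, h, rfl⟩ := hΩ.exists_isBoundaryChart hp
  have := h.isOuterUnitNormal (s := s₀) ⟨by linarith [h.pos], by linarith [h.pos]⟩
  rw [outerNormal_eq this]
  exact this.1

theorem IsC11.continuousOn_outerNormal (hΩ : IsC11 Ω) :
    ContinuousOn (outerNormal Ω) (frontier Ω) := by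
  intro p hp
  obtain ⟨T, γ, hγ, s₀, a, h, rfl⟩ := hΩ.exists_isBoundaryChart hp
  set Θ := graphChart T γ hγ.continuous with hΘ
  -- a continuous function of the first coordinate, which is the normal along the boundary
  have hd : Continuous (deriv γ) := hγ.continuous_deriv le_rfl
  have hN : Continuous fun s : ℝ => (Real.sqrt (1 + deriv γ s ^ 2))⁻¹ • T ⟨deriv γ s, -1⟩ := by
    have h1 : Continuous fun s : ℝ => (⟨deriv γ s, -1⟩ : ℂ) := by
      have : (fun s : ℝ => (⟨deriv γ s, -1⟩ : ℂ))
          = fun s : ℝ => ((deriv γ s : ℝ) : ℂ) + ((-1 : ℝ) : ℂ) * Complex.I := by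
        ext s
        rw [← Complex.mk_eq_add_mul_I]
      rw [this]
      fun_prop
    refine Continuous.smul (Continuous.inv₀ ((continuous_const.add (hd.pow 2)).sqrt) fun s => ?_)
      (T.continuous.comp h1)
    have : 0 < 1 + deriv γ s ^ 2 := by positivity
    exact (Real.sqrt_pos.2 this).ne'
  have hc : Continuous fun z : ℂ => (Real.sqrt (1 + deriv γ (Θ.symm z).1 ^ 2))⁻¹ •
      T ⟨deriv γ (Θ.symm z).1, -1⟩ := hN.comp (continuous_fst.comp Θ.symm.continuous)
  have heq : ∀ z ∈ frontier Ω ∩ chartBox T γ hγ s₀ a, outerNormal Ω z =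
      (Real.sqrt (1 + deriv γ (Θ.symm z).1 ^ 2))⁻¹ • T ⟨deriv γ (Θ.symm z).1, -1⟩ := by
    intro z hz
    rw [h.frontier_inter hΩ.1] at hz
    obtain ⟨s, hs, rfl⟩ := hz
    dsimp only
    rw [← hΘ, Homeomorph.symm_apply_apply]
    exact outerNormal_eq (h.isOuterUnitNormal hs)
  have hmem := mem_chartBox (T := T) (γ := γ) (hγ := hγ) (s₀ := s₀) h.pos
  refine hc.continuousWithinAt.congr_of_eventuallyEq ?_ (heq _ ⟨hp, hmem⟩)
  filter_upwards [self_mem_nhdsWithin, nhdsWithin_le_nhds (isOpen_chartBox.mem_nhds hmem)]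
    with z hz1 hz2
  exact heq z ⟨hz1, hz2⟩

end Charts

/-! ### Sobolev functions in a boundary chart -/

section BoundaryLines

variable {Ω : Set ℂ} {T : ℂ ≃ₗᵢ[ℝ] ℂ} {γ : ℝ → ℝ} {hγ : ContDiff ℝ 1 γ} {s₀ a : ℝ} {f f' : ℂ → ℝ}

theorem IsBoundaryChart.image_subset (h : IsBoundaryChart Ω T γ hγ s₀ a) :
    graphChart T γ hγ.continuous '' (Icc (s₀ - a) (s₀ + a) ×ˢ Ioc 0 a) ⊆ Ω := by
  rintro _ ⟨⟨s, t⟩, ⟨hs, ht⟩, rfl⟩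
  exact (h.mem_iff s hs t ⟨by linarith [ht.1, h.pos], ht.2⟩).2 ht.1

theorem integrable_comp_graphChart {A B : Set ℝ}
    (hf : IntegrableOn f (graphChart T γ hγ.continuous '' (A ×ˢ B))) :
    Integrable (fun q => f (graphChart T γ hγ.continuous q))
      ((volume.restrict A).prod (volume.restrict B)) :=
  ((graphChart_restrict A B).integrable_comp_emb
    (graphChart T γ hγ.continuous).measurableEmbedding).2 hf

/-- Up to the boundary, on almost every line transversal to the boundary, a weakly differentiable
function is an indefinite integral of its weak derivative. -/
theorem IsBoundaryChart.ae_line (h : IsBoundaryChart Ω T γ hγ s₀ a) (hΩ : IsOpen Ω)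
    (hf : IsWeakDeriv Ω (T Complex.I) f f') (hf' : IntegrableOn f' Ω) :
    ∀ᵐ s ∂volume.restrict (Icc (s₀ - a) (s₀ + a)),
      IntegrableOn (fun t => f' (graphChart T γ hγ.continuous (s, t))) (Ioc 0 a) ∧
      ∃ C, ∀ᵐ t ∂volume.restrict (Ioc 0 a), f (graphChart T γ hγ.continuous (s, t))
        = C + ∫ τ in (0 : ℝ)..t, f' (graphChart T γ hγ.continuous (s, τ)) := by
  set Θ := graphChart T γ hγ.continuous with hΘ
  have ha := h.pos
  have hm0 : ∀ m : ℕ, 0 < a / (m + 2) := fun m => by positivity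
  have hma : ∀ m : ℕ, a / (m + 2) ≤ a / 2 := fun m =>
    div_le_div_of_nonneg_left ha.le two_pos (by simp)
  have hJ : ∀ m : ℕ, Icc (a / (m + 2)) a ⊆ Ioc 0 a := fun m t ht =>
    ⟨(hm0 m).trans_le ht.1, ht.2⟩
  have hint := (integrable_comp_graphChart (hγ := hγ) (hf'.mono_set h.image_subset)).prod_right_ae
  have hline := fun m : ℕ => hf.ae_line (γ := γ) (hγ := hγ.continuous) (a := s₀ - a)
    (b := s₀ + a) (c := a / (m + 2)) (d := a) hΩ (by linarith [hma m])
    ((image_mono (Set.prod_mono_right (hJ m))).trans h.image_subset)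
  filter_upwards [hint, ae_all_iff.2 hline] with s h1 h2
  refine ⟨h1, ?_⟩
  have hI : ∀ {x y : ℝ}, 0 ≤ x → x ≤ y → y ≤ a →
      IntervalIntegrable (fun τ => f' (Θ (s, τ))) volume x y := fun hx hxy hy =>
    (intervalIntegrable_iff_integrableOn_Ioc_of_le hxy).2
      (IntegrableOn.mono_set h1 (Ioc_subset_Ioc hx hy))
  choose C hC using fun m => (h2 m).2
  set D : ℕ → ℝ := fun m => C m - ∫ τ in (0 : ℝ)..(a / (m + 2)), f' (Θ (s, τ)) with hD
  have hCD : ∀ m : ℕ, ∀ᵐ t, t ∈ Icc (a / (m + 2)) a →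
      f (Θ (s, t)) = D m + ∫ τ in (0 : ℝ)..t, f' (Θ (s, τ)) := by
    intro m
    filter_upwards [(ae_restrict_iff' measurableSet_Icc).1 (hC m)] with t ht htm
    rw [ht htm, ← intervalIntegral.integral_add_adjacent_intervals
      (hI le_rfl (hm0 m).le ((hma m).trans (by linarith))) (hI (hm0 m).le htm.1 htm.2), hD]
    ring
  have hDeq : ∀ m, D m = D 0 := by
    intro m
    have hne : (ae (volume.restrict (Icc (a / 2) a))).NeBot := by
      rw [ae_neBot, Ne, Measure.restrict_eq_zero, Real.volume_Icc, ENNReal.ofReal_eq_zero]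
      linarith
    obtain ⟨t, ht, ht1, ht2⟩ := ((ae_restrict_mem (μ := volume) (s := Icc (a / 2) a)
      measurableSet_Icc).and (ae_restrict_of_ae ((hCD m).and (hCD 0)))).exists
    have e1 := ht1 ⟨(hma m).trans ht.1, ht.2⟩
    have e2 := ht2 ⟨by simpa using ht.1, ht.2⟩
    linarith
  refine ⟨D 0, (ae_restrict_iff' measurableSet_Ioc).2 ?_⟩
  filter_upwards [ae_all_iff.2 hCD] with t ht hta
  obtain ⟨m, hm⟩ := exists_nat_gt (a / t)
  rw [ht m ⟨?_, hta.2⟩, hDeq m]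
  rw [div_lt_iff₀ hta.1] at hm
  rw [div_le_iff₀ (by positivity)]
  nlinarith [hta.1]

/-- A function with square integrable derivatives, which is square integrable at positive distance
from the boundary, is square integrable up to the boundary: on almost all lines transversal to the
boundary, it is controlled by its mean over an interior part of the line and the integral of its
derivative. -/
theorem IsBoundaryChart.memLp (h : IsBoundaryChart Ω T γ hγ s₀ a) (hΩ : IsOpen Ω)
    (hf : IsWeakDeriv Ω (T Complex.I) f f') (hf'i : IntegrableOn f' Ω)
    (hf' : MemLp f' 2 (volume.restrict Ω))
    (hfi : MemLp f 2 (volume.restrict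
      (graphChart T γ hγ.continuous '' (Icc (s₀ - a) (s₀ + a) ×ˢ Icc (a / 2) a)))) :
    MemLp f 2 (volume.restrict
      (graphChart T γ hγ.continuous '' (Icc (s₀ - a) (s₀ + a) ×ˢ Ioc 0 a))) := by
  set Θ := graphChart T γ hγ.continuous with hΘ
  have ha := h.pos
  set μ := volume.restrict (Icc (s₀ - a) (s₀ + a)) with hμ
  set ν := volume.restrict (Ioc 0 a) with hν
  have hmp : MeasurePreserving Θ (μ.prod ν)
    (volume.restrict (Θ '' (Icc (s₀ - a) (s₀ + a) ×ˢ Ioc 0 a))) := graphChart_restrict _ _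
  have hmp' : MeasurePreserving Θ (μ.prod (volume.restrict (Icc (a / 2) a)))
    (volume.restrict (Θ '' (Icc (s₀ - a) (s₀ + a) ×ˢ Icc (a / 2) a))) := graphChart_restrict _ _
  have hsub := h.image_subset
  have hF' : MemLp (fun q => f' (Θ q)) 2 (μ.prod ν) :=
    (hf'.mono_measure (Measure.restrict_mono hsub le_rfl)).comp_measurePreserving hmp
  have hFi : MemLp (fun q => f (Θ q)) 2 (μ.prod (volume.restrict (Icc (a / 2) a))) :=
    hfi.comp_measurePreserving hmp'
  have hFm : AEStronglyMeasurable (fun q => f (Θ q)) (μ.prod ν) :=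
    (hf.1.aestronglyMeasurable.mono_set hsub).comp_measurePreserving hmp
  set M : ℝ → ℝ := fun s => (∫⁻ t, ‖f' (Θ (s, t))‖ₑ ∂ν).toReal with hM
  set P : ℝ → ℝ := fun s => (∫⁻ t in Icc (a / 2) a, ‖f (Θ (s, t))‖ₑ).toReal with hP
  set N : ℝ → ℝ := fun s => (2 / a) * P s + 2 * M s with hN
  have hNL : MemLp (fun q : ℝ × ℝ => N q.1) 2 (μ.prod ν) :=
    MemLp.comp_fst (((memLp_marginal hFi).const_mul _).add ((memLp_marginal hF').const_mul _)) ν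
  -- `f = C + ∫ f'` on the line over `s`, and `|C|` is estimated by averaging over `[a / 2, a]`
  have hbound : ∀ᵐ s ∂μ, ∀ᵐ t ∂ν, ‖f (Θ (s, t))‖ ≤ ‖N s‖ := by
    filter_upwards [h.ae_line hΩ hf hf'i, (hFi.integrable (by norm_num)).prod_right_ae]
      with s ⟨h1, C, h2⟩ h3
    have hMs : ∀ t ∈ Ioc 0 a, |∫ τ in (0 : ℝ)..t, f' (Θ (s, τ))| ≤ M s := by
      intro t ht
      rw [hM]
      dsimp only
      rw [← integral_norm_eq_lintegral_enorm h1.aestronglyMeasurable,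
        intervalIntegral.integral_of_le ht.1.le]
      exact (norm_integral_le_integral_norm _).trans (setIntegral_mono_set h1.norm
        (Eventually.of_forall fun _ => norm_nonneg _)
        (Ioc_subset_Ioc_right ht.2).eventuallyLE)
    have hC : |C| ≤ (2 / a) * P s + M s := by
      have h4 : ∀ᵐ t ∂volume.restrict (Icc (a / 2) a), |C| ≤ ‖f (Θ (s, t))‖ + M s := by
        rw [ae_restrict_iff' measurableSet_Icc]
        filter_upwards [(ae_restrict_iff' measurableSet_Ioc).1 h2] with t ht htm
        have htm' : t ∈ Ioc 0 a := ⟨by linarith [htm.1], htm.2⟩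
        have h5 := hMs t htm'
        have h6 : C = f (Θ (s, t)) - ∫ τ in (0 : ℝ)..t, f' (Θ (s, τ)) := by
          rw [ht htm']
          ring
        rw [h6]
        exact (abs_sub _ _).trans (add_le_add le_rfl h5)
      have h7 := integral_mono_ae (integrable_const _) (h3.norm.add (integrable_const (M s))) h4
      rw [integral_add' h3.norm (integrable_const _),
        integral_norm_eq_lintegral_enorm h3.aestronglyMeasurable] at h7
      simp only [integral_const, measureReal_restrict_apply_univ, Real.volume_real_Icc,
        smul_eq_mul] at h7
      rw [max_eq_left (by linarith), show a - a / 2 = a / 2 by ring] at h7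
      have h8 : (2 / a) * (a / 2 * |C|) ≤ (2 / a) * (P s + a / 2 * M s) :=
        mul_le_mul_of_nonneg_left h7 (by positivity)
      have h9 : (2 / a) * (a / 2) = 1 := by field_simp
      rw [mul_add, ← mul_assoc, ← mul_assoc, h9, one_mul, one_mul] at h8
      exact h8
    filter_upwards [h2, ae_restrict_mem measurableSet_Ioc] with t ht htm
    rw [ht]
    refine le_trans ?_ (le_abs_self _)
    have h5 := (abs_add_le C (∫ τ in (0 : ℝ)..t, f' (Θ (s, τ)))).trans (add_le_add hC (hMs t htm))
    refine h5.trans (le_of_eq ?_)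
    rw [hN]
    ring
  rw [← hmp.map_eq, Θ.measurableEmbedding.memLp_map_measure_iff]
  change MemLp (fun q => f (Θ q)) 2 (μ.prod ν)
  refine ⟨hFm, ?_⟩
  have hN2 := (eLpNorm_lt_top_iff_lintegral_rpow_enorm_lt_top (by norm_num) (by norm_num)).1 hNL.2
  rw [eLpNorm_lt_top_iff_lintegral_rpow_enorm_lt_top (by norm_num) (by norm_num)]
  refine lt_of_le_of_lt ?_ hN2
  rw [lintegral_prod _ (hFm.enorm.pow_const _),
    lintegral_prod _ (hNL.aestronglyMeasurable.enorm.pow_const _)]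
  refine lintegral_mono_ae ?_
  filter_upwards [hbound] with s hs
  refine lintegral_mono_ae ?_
  filter_upwards [hs] with t ht
  gcongr
  exact enorm_le_iff_norm_le.2 ht

/-- The boundary values of `f` along the lines transversal to the boundary. -/
theorem IsBoundaryChart.exists_boundary_value (h : IsBoundaryChart Ω T γ hγ s₀ a) (hΩ : IsOpen Ω)
    (hf : IsWeakDeriv Ω (T Complex.I) f f') (hf' : IntegrableOn f' Ω) (hfi : IntegrableOn f Ω) :
    ∃ c : ℝ → ℝ, IntegrableOn c (Icc (s₀ - a) (s₀ + a)) ∧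
      ∀ᵐ s ∂volume.restrict (Icc (s₀ - a) (s₀ + a)), ∀ᵐ t ∂volume.restrict (Ioc 0 a),
        ‖f (graphChart T γ hγ.continuous (s, t)) - c s‖ₑ
          ≤ ∫⁻ τ in Ioc 0 t, ‖f' (graphChart T γ hγ.continuous (s, τ))‖ₑ := by
  set Θ := graphChart T γ hγ.continuous with hΘ
  have ha := h.pos
  set μ := volume.restrict (Icc (s₀ - a) (s₀ + a)) with hμ
  set ν := volume.restrict (Ioc 0 a) with hν
  have hμ0 : (ae μ).NeBot := by
    rw [ae_neBot, Ne, Measure.restrict_eq_zero, Real.volume_Icc, ENNReal.ofReal_eq_zero]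
    linarith
  have hl := h.ae_line hΩ hf hf'
  have hF := integrable_comp_graphChart (hγ := hγ) (hfi.mono_set h.image_subset)
  have hF' := integrable_comp_graphChart (hγ := hγ) (hf'.mono_set h.image_subset)
  rw [← hμ, ← hν] at hF hF'
  obtain ⟨c, hc⟩ := (hl.mono fun s hs => hs.2).choice
  have hbound : ∀ᵐ s ∂μ, ∀ᵐ t ∂ν,
      ‖f (Θ (s, t)) - c s‖ₑ ≤ ∫⁻ τ in Ioc 0 t, ‖f' (Θ (s, τ))‖ₑ := by
    filter_upwards [hc] with s hs
    filter_upwards [hs, ae_restrict_mem measurableSet_Ioc] with t ht htm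
    rw [ht, add_sub_cancel_left, intervalIntegral.integral_of_le htm.1.le]
    exact enorm_integral_le_lintegral_enorm _
  refine ⟨c, ?_, hbound⟩
  have hcm : AEStronglyMeasurable c μ := by
    -- `c s` is the limit of the means of `f` over the segments `{s} × (0, a / (n + 1)]`
    refine aestronglyMeasurable_of_tendsto_ae atTop
      (f := fun (n : ℕ) s => (a / (n + 1))⁻¹ * ∫ t in Ioc 0 (a / (n + 1)), f (Θ (s, t)))
      (fun n => ?_) ?_
    · have hle : volume.restrict (Ioc 0 (a / (n + 1))) ≤ ν :=
        Measure.restrict_mono (Ioc_subset_Ioc_right (div_le_self ha.le (by simp))) le_rfl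
      have h1 : AEStronglyMeasurable (fun q => f (Θ q))
          (μ.prod (volume.restrict (Ioc 0 (a / (n + 1))))) :=
        hF.aestronglyMeasurable.mono_measure (Measure.prod_mono le_rfl hle)
      exact h1.integral_prod_right'.const_mul _
    · filter_upwards [hc, hl, hF.prod_right_ae] with s h1 h2 h3
      have hn : ∀ n : ℕ, 0 < a / ((n : ℝ) + 1) := fun n => by positivity
      have hna : ∀ n : ℕ, a / ((n : ℝ) + 1) ≤ a := fun n => div_le_self ha.le (by simp)
      set B : ℝ → ℝ := fun x => ∫ τ in (0 : ℝ)..x, ‖f' (Θ (s, τ))‖ with hB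
      have hf'Icc : IntegrableOn (fun τ => f' (Θ (s, τ))) (Icc 0 a) :=
        (integrableOn_Icc_iff_integrableOn_Ioc (by simp)).2 h2.1
      have hBlim : Tendsto (fun n : ℕ => B (a / ((n : ℝ) + 1))) atTop (𝓝 0) := by
        have h4 : ContinuousOn B (uIcc 0 a) :=
          intervalIntegral.continuousOn_primitive_interval
            (by rw [uIcc_of_le ha.le]; exact hf'Icc.norm)
        have h5 : Tendsto (fun n : ℕ => a / ((n : ℝ) + 1)) atTop (𝓝[uIcc 0 a] 0) := by
          refine tendsto_nhdsWithin_iff.2 ⟨?_, Eventually.of_forall fun n => ?_⟩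
          · simpa [div_eq_mul_inv] using tendsto_one_div_add_atTop_nhds_zero_nat.const_mul a
          · rw [uIcc_of_le ha.le]
            exact ⟨(hn n).le, hna n⟩
        have h6 := (h4 0 left_mem_uIcc).tendsto.comp h5
        simpa [hB, Function.comp_def] using h6
      refine tendsto_iff_norm_sub_tendsto_zero.2 (squeeze_zero (fun _ => norm_nonneg _)
        (fun n => ?_) hBlim)
      have hI : IntegrableOn (fun t => f (Θ (s, t))) (Ioc 0 (a / (n + 1))) :=
        IntegrableOn.mono_set h3 (Ioc_subset_Ioc_right (hna n))
      have e1 : (a / ((n : ℝ) + 1))⁻¹ * (∫ t in Ioc 0 (a / ((n : ℝ) + 1)), f (Θ (s, t))) - c s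
          = (a / ((n : ℝ) + 1))⁻¹ * ∫ t in (0 : ℝ)..(a / ((n : ℝ) + 1)), (f (Θ (s, t)) - c s) := by
        rw [intervalIntegral.integral_sub
          ((intervalIntegrable_iff_integrableOn_Ioc_of_le (hn n).le).2 hI)
          intervalIntegrable_const, intervalIntegral.integral_const, mul_sub,
          intervalIntegral.integral_of_le (hn n).le, sub_zero, smul_eq_mul,
          inv_mul_cancel_left₀ (hn n).ne']
      rw [e1, norm_mul, norm_inv, Real.norm_of_nonneg (hn n).le, inv_mul_le_iff₀ (hn n),
        mul_comm]
      have e2 := intervalIntegral.norm_integral_le_of_norm_le_const_ae (a := 0)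
        (b := a / ((n : ℝ) + 1)) (C := B (a / ((n : ℝ) + 1))) (f := fun t => f (Θ (s, t)) - c s) ?_
      · rwa [sub_zero, abs_of_pos (hn n)] at e2
      filter_upwards [(ae_restrict_iff' measurableSet_Ioc).1 h1] with t ht htm
      rw [uIoc_of_le (hn n).le] at htm
      rw [ht ⟨htm.1, htm.2.trans (hna n)⟩, add_sub_cancel_left, hB]
      dsimp only
      rw [intervalIntegral.integral_of_le htm.1.le, intervalIntegral.integral_of_le (hn n).le]
      refine (norm_integral_le_integral_norm _).trans (setIntegral_mono_set
        (IntegrableOn.mono_set h2.1 (Ioc_subset_Ioc_right (hna n))).norm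
        (Eventually.of_forall fun _ => norm_nonneg _) (Ioc_subset_Ioc_right htm.2).eventuallyLE)
  refine ⟨hcm, ?_⟩
  -- `a |c s|` is at most the integral of `|f| + a |f'|` over the segment `{s} × (0, a]`
  have h1 : ENNReal.ofReal a * ∫⁻ s, ‖c s‖ₑ ∂μ
      ≤ (∫⁻ q, ‖f (Θ q)‖ₑ ∂μ.prod ν) + ENNReal.ofReal a * ∫⁻ q, ‖f' (Θ q)‖ₑ ∂μ.prod ν := by
    rw [lintegral_prod _ hF.aestronglyMeasurable.enorm,
      lintegral_prod _ hF'.aestronglyMeasurable.enorm,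
      ← lintegral_const_mul' _ _ ENNReal.ofReal_ne_top,
      ← lintegral_const_mul' _ _ ENNReal.ofReal_ne_top,
      ← lintegral_add_left' hF.aestronglyMeasurable.enorm.lintegral_prod_right']
    refine lintegral_mono_ae ?_
    filter_upwards [hbound, hF.prod_right_ae] with s hs hs'
    have hν1 : ν univ = ENNReal.ofReal a := by
      rw [hν, Measure.restrict_apply_univ, Real.volume_Ioc, sub_zero]
    calc ENNReal.ofReal a * ‖c s‖ₑ = ∫⁻ _, ‖c s‖ₑ ∂ν := by rw [lintegral_const, hν1, mul_comm]
      _ ≤ ∫⁻ t, (‖f (Θ (s, t))‖ₑ + ∫⁻ τ, ‖f' (Θ (s, τ))‖ₑ ∂ν) ∂ν := by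
          refine lintegral_mono_ae ?_
          filter_upwards [hs, ae_restrict_mem measurableSet_Ioc] with t ht htm
          have e1 : c s = f (Θ (s, t)) - (f (Θ (s, t)) - c s) := by ring
          rw [e1]
          refine (enorm_sub_le).trans (add_le_add le_rfl (le_trans (by simpa using ht) ?_))
          exact lintegral_mono_set (Ioc_subset_Ioc_right htm.2)
      _ = _ := by
          rw [lintegral_add_left' hs'.aestronglyMeasurable.enorm, lintegral_const, hν1, mul_comm]
  have h2 : ENNReal.ofReal a * ∫⁻ s, ‖c s‖ₑ ∂μ < ⊤ :=
    h1.trans_lt (ENNReal.add_lt_top.2 ⟨hF.2, ENNReal.mul_lt_top ENNReal.ofReal_lt_top hF'.2⟩)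
  exact (ENNReal.mul_lt_top_iff.1 h2).elim (fun h => h.2) fun h => h.elim
    (fun h => absurd h (by simpa using ha)) fun h => by
      rw [HasFiniteIntegral, h]
      exact ENNReal.zero_lt_top

end BoundaryLines

/-! ### Existence of the boundary trace -/

section Traces

variable {Ω : Set ℂ} {T : ℂ ≃ₗᵢ[ℝ] ℂ} {γ : ℝ → ℝ} {hγ : ContDiff ℝ 1 γ} {s₀ a : ℝ} {f f' : ℂ → ℝ}

theorem dist_graphChart_le (s s' t : ℝ) (L : ℝ) (hL : |γ s' - γ s| ≤ L * |s' - s|) :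
    dist (graphChart T γ hγ.continuous (s', t)) (graphChart T γ hγ.continuous (s, 0))
      ≤ (1 + L) * |s' - s| + |t| := by
  rw [graphChart_apply, graphChart_apply, LinearIsometryEquiv.dist_map, dist_eq_norm]
  refine (Complex.norm_le_abs_re_add_abs_im _).trans ?_
  simp only [Complex.sub_re, Complex.sub_im, add_zero]
  have : |γ s' + t - γ s| ≤ |γ s' - γ s| + |t| := by
    rw [show γ s' + t - γ s = (γ s' - γ s) + t by ring]
    exact abs_add_le _ _
  linarith

theorem abs_le_dist_graphChart (s s' t : ℝ) :
    |s' - s| ≤ dist (graphChart T γ hγ.continuous (s', t)) (graphChart T γ hγ.continuous (s, 0)) ∧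
    |γ s' - γ s + t| ≤
      dist (graphChart T γ hγ.continuous (s', t)) (graphChart T γ hγ.continuous (s, 0)) := by
  rw [graphChart_apply, graphChart_apply, LinearIsometryEquiv.dist_map, dist_eq_norm]
  constructor
  · simpa using Complex.abs_re_le_norm ((⟨s', γ s' + t⟩ : ℂ) - ⟨s, γ s + 0⟩)
  · refine le_trans (le_of_eq ?_)
      (Complex.abs_im_le_norm ((⟨s', γ s' + t⟩ : ℂ) - ⟨s, γ s + 0⟩))
    simp only [Complex.sub_im, add_zero]
    congr 1
    ring

theorem volume_image_graphChart (A B : Set ℝ) :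
    volume (graphChart T γ hγ.continuous '' (A ×ˢ B)) = volume A * volume B := by
  rw [← (measurePreserving_graphChart (T := T) (hγ := hγ.continuous)).measure_preimage_emb
    (graphChart T γ hγ.continuous).measurableEmbedding,
    preimage_image_eq _ (graphChart T γ hγ.continuous).injective, Measure.volume_eq_prod,
    Measure.prod_prod]

/-- The boundary values along transversal lines are boundary traces: at a common Lebesgue point of
the boundary values and of the integrals of `|f'|` over the segments of length `a / (n + 1)`, the
mean oscillation of `f` is bounded in the limit by a multiple of the latter, for every `n`. -/
theorem IsBoundaryChart.ae_exists_hasTraceAt (h : IsBoundaryChart Ω T γ hγ s₀ a) (hΩ : IsOpen Ω)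
    (hf : IsWeakDeriv Ω (T Complex.I) f f') (hf' : IntegrableOn f' Ω) (hfi : IntegrableOn f Ω) :
    ∀ᵐ s, s ∈ Ioo (s₀ - a) (s₀ + a) →
      ∃ y, HasTraceAt Ω f (graphChart T γ hγ.continuous (s, 0)) y := by
  set Θ := graphChart T γ hγ.continuous with hΘ
  have ha := h.pos
  set I := Icc (s₀ - a) (s₀ + a) with hI
  set ν := volume.restrict (Ioc 0 a) with hν
  obtain ⟨c, hc, hbound⟩ := h.exists_boundary_value hΩ hf hf' hfi
  have hF' := integrable_comp_graphChart (hγ := hγ) (hf'.mono_set h.image_subset)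
  obtain ⟨L, hL⟩ : ∃ L : ℝ, 0 ≤ L ∧ ∀ s ∈ I, ∀ s' ∈ I, |γ s' - γ s| ≤ L * |s' - s| := by
    obtain ⟨K, hK⟩ := LocallyLipschitzOn.exists_lipschitzOnWith_of_compact
      (isCompact_Icc (a := s₀ - a) (b := s₀ + a)) hγ.locallyLipschitz.locallyLipschitzOn
    exact ⟨K, K.2, fun s hs s' hs' => by simpa [Real.dist_eq] using hK.dist_le_mul s' hs' s hs⟩
  obtain ⟨hL0, hL⟩ := hL
  set J : ℕ → Set ℝ := fun n => Ioc 0 (a / ((n : ℝ) + 1)) with hJ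
  have hJle : ∀ n, J n ⊆ Ioc 0 a := fun n => Ioc_subset_Ioc_right (div_le_self ha.le (by simp))
  set G : ℕ → ℝ → ℝ≥0∞ := fun n => I.indicator fun s => ∫⁻ τ in J n, ‖f' (Θ (s, τ))‖ₑ with hG
  have hGm : ∀ n, AEMeasurable (G n) := by
    intro n
    refine (aemeasurable_indicator_iff measurableSet_Icc).2 ?_
    have h1 : AEStronglyMeasurable (fun q => f' (Θ q))
        ((volume.restrict I).prod (volume.restrict (J n))) :=
      hF'.aestronglyMeasurable.mono_measure
        (Measure.prod_mono le_rfl (Measure.restrict_mono (hJle n) le_rfl))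
    exact h1.enorm.lintegral_prod_right'
  have hGi : ∀ n, ∫⁻ s, G n s ≠ ⊤ := by
    intro n
    rw [hG, lintegral_indicator measurableSet_Icc]
    have h1 := hF'.2
    rw [HasFiniteIntegral, lintegral_prod _ hF'.aestronglyMeasurable.enorm] at h1
    exact ((lintegral_mono fun s => lintegral_mono_set (hJle n)).trans_lt h1).ne
  have hci : Integrable (I.indicator c) := (integrable_indicator_iff measurableSet_Icc).2 hc
  set V := Besicovitch.vitaliFamily (volume : Measure ℝ)
  have hV1 := V.ae_tendsto_lintegral_enorm_sub_div hci.locallyIntegrable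
  have hV2 := ae_all_iff.2 fun n => V.ae_tendsto_lintegral_div (hGm n) (hGi n)
  have hb' := (ae_restrict_iff' measurableSet_Icc).1 hbound
  have hi' := (ae_restrict_iff' measurableSet_Icc).1 hF'.prod_right_ae
  filter_upwards [hV1, hV2, hi'] with s h1 h2 h3 hs
  have hsI : s ∈ I := Ioo_subset_Icc_self hs
  have htend := Besicovitch.tendsto_filterAt (volume : Measure ℝ) s
  refine ⟨c s, ?_⟩
  set p := Θ (s, 0) with hp
  set K := 1 + L with hK
  have hKpos : 0 < K := by positivity
  set M := K * (K + 2) ^ 2 with hM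
  set X : ℝ → ℝ≥0∞ := fun r => (∫⁻ y in Metric.closedBall s r, ‖I.indicator c y - I.indicator c s‖ₑ)
    / volume (Metric.closedBall s r) with hX
  set Y : ℕ → ℝ → ℝ≥0∞ := fun n r => (∫⁻ y in Metric.closedBall s r, G n y)
    / volume (Metric.closedBall s r) with hY
  have hXlim : Tendsto X (𝓝[>] 0) (𝓝 0) := h1.comp htend
  have hYlim : ∀ n, Tendsto (Y n) (𝓝[>] 0) (𝓝 (G n s)) := fun n => (h2 n).comp htend
  have hGlim : Tendsto (fun n => G n s) atTop (𝓝 0) := by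
    have h4 : ∫⁻ τ, ‖f' (Θ (s, τ))‖ₑ ∂ν ≠ ⊤ := (h3 hsI).2.ne
    have h5 := tendsto_setLIntegral_zero (l := atTop) (s := J) h4 (by
      have h6 : Tendsto (fun n : ℕ => ENNReal.ofReal (a / ((n : ℝ) + 1))) atTop (𝓝 0) := by
        have := tendsto_one_div_add_atTop_nhds_zero_nat.const_mul a
        rw [mul_zero] at this
        simpa [div_eq_mul_inv] using ENNReal.tendsto_ofReal this
      refine h6.congr fun n => ?_
      rw [Function.comp_apply, hν, Measure.restrict_apply' measurableSet_Ioc,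
        inter_eq_left.2 (hJle n), hJ, Real.volume_Ioc, sub_zero])
    refine h5.congr fun n => ?_
    rw [hG]
    dsimp only
    rw [indicator_of_mem hsI, hν, Measure.restrict_restrict_of_subset (hJle n)]
  have hmain : ∀ n : ℕ, ∀ᶠ r in 𝓝[>] (0 : ℝ),
      ⨍⁻ y in Ω ∩ Metric.ball p r, ‖f y - c s‖ₑ ∂volume
        ≤ ENNReal.ofReal M * (Y n r + X r) := by
    intro n
    obtain ⟨ρ₀, hρ₀, hρ₀I⟩ := Metric.nhds_basis_closedBall.mem_iff.1 (Icc_mem_nhds hs.1 hs.2)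
    have hr0 : 0 < min ρ₀ (a / ((n : ℝ) + 1) / K) := by positivity
    filter_upwards [Ioc_mem_nhdsGT hr0] with r ⟨hr, hr'⟩
    have hrI : Metric.closedBall s r ⊆ I :=
      (Metric.closedBall_subset_closedBall (hr'.trans (min_le_left _ _))).trans hρ₀I
    have hrK : K * r ≤ a / ((n : ℝ) + 1) := by
      rw [mul_comm, ← le_div_iff₀ hKpos]
      exact hr'.trans (min_le_right _ _)
    have hrJ : Ioc 0 (K * r) ⊆ J n := Ioc_subset_Ioc_right hrK
    have hna : a / ((n : ℝ) + 1) ≤ a := div_le_self ha.le (by simp)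
    -- the image of a point at horizontal and vertical distance `ρ` has distance at most
    -- `K ρ + ρ < r` from `p`
    set ρ := r / (K + 2) with hρ
    have hρpos : 0 < ρ := by positivity
    have hρr : (K + 2) * ρ = r := by rw [hρ]; field_simp
    -- the half ball lies between the images of two rectangles
    have hup : Ω ∩ Metric.ball p r ⊆ Θ '' (Metric.closedBall s r ×ˢ Ioc 0 (K * r)) := by
      rintro z ⟨hzΩ, hz⟩
      obtain ⟨⟨s', t⟩, rfl⟩ := Θ.surjective z
      obtain ⟨e1, e2⟩ := abs_le_dist_graphChart (T := T) (γ := γ) (hγ := hγ) s s' t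
      rw [Metric.mem_ball] at hz
      have e3 : s' ∈ Metric.closedBall s r := by
        rw [Metric.mem_closedBall, Real.dist_eq]
        exact e1.trans hz.le
      have e4 := hL s hsI s' (hrI e3)
      have e5 : |t| ≤ K * r := by
        have e6 : |t| ≤ |γ s' - γ s + t| + |γ s' - γ s| := by
          have := abs_sub (γ s' - γ s + t) (γ s' - γ s)
          rwa [add_sub_cancel_left] at this
        have e7 : L * |s' - s| ≤ L * r := mul_le_mul_of_nonneg_left (e1.trans hz.le) hL0
        have e8 : |γ s' - γ s + t| ≤ r := e2.trans hz.le
        rw [hK, add_mul, one_mul]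
        linarith
      have e9 := abs_le.1 (e5.trans (hrK.trans hna))
      exact ⟨(s', t), ⟨e3, (h.mem_iff s' (hrI e3) t e9).1 hzΩ, (le_abs_self t).trans e5⟩, rfl⟩
    have hlow : Θ '' (Metric.closedBall s ρ ×ˢ Ioc 0 ρ) ⊆ Ω ∩ Metric.ball p r := by
      rintro _ ⟨⟨s', t⟩, ⟨hs', ht⟩, rfl⟩
      have hρr' : ρ ≤ r := by nlinarith
      have hs'I := hrI (Metric.closedBall_subset_closedBall hρr' hs')
      rw [Metric.mem_closedBall, Real.dist_eq] at hs'
      dsimp only at hs' ht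
      have hρK : ρ ≤ K * r := hρr'.trans (by nlinarith)
      refine ⟨(h.mem_iff s' hs'I t ⟨by linarith [ht.1], by linarith [ht.2]⟩).2 ht.1, ?_⟩
      rw [Metric.mem_ball]
      refine (dist_graphChart_le (hγ := hγ) s s' t L (hL s hsI s' hs'I)).trans_lt ?_
      rw [abs_of_pos ht.1]
      have := mul_le_mul_of_nonneg_left hs' hKpos.le
      nlinarith [ht.2]
    have hvol : ENNReal.ofReal (2 * ρ * ρ) ≤ volume (Ω ∩ Metric.ball p r) := by
      refine le_trans (le_of_eq ?_) (measure_mono hlow)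
      rw [hΘ, volume_image_graphChart (hγ := hγ), Real.volume_closedBall, Real.volume_Ioc, sub_zero,
        ENNReal.ofReal_mul (by positivity)]
    have hcint : AEMeasurable (fun y => ‖I.indicator c y - I.indicator c s‖ₑ)
        (volume.restrict (Metric.closedBall s r)) :=
      (hci.aestronglyMeasurable.sub aestronglyMeasurable_const).enorm.restrict
    have hint : ∫⁻ y in Ω ∩ Metric.ball p r, ‖f y - c s‖ₑ
        ≤ ENNReal.ofReal (K * r) * ((∫⁻ y in Metric.closedBall s r, G n y)
          + ∫⁻ y in Metric.closedBall s r, ‖I.indicator c y - I.indicator c s‖ₑ) := by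
      refine (lintegral_mono_set hup).trans ?_
      rw [← (graphChart_restrict _ _).lintegral_comp_emb Θ.measurableEmbedding
        (fun y => ‖f y - c s‖ₑ)]
      refine (lintegral_prod_le _).trans ?_
      rw [← lintegral_add_right' _ hcint, ← lintegral_const_mul' _ _ ENNReal.ofReal_ne_top]
      refine lintegral_mono_ae ((ae_restrict_iff' Metric.isClosed_closedBall.measurableSet).2 ?_)
      filter_upwards [hb'] with s' hs' hs'r
      have hs'I := hrI hs'r
      calc ∫⁻ t in Ioc 0 (K * r), ‖f (Θ (s', t)) - c s‖ₑ
          ≤ ∫⁻ _ in Ioc 0 (K * r), (G n s' + ‖I.indicator c s' - I.indicator c s‖ₑ) := by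
            refine lintegral_mono_ae ((ae_restrict_iff' measurableSet_Ioc).2 ?_)
            filter_upwards [(ae_restrict_iff' measurableSet_Ioc).1 (hs' hs'I)] with t ht htr
            rw [indicator_of_mem hs'I, indicator_of_mem hsI, hG]
            dsimp only
            rw [indicator_of_mem hs'I,
              show f (Θ (s', t)) - c s = (f (Θ (s', t)) - c s') + (c s' - c s) by ring]
            refine (enorm_add_le _ _).trans (add_le_add ((ht (hJle n (hrJ htr))).trans ?_) le_rfl)
            exact lintegral_mono_set (Ioc_subset_Ioc_right (htr.2.trans hrK))
        _ = _ := by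
            rw [lintegral_const, Measure.restrict_apply_univ, Real.volume_Ioc, sub_zero, mul_comm]
    rw [setLAverage_eq]
    have hr2 : volume (Metric.closedBall s r) = ENNReal.ofReal (2 * r) := Real.volume_closedBall _ _
    calc _ ≤ ENNReal.ofReal (K * r) * ((∫⁻ y in Metric.closedBall s r, G n y)
          + ∫⁻ y in Metric.closedBall s r, ‖I.indicator c y - I.indicator c s‖ₑ)
          / ENNReal.ofReal (2 * ρ * ρ) := ENNReal.div_le_div hint hvol
      _ = ENNReal.ofReal M * (Y n r + X r) := by
          rw [hY, hX]
          dsimp only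
          rw [hr2, ← ENNReal.add_div, ← mul_div_assoc (ENNReal.ofReal M)]
          have e1 : ENNReal.ofReal (K * r) / ENNReal.ofReal (2 * ρ * ρ)
              = ENNReal.ofReal M / ENNReal.ofReal (2 * r) := by
            rw [← ENNReal.ofReal_div_of_pos (by positivity),
              ← ENNReal.ofReal_div_of_pos (by positivity)]
            congr 1
            rw [hM, hρ]
            field_simp
          rw [ENNReal.mul_div_right_comm, e1, ENNReal.mul_div_right_comm]
  refine ENNReal.tendsto_nhds_zero.2 fun ε hε => ?_
  have hlimM : Tendsto (fun n => ENNReal.ofReal M * G n s) atTop (𝓝 0) := by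
    simpa using ENNReal.Tendsto.const_mul hGlim (Or.inr ENNReal.ofReal_ne_top)
  obtain ⟨n, hn⟩ := (hlimM.eventually_lt_const hε).exists
  have hlim : Tendsto (fun r => ENNReal.ofReal M * (Y n r + X r)) (𝓝[>] 0)
      (𝓝 (ENNReal.ofReal M * (G n s + 0))) :=
    ENNReal.Tendsto.const_mul ((hYlim n).add hXlim) (Or.inr ENNReal.ofReal_ne_top)
  rw [add_zero] at hlim
  filter_upwards [hmain n, hlim.eventually_lt_const hn] with r h4 h5
  exact h4.trans h5.le

end Traces

/-! ### Functions of class `H¹` on bounded sets of class `C^{1,1}` -/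

section Global

variable {Ω : Set ℂ}

theorem IsWeakDeriv.direction {E : Type*} [NormedAddCommGroup E] [NormedSpace ℝ E]
    {f f₁ f₂ : ℂ → E} (h1 : IsWeakDeriv Ω 1 f f₁) (h2 : IsWeakDeriv Ω Complex.I f f₂) (v : ℂ) :
    IsWeakDeriv Ω v f fun x => v.re • f₁ x + v.im • f₂ x := by
  rw [isWeakDeriv_iff]
  refine ⟨h1.1, (h1.2.1.smul v.re).add (h2.2.1.smul v.im), fun ψ hψ hc hs => ?_⟩
  have e1 := (isWeakDeriv_iff.1 h1).2.2 ψ hψ hc hs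
  have e2 := (isWeakDeriv_iff.1 h2).2.2 ψ hψ hc hs
  have hi : ∀ w, Integrable fun x => fderiv ℝ ψ x w • f x := fun w =>
    integrable_smul_of_locallyIntegrableOn h1.1 hc hs (continuous_fderiv_apply hψ w)
      fun x hx => fderiv_apply_eq_zero_of_notMem hx w
  have hi' : ∀ {F : ℂ → E}, LocallyIntegrableOn F Ω → Integrable fun x => ψ x • F x := fun hF =>
    integrable_smul_of_locallyIntegrableOn hF hc hs hψ.continuous
      fun x hx => image_eq_zero_of_notMem_tsupport hx
  have hv : ∀ x, fderiv ℝ ψ x v • f x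
      = v.re • (fderiv ℝ ψ x 1 • f x) + v.im • (fderiv ℝ ψ x Complex.I • f x) := by
    intro x
    have : v = v.re • (1 : ℂ) + v.im • Complex.I := by
      apply Complex.ext <;> simp
    conv_lhs => rw [this]
    rw [map_add, map_smul, map_smul, add_smul, smul_assoc, smul_assoc]
  have hw : ∀ x, ψ x • (v.re • f₁ x + v.im • f₂ x)
      = v.re • (ψ x • f₁ x) + v.im • (ψ x • f₂ x) := fun x => by
    rw [smul_add, smul_comm (ψ x) v.re, smul_comm (ψ x) v.im]
  simp only [hv, hw]
  have hadd : ∀ {F G : ℂ → E}, Integrable F → Integrable G →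
      ∫ x, (v.re • F x + v.im • G x) = v.re • (∫ x, F x) + v.im • ∫ x, G x := by
    intro F G hF hG
    rw [← integral_smul, ← integral_smul]
    exact integral_add (hF.smul v.re) (hG.smul v.im)
  rw [hadd (hi 1) (hi Complex.I), hadd (hi' h1.2.1) (hi' h2.2.1), e1, e2, smul_neg, smul_neg,
    neg_add]

theorem memLp_of_isCompact {f : ℂ → ℝ} {K : Set ℂ} {μ : Measure ℂ} (hK : IsCompact K)
    (hf : AEStronglyMeasurable f (μ.restrict K))
    (h : ∀ z ∈ K, ∃ U, IsOpen U ∧ z ∈ U ∧ MemLp f 2 (μ.restrict U)) :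
    MemLp f 2 (μ.restrict K) := by
  refine (memLp_two_iff_integrable_sq hf).2 (LocallyIntegrableOn.integrableOn_isCompact
    (fun z hz => ?_) hK)
  obtain ⟨U, hU, hzU, hfU⟩ := h z hz
  exact ⟨U, nhdsWithin_le_nhds (hU.mem_nhds hzU), hfU.integrable_sq⟩

/-- A locally square integrable function with square integrable derivatives is square integrable on
a bounded set with regular boundary. -/
theorem IsC11.memLp_two (hΩ : IsC11 Ω) (hb : Bornology.IsBounded Ω) {f f₁ f₂ : ℂ → ℝ}
    (h1 : IsWeakDeriv Ω 1 f f₁) (h2 : IsWeakDeriv Ω Complex.I f f₂)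
    (hL1 : MemLp f₁ 2 (volume.restrict Ω)) (hL2 : MemLp f₂ 2 (volume.restrict Ω))
    (hloc : ∀ z ∈ Ω, ∃ U, IsOpen U ∧ z ∈ U ∧ MemLp f 2 (volume.restrict U)) :
    MemLp f 2 (volume.restrict Ω) := by
  have hfm := h1.1.aestronglyMeasurable
  have hfin : IsFiniteMeasure (volume.restrict Ω) :=
    ⟨by rw [Measure.restrict_apply_univ]; exact hb.measure_lt_top⟩
  have hΩcl : (volume.restrict Ω).restrict (closure Ω) = volume.restrict Ω := by
    rw [Measure.restrict_restrict isClosed_closure.measurableSet,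
      inter_eq_right.2 subset_closure]
  have hcomp : IsCompact (closure Ω) := hb.isCompact_closure
  rw [← hΩcl]
  refine memLp_of_isCompact hcomp (by rwa [hΩcl]) fun z hz => ?_
  by_cases hzΩ : z ∈ Ω
  · obtain ⟨U, hU, hzU, hfU⟩ := hloc z hzΩ
    refine ⟨U, hU, hzU, hfU.mono_measure ?_⟩
    exact Measure.restrict_mono_measure Measure.restrict_le_self U
  have hzf : z ∈ frontier Ω := by
    rw [hΩ.1.frontier_eq]
    exact ⟨hz, hzΩ⟩
  obtain ⟨T, γ, hγ, s₀, a, h, rfl⟩ := hΩ.exists_isBoundaryChart hzf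
  have ha := h.pos
  set Θ := graphChart T γ hγ.continuous with hΘ
  have hd := h1.direction h2 (T Complex.I)
  have hdL : MemLp (fun x => (T Complex.I).re • f₁ x + (T Complex.I).im • f₂ x) 2
      (volume.restrict Ω) := (hL1.const_smul (T Complex.I).re).add (hL2.const_smul (T Complex.I).im)
  have hJ : Icc (a / 2) a ⊆ Ioc 0 a := fun t ht => ⟨by linarith [ht.1], ht.2⟩
  have hsubK : Θ '' (Icc (s₀ - a) (s₀ + a) ×ˢ Icc (a / 2) a) ⊆ Ω :=
    (image_mono (Set.prod_mono_right hJ)).trans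
      h.image_subset
  have hfi : MemLp f 2 (volume.restrict (Θ '' (Icc (s₀ - a) (s₀ + a) ×ˢ Icc (a / 2) a))) :=
    memLp_of_isCompact ((isCompact_Icc.prod isCompact_Icc).image Θ.continuous)
      (hfm.mono_set hsubK) fun w hw => hloc w (hsubK hw)
  have hbox := h.memLp hΩ.1 hd (hdL.integrable (by norm_num)) hdL hfi
  refine ⟨chartBox T γ hγ s₀ a, isOpen_chartBox, mem_chartBox ha, hbox.mono_measure ?_⟩
  rw [Measure.restrict_restrict isOpen_chartBox.measurableSet]
  refine Measure.restrict_mono ?_ le_rfl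
  rintro _ ⟨⟨⟨s, t⟩, ⟨hs, ht⟩, rfl⟩, hΩz⟩
  have hs' := Ioo_subset_Icc_self hs
  exact ⟨(s, t), ⟨hs', (h.mem_iff s hs' t (Ioo_subset_Icc_self ht)).1 hΩz, ht.2.le⟩, rfl⟩

theorem IsC11.ae_exists_hasTraceAt (hΩ : IsC11 Ω) (hb : Bornology.IsBounded Ω) {f : ℂ → ℝ}
    (hf : MemH1 Ω f) : ∀ᵐ x ∂arcLength Ω, ∃ y, HasTraceAt Ω f x y := by
  obtain ⟨hL, ⟨f₁, h1, hL1⟩, f₂, h2, hL2⟩ := hf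
  have hfin : IsFiniteMeasure (volume.restrict Ω) :=
    ⟨by rw [Measure.restrict_apply_univ]; exact hb.measure_lt_top⟩
  rw [arcLength, ae_restrict_iff' isClosed_frontier.measurableSet]
  refine ae_of_locally fun z hz => ?_
  obtain ⟨T, γ, hγ, s₀, a, h, rfl⟩ := hΩ.exists_isBoundaryChart hz
  refine ⟨chartBox T γ hγ s₀ a, isOpen_chartBox, mem_chartBox h.pos, h.arcLength_null hΩ.1 ?_⟩
  have hdL : MemLp (fun x => (T Complex.I).re • f₁ x + (T Complex.I).im • f₂ x) 2
      (volume.restrict Ω) := (hL1.const_smul (T Complex.I).re).add (hL2.const_smul (T Complex.I).im)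
  exact h.ae_exists_hasTraceAt hΩ.1 (h1.direction h2 (T Complex.I))
    (hdL.integrable (by norm_num)) (hL.integrable (by norm_num))

section TraceAt

variable {E : Type*} [NormedAddCommGroup E]

theorem hasTraceAt_trace {f : ℂ → E} {p : ℂ} {y : E} (h : HasTraceAt Ω f p y) :
    HasTraceAt Ω f p (trace Ω f p) :=
  Classical.epsilon_spec (p := HasTraceAt Ω f p) ⟨y, h⟩

theorem volume_inter_ball_ne_zero (hΩ : IsOpen Ω) {p : ℂ} (hp : p ∈ closure Ω) {r : ℝ}
    (hr : 0 < r) : volume (Ω ∩ Metric.ball p r) ≠ 0 := by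
  refine ((hΩ.inter Metric.isOpen_ball).measure_pos volume ?_).ne'
  rw [inter_comm]
  exact mem_closure_iff_nhds.1 hp _ (Metric.ball_mem_nhds p hr)

theorem volume_inter_ball_ne_top {p : ℂ} {r : ℝ} : volume (Ω ∩ Metric.ball p r) ≠ ⊤ :=
  ((measure_mono inter_subset_right).trans_lt measure_ball_lt_top).ne

/-- At a boundary point, the means of the constant `‖y - y'‖` over half balls are at most the sum of
the mean oscillations around `y` and `y'`. -/
theorem HasTraceAt.unique (hΩ : IsOpen Ω) {f : ℂ → E}
    (hf : AEStronglyMeasurable f (volume.restrict Ω)) {p : ℂ} (hp : p ∈ closure Ω) {y y' : E}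
    (h : HasTraceAt Ω f p y) (h' : HasTraceAt Ω f p y') : y = y' := by
  have h1 := h.add h'
  rw [add_zero] at h1
  have h2 : ‖y' - y‖ₑ ≤ 0 := by
    refine ge_of_tendsto h1 ?_
    filter_upwards [self_mem_nhdsWithin] with r (hr : 0 < r)
    have hm : AEMeasurable (fun x => ‖f x - y‖ₑ) (volume.restrict (Ω ∩ Metric.ball p r)) :=
      ((hf.mono_set inter_subset_left).sub aestronglyMeasurable_const).enorm
    calc ‖y' - y‖ₑ = ⨍⁻ _ in Ω ∩ Metric.ball p r, ‖y' - y‖ₑ ∂volume := by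
          rw [setLAverage_const (volume_inter_ball_ne_zero hΩ hp hr) volume_inter_ball_ne_top]
      _ ≤ _ := by
          rw [setLAverage_eq, setLAverage_eq, setLAverage_eq, ← ENNReal.add_div,
            ← lintegral_add_left' hm]
          gcongr with x
          rw [show y' - y = (f x - y) - (f x - y') by abel]
          exact enorm_sub_le
  have h3 : y' - y = 0 := by simpa using h2
  exact (sub_eq_zero.1 h3).symm

/-- Traces commute with `t ↦ e^{it}`, which is `1`-Lipschitz. -/
theorem HasTraceAt.exp_I_mul {φ : ℂ → ℝ} {u : ℂ → ℂ}
    (hu : ∀ᵐ x ∂volume.restrict Ω, u x = Complex.exp (Complex.I * φ x)) {p : ℂ} {y : ℝ}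
    (h : HasTraceAt Ω φ p y) : HasTraceAt Ω u p (Complex.exp (Complex.I * y)) := by
  refine tendsto_of_tendsto_of_tendsto_of_le_of_le tendsto_const_nhds h (fun _ => zero_le) ?_
  intro r
  dsimp only
  rw [setLAverage_eq, setLAverage_eq]
  refine ENNReal.div_le_div (lintegral_mono_ae ?_) le_rfl
  filter_upwards [ae_restrict_of_ae_restrict_of_subset inter_subset_left hu] with x hx
  have e1 : u x - Complex.exp (Complex.I * y)
      = Complex.exp (Complex.I * y) * (Complex.exp (Complex.I * ((φ x - y : ℝ) : ℂ)) - 1) := by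
    rw [hx, mul_sub, ← Complex.exp_add, mul_one]
    congr 2
    push_cast
    ring
  rw [e1, enorm_mul, ← ofReal_norm (Complex.exp _), norm_exp_I_mul, ENNReal.ofReal_one, one_mul]
  exact Real.enorm_exp_I_mul_ofReal_sub_one_le

/-- The trace is the limit of the means over small half balls. -/
theorem HasTraceAt.tendsto_average (hΩ : IsOpen Ω) {f : ℂ → ℝ} (hf : IntegrableOn f Ω) {p : ℂ}
    (hp : p ∈ closure Ω) {y : ℝ} (h : HasTraceAt Ω f p y) :
    Tendsto (fun n : ℕ => ⨍ x in Ω ∩ Metric.ball p (1 / ((n : ℝ) + 1)), f x) atTop (𝓝 y) := by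
  have hr : Tendsto (fun n : ℕ => 1 / ((n : ℝ) + 1)) atTop (𝓝[>] 0) :=
    tendsto_nhdsWithin_iff.2 ⟨tendsto_one_div_add_atTop_nhds_zero_nat,
      Eventually.of_forall fun n => mem_Ioi.2 (by positivity)⟩
  rw [tendsto_iff_edist_tendsto_0]
  refine tendsto_of_tendsto_of_tendsto_of_le_of_le tendsto_const_nhds (h.comp hr)
    (fun _ => zero_le) fun n => ?_
  have hn : (0 : ℝ) < 1 / ((n : ℝ) + 1) := by positivity
  have hv := volume_inter_ball_ne_zero hΩ hp hn
  have hv' := volume_inter_ball_ne_top (Ω := Ω) (p := p) (r := 1 / ((n : ℝ) + 1))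
  have hfi := hf.mono_set (inter_subset_left (t := Metric.ball p (1 / ((n : ℝ) + 1))))
  have e1 : (⨍ x in Ω ∩ Metric.ball p (1 / ((n : ℝ) + 1)), f x) - y
      = ⨍ x in Ω ∩ Metric.ball p (1 / ((n : ℝ) + 1)), (f x - y) := by
    have e2 : y = ⨍ _ in Ω ∩ Metric.ball p (1 / ((n : ℝ) + 1)), y := by
      rw [setAverage_const hv hv']
    conv_lhs => rw [e2]
    rw [setAverage_eq, setAverage_eq, setAverage_eq,
      integral_sub hfi (integrableOn_const hv'), smul_sub]
  rw [edist_eq_enorm_sub, e1, Function.comp_apply, setLAverage_eq, setAverage_eq, enorm_smul,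
    mul_comm, ENNReal.div_eq_inv_mul, mul_comm]
  refine mul_le_mul' (le_of_eq ?_) (enorm_integral_le_lintegral_enorm _)
  rw [enorm_inv (by rw [Ne, measureReal_eq_zero_iff hv']; exact hv),
    Real.enorm_of_nonneg measureReal_nonneg, ofReal_measureReal hv']

end TraceAt

theorem stronglyMeasurable_setIntegral_ball {f : ℂ → ℝ} (hf : IntegrableOn f Ω) (r : ℝ) :
    StronglyMeasurable fun p => ∫ x in Ω ∩ Metric.ball p r, f x := by
  have hF := hf.aestronglyMeasurable
  have e : (fun p => ∫ x in Ω ∩ Metric.ball p r, f x)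
      = fun p => ∫ x in Ω,
        {q : ℂ × ℂ | dist q.2 q.1 < r}.indicator (fun q => hF.mk f q.2) (p, x) := by
    ext p
    have e1 : ∀ x, {q : ℂ × ℂ | dist q.2 q.1 < r}.indicator (fun q => hF.mk f q.2) (p, x)
        = (Metric.ball p r).indicator (hF.mk f) x := fun x => rfl
    simp only [e1]
    rw [integral_indicator measurableSet_ball, Measure.restrict_restrict measurableSet_ball,
      inter_comm]
    exact integral_congr_ae (ae_restrict_of_ae_restrict_of_subset inter_subset_right hF.ae_eq_mk)
  rw [e]
  refine StronglyMeasurable.integral_prod_right (f := fun p x =>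
    {q : ℂ × ℂ | dist q.2 q.1 < r}.indicator (fun q => hF.mk f q.2) (p, x)) ?_
  refine StronglyMeasurable.indicator (hF.stronglyMeasurable_mk.comp_measurable measurable_snd) ?_
  exact (isOpen_lt (by fun_prop) continuous_const).measurableSet

/-- The trace is the limit of means over half balls of radius `1 / (n + 1)`, which depend measurably
on the centre. -/
theorem IsC11.aestronglyMeasurable_trace (hΩ : IsC11 Ω) (hb : Bornology.IsBounded Ω) {f : ℂ → ℝ}
    (hf : MemH1 Ω f) : AEStronglyMeasurable (trace Ω f) (arcLength Ω) := by
  have hfin : IsFiniteMeasure (volume.restrict Ω) :=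
    ⟨by rw [Measure.restrict_apply_univ]; exact hb.measure_lt_top⟩
  have hfi : IntegrableOn f Ω := hf.1.integrable (by norm_num)
  refine aestronglyMeasurable_of_tendsto_ae atTop
    (f := fun (n : ℕ) p => ⨍ x in Ω ∩ Metric.ball p (1 / ((n : ℝ) + 1)), f x) (fun n => ?_) ?_
  · have h1 := stronglyMeasurable_setIntegral_ball hfi (1 / ((n : ℝ) + 1))
    have h2 := stronglyMeasurable_setIntegral_ball (Ω := Ω) (f := fun _ => 1)
      (integrable_const _) (1 / ((n : ℝ) + 1))
    simp only [setAverage_eq]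
    simp only [integral_const, measureReal_restrict_apply_univ, smul_eq_mul, mul_one] at h2
    exact ((h2.measurable.inv.stronglyMeasurable).smul h1).aestronglyMeasurable
  · have hmem : ∀ᵐ x ∂arcLength Ω, x ∈ frontier Ω :=
      ae_restrict_mem isClosed_frontier.measurableSet
    filter_upwards [hΩ.ae_exists_hasTraceAt hb hf, hmem] with x ⟨y, hy⟩ hx
    exact (hasTraceAt_trace hy).tendsto_average hΩ.1 hfi (frontier_subset_closure hx)

end Global

/-! ### Liftings and energies -/

section Energies

variable {Ω : Set ℂ} {u : ℂ → ℂ} {φ : ℂ → ℝ}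

theorem IsWeakDeriv.weakDeriv_spec {E : Type*} [NormedAddCommGroup E] [NormedSpace ℝ E] {v : ℂ}
    {f f' : ℂ → E} (h : IsWeakDeriv Ω v f f') : IsWeakDeriv Ω v f (weakDeriv Ω v f) :=
  Classical.epsilon_spec (p := IsWeakDeriv Ω v f) ⟨f', h⟩

theorem memLp_weakDeriv {E : Type*} [NormedAddCommGroup E] [NormedSpace ℝ E] [CompleteSpace E]
    (hΩ : IsOpen Ω) {v : ℂ} {f : ℂ → E}
    (h : ∃ f', IsWeakDeriv Ω v f f' ∧ MemLp f' 2 (volume.restrict Ω)) :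
    IsWeakDeriv Ω v f (weakDeriv Ω v f) ∧ MemLp (weakDeriv Ω v f) 2 (volume.restrict Ω) := by
  obtain ⟨f', h1, h2⟩ := h
  exact ⟨h1.weakDeriv_spec, (memLp_congr_ae (h1.ae_eq hΩ h1.weakDeriv_spec)).1 h2⟩

theorem MemH1.integrableOn_gradSq {E : Type*} [NormedAddCommGroup E] [NormedSpace ℝ E]
    [CompleteSpace E] (hΩ : IsOpen Ω) {f : ℂ → E} (h : MemH1 Ω f) :
    IntegrableOn (gradSq Ω f) Ω := by
  obtain ⟨-, h1, h2⟩ := h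
  have e1 := (memLp_weakDeriv hΩ h1).2
  have e2 := (memLp_weakDeriv hΩ h2).2
  exact ((memLp_two_iff_integrable_sq_norm e1.1).1 e1).add
    ((memLp_two_iff_integrable_sq_norm e2.1).1 e2)

theorem memH1_of_ae_eq_add_const (hb : Bornology.IsBounded Ω) (h : MemH1 Ω φ)
    {ψ : ℂ → ℝ} {c : ℝ} (hψ : ∀ᵐ x ∂volume.restrict Ω, ψ x = φ x + c) : MemH1 Ω ψ := by
  have hfin : IsFiniteMeasure (volume.restrict Ω) :=
    ⟨by rw [Measure.restrict_apply_univ]; exact hb.measure_lt_top⟩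
  have hψ' : (fun x => φ x - -c) =ᵐ[volume.restrict Ω] ψ := hψ.mono fun x hx => by
    rw [hx]
    exact sub_neg_eq_add _ _
  have hd : ∀ {v : ℂ} {f' : ℂ → ℝ}, IsWeakDeriv Ω v φ f' → IsWeakDeriv Ω v ψ f' := fun hf =>
    (hf.sub (isWeakDeriv_const (-c))).congr hψ' (Eventually.of_forall fun x => sub_zero _)
  obtain ⟨hL, ⟨f₁, h1, hL1⟩, f₂, h2, hL2⟩ := h
  exact ⟨(memLp_congr_ae hψ').1 (hL.sub (memLp_const _)), ⟨f₁, hd h1, hL1⟩, f₂, hd h2, hL2⟩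

/-- The lifting of `exists_lifting_loc` has gradient `Im (ū ∇u) ∈ L²`, hence is itself in `L²` up to
the boundary. -/
theorem IsBddSimplyConnectedC11.exists_isH1Lifting (hΩ : IsBddSimplyConnectedC11 Ω) (hu : MemH1 Ω u)
    (hu1 : ∀ᵐ x ∂volume.restrict Ω, ‖u x‖ = 1) : ∃ φ, IsH1Lifting Ω u φ := by
  obtain ⟨-, ⟨u₁, h1, hL1⟩, u₂, h2, hL2⟩ := hu
  obtain ⟨φ, hφ1, hφ2, hφu, hloc⟩ := exists_lifting_loc hΩ.isC11.1 hΩ.bounded hΩ.simplyConnected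
    h1 h2 hu1 hL1 hL2
  have hm := h1.1.aestronglyMeasurable
  have hF1 := memLp_im_conj_mul hm hu1 hL1
  have hF2 := memLp_im_conj_mul hm hu1 hL2
  exact ⟨φ, ⟨hΩ.isC11.memLp_two hΩ.bounded hφ1 hφ2 hF1 hF2 hloc, ⟨_, hφ1, hF1⟩, _, hφ2, hF2⟩, hφu⟩

/-- Two liftings have the same gradient `-i ū ∇u`, hence differ by a constant. -/
theorem IsH1Lifting.exists_eq_add (hΩ : IsOpen Ω) (hsc : IsSimplyConnected Ω) (hu : MemH1 Ω u)
    (hu1 : ∀ᵐ x ∂volume.restrict Ω, ‖u x‖ = 1) {ψ : ℂ → ℝ} (hφ : IsH1Lifting Ω u φ)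
    (hψ : IsH1Lifting Ω u ψ) :
    ∃ k : ℤ, ∀ᵐ x ∂volume.restrict Ω, ψ x = φ x + 2 * Real.pi * k := by
  have hd : ∀ {v : ℂ} {u' : ℂ → ℂ} {φ' ψ' : ℂ → ℝ}, IsWeakDeriv Ω v u u' → IsWeakDeriv Ω v φ φ' →
      IsWeakDeriv Ω v ψ ψ' → IsWeakDeriv Ω v (fun x => ψ x - φ x) fun _ => 0 := by
    intro v u' φ' ψ' h h1 h2
    refine (h2.sub h1).congr EventuallyEq.rfl ?_
    filter_upwards [ae_eq_of_eq_exp hΩ h h1 hφ.2, ae_eq_of_eq_exp hΩ h h2 hψ.2, hu1]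
      with x e1 e2 e3
    have hne : u x ≠ 0 := norm_ne_zero_iff.1 (by rw [e3]; exact one_ne_zero)
    rw [e1] at e2
    have e4 := mul_left_cancel₀ Complex.I_ne_zero (mul_left_cancel₀ hne e2)
    rw [Complex.ofReal_inj.1 e4, sub_self]
  obtain ⟨-, ⟨u₁, h1, -⟩, u₂, h2, -⟩ := hu
  obtain ⟨-, ⟨φ₁, hφ1, -⟩, φ₂, hφ2, -⟩ := hφ.1
  obtain ⟨-, ⟨ψ₁, hψ1, -⟩, ψ₂, hψ2, -⟩ := hψ.1
  obtain ⟨c, hc⟩ := exists_ae_eq_const hΩ hsc.isPathConnected.isConnected.isPreconnected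
    (hd h1 hφ1 hψ1) (hd h2 hφ2 hψ2)
  have hne : (ae (volume.restrict Ω)).NeBot := by
    rw [ae_neBot, Ne, Measure.restrict_eq_zero]
    exact (hΩ.measure_pos volume hsc.nonempty).ne'
  obtain ⟨x, hx, hxφ, hxψ⟩ := (hc.and (hφ.2.and hψ.2)).exists
  have hexp : Complex.exp (Complex.I * c) = 1 := by
    rw [← hx, Complex.ofReal_sub, mul_sub, Complex.exp_sub, ← hxφ, ← hxψ, div_self]
    rw [hxφ]
    exact Complex.exp_ne_zero _
  obtain ⟨k, hk⟩ := Complex.exp_eq_one_iff.1 hexp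
  have hck : c = 2 * Real.pi * k := by
    have := congrArg Complex.im hk
    simp only [Complex.mul_im, Complex.I_re, Complex.I_im, Complex.ofReal_re,
      Complex.ofReal_im] at this
    simpa [mul_comm] using this
  refine ⟨k, hc.mono fun x hx => ?_⟩
  rw [← hck, ← hx]
  ring

theorem IsH1Lifting.add_const (hb : Bornology.IsBounded Ω)
    (hφ : IsH1Lifting Ω u φ) {ψ : ℂ → ℝ} {k : ℤ}
    (h : ∀ᵐ x ∂volume.restrict Ω, ψ x = φ x + 2 * Real.pi * k) : IsH1Lifting Ω u ψ := by
  refine ⟨memH1_of_ae_eq_add_const hb hφ.1 h, ?_⟩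
  filter_upwards [h, hφ.2] with x h1 h2
  have e : Complex.I * ((φ x + 2 * Real.pi * k : ℝ) : ℂ)
      = Complex.I * φ x + k * (2 * Real.pi * Complex.I) := by
    push_cast
    ring
  rw [h1, h2, e, Complex.exp_add, Complex.exp_int_mul_two_pi_mul_I, mul_one]

theorem IsH1Lifting.gradSq_eq (hΩ : IsOpen Ω) (hu : MemH1 Ω u) (hφ : IsH1Lifting Ω u φ) :
    gradSq Ω u =ᵐ[volume.restrict Ω] gradSq Ω φ := by
  obtain ⟨-, h1, h2⟩ := hu
  obtain ⟨-, hφ1, hφ2⟩ := hφ.1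
  filter_upwards [ae_eq_of_eq_exp hΩ (memLp_weakDeriv hΩ h1).1 (memLp_weakDeriv hΩ hφ1).1 hφ.2,
    ae_eq_of_eq_exp hΩ (memLp_weakDeriv hΩ h2).1 (memLp_weakDeriv hΩ hφ2).1 hφ.2, hφ.2]
    with x e1 e2 e3
  rw [gradSq, gradSq, e1, e2, e3]
  simp only [norm_mul, norm_exp_I_mul, Complex.norm_I, one_mul, Complex.norm_real]

/-- The traces of `φ` exist almost everywhere on the boundary, and the trace of `e^{iφ}` is `e^{iφ}`
for the trace of `φ`. -/
theorem IsH1Lifting.trace_eq (hΩ : IsC11 Ω) (hb : Bornology.IsBounded Ω) (hu : MemH1 Ω u)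
    (hφ : IsH1Lifting Ω u φ) : ∀ᵐ x ∂arcLength Ω, HasTraceAt Ω φ x (trace Ω φ x) ∧
      HasTraceAt Ω u x (trace Ω u x) ∧
      trace Ω u x = Complex.exp (Complex.I * trace Ω φ x) := by
  have hmem : ∀ᵐ x ∂arcLength Ω, x ∈ frontier Ω :=
    ae_restrict_mem isClosed_frontier.measurableSet
  filter_upwards [hΩ.ae_exists_hasTraceAt hb hφ.1, hmem] with x ⟨y, hy⟩ hx
  have h1 := hasTraceAt_trace hy
  have h2 := h1.exp_I_mul hφ.2
  have h3 := hasTraceAt_trace h2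
  exact ⟨h1, h3, h3.unique hΩ.1 hu.1.1 (frontier_subset_closure hx) h2⟩

/-- If `e^{ig} = i n`, then the component of `e^{iθ}` along `n` is `± sin (θ - g)`. -/
theorem inner_exp_sq_eq_sin_sq {θ g : ℝ} {n : ℂ}
    (h : Complex.exp (Complex.I * g) = Complex.I * n) :
    (inner ℝ (Complex.exp (Complex.I * θ)) n) ^ 2 = Real.sin (θ - g) ^ 2 := by
  have hn : n = -Complex.I * Complex.exp (Complex.I * g) := by
    rw [h, ← mul_assoc, neg_mul, Complex.I_mul_I, neg_neg, one_mul]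
  have he : ∀ t : ℝ, Complex.exp (Complex.I * t) = ⟨Real.cos t, Real.sin t⟩ := fun t => by
    rw [mul_comm]
    apply Complex.ext
    · rw [Complex.exp_ofReal_mul_I_re]
    · rw [Complex.exp_ofReal_mul_I_im]
  rw [hn, Complex.inner, he, he, Real.sin_sub]
  simp
  ring

theorem integrable_inner_trace_sq (hΩ : IsC11 Ω) (hb : Bornology.IsBounded Ω) (hu : MemH1 Ω u)
    (hφ : IsH1Lifting Ω u φ) :
    Integrable (fun x => (inner ℝ (trace Ω u x) (outerNormal Ω x)) ^ 2) (arcLength Ω) := by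
  have hfin := isFiniteMeasure_arcLength hΩ hb
  have hν : AEStronglyMeasurable (outerNormal Ω) (arcLength Ω) :=
    hΩ.continuousOn_outerNormal.aestronglyMeasurable isClosed_frontier.measurableSet
  have hmem : ∀ᵐ x ∂arcLength Ω, x ∈ frontier Ω :=
    ae_restrict_mem isClosed_frontier.measurableSet
  have htr := hφ.trace_eq hΩ hb hu
  have htm : AEStronglyMeasurable (trace Ω u) (arcLength Ω) :=
    (continuous_exp_I_mul.comp_aestronglyMeasurable (hΩ.aestronglyMeasurable_trace hb hφ.1)).congr
      (htr.mono fun x hx => hx.2.2.symm)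
  refine Integrable.of_bound ((htm.inner hν).pow 2) 1 ?_
  filter_upwards [htr, hmem] with x hx hxf
  have h1 := abs_real_inner_le_norm (trace Ω u x) (outerNormal Ω x)
  rw [hx.2.2, norm_exp_I_mul, hΩ.norm_outerNormal hxf, one_mul, ← hx.2.2] at h1
  rw [norm_pow, Real.norm_eq_abs]
  exact pow_le_one₀ (abs_nonneg _) h1

theorem integrableOn_inner (hb : Bornology.IsBounded Ω)
    (hu : MemH1 Ω u) (h : ℂ) : IntegrableOn (fun x => inner ℝ h (u x)) Ω := by
  have hfin : IsFiniteMeasure (volume.restrict Ω) :=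
    ⟨by rw [Measure.restrict_apply_univ]; exact hb.measure_lt_top⟩
  exact (hu.1.integrable (by norm_num)).const_inner h

/-- The traces of `u` are obtained from those of a lifting. -/
theorem vortexEnergyDefined (hΩ : IsBddSimplyConnectedC11 Ω) (hu : MemH1 Ω u)
    (hu1 : ∀ᵐ x ∂volume.restrict Ω, ‖u x‖ = 1) (h : ℂ) : VortexEnergyDefined Ω h u := by
  obtain ⟨φ, hφ⟩ := IsBddSimplyConnectedC11.exists_isH1Lifting hΩ hu hu1
  refine ⟨(hφ.trace_eq hΩ.isC11 hΩ.bounded hu).mono fun x hx => hx.2.1,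
    hu.integrableOn_gradSq hΩ.isC11.1, ?_, integrable_inner_trace_sq hΩ.isC11 hΩ.bounded hu hφ,
    integrableOn_inner hΩ.bounded hu h⟩
  refine (integrable_zero ℂ ℝ (volume.restrict Ω)).congr ?_
  filter_upwards [hu1] with x hx
  rw [hx]
  norm_num

variable {g : ℂ → ℝ}

theorem ae_inner_trace_sq_eq (hΩ : IsC11 Ω) (hb : Bornology.IsBounded Ω) (hu : MemH1 Ω u)
    (hφ : IsH1Lifting Ω u φ) (hg : IsTangentLifting Ω g) :
    (fun x => (inner ℝ (trace Ω u x) (outerNormal Ω x)) ^ 2)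
      =ᵐ[arcLength Ω] fun x => Real.sin (trace Ω φ x - g x) ^ 2 := by
  filter_upwards [hφ.trace_eq hΩ hb hu, hg] with x h1 h2
  rw [h1.2.2, inner_exp_sq_eq_sin_sq h2]

theorem ae_inner_eq (hφ : IsH1Lifting Ω u φ) (h : ℂ) : (fun x => inner ℝ h (u x))
    =ᵐ[volume.restrict Ω] fun x => inner ℝ h (Complex.exp (Complex.I * φ x)) :=
  hφ.2.mono fun x hx => by simp only [hx]

theorem IsH1Lifting.liftedEnergyDefined (hΩ : IsBddSimplyConnectedC11 Ω) (hu : MemH1 Ω u)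
    (hφ : IsH1Lifting Ω u φ) (hg : IsTangentLifting Ω g) (h : ℂ) : LiftedEnergyDefined Ω g h φ :=
  ⟨(hφ.trace_eq hΩ.isC11 hΩ.bounded hu).mono fun _ hx => hx.1,
    hφ.1.integrableOn_gradSq hΩ.isC11.1,
    (integrable_inner_trace_sq hΩ.isC11 hΩ.bounded hu hφ).congr
      (ae_inner_trace_sq_eq hΩ.isC11 hΩ.bounded hu hφ hg),
    (integrableOn_inner hΩ.bounded hu h).congr (ae_inner_eq hφ h)⟩

theorem IsH1Lifting.vortexEnergy_eq (hΩ : IsBddSimplyConnectedC11 Ω) (hu : MemH1 Ω u)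
    (hu1 : ∀ᵐ x ∂volume.restrict Ω, ‖u x‖ = 1) (hφ : IsH1Lifting Ω u φ)
    (hg : IsTangentLifting Ω g) (h : ℂ) (ε η : ℝ) :
    vortexEnergy Ω ε η h u = liftedEnergy Ω g ε h φ := by
  have hpot : ∫ x in Ω, (1 - ‖u x‖ ^ 2) ^ 2 = 0 := by
    refine integral_eq_zero_of_ae ?_
    filter_upwards [hu1] with x hx
    simp [hx]
  rw [vortexEnergy, liftedEnergy, hpot, mul_zero, add_zero,
    integral_congr_ae (hφ.gradSq_eq hΩ.isC11.1 hu), integral_congr_ae (ae_inner_eq hφ h),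
    integral_congr_ae (ae_inner_trace_sq_eq hΩ.isC11 hΩ.bounded hu hφ hg)]

end Energies

end Micromagnetics

theorem mainTheorem6 (Ω : Set ℂ) (hΩ : Micromagnetics.IsBddSimplyConnectedC11 Ω)
    (u : ℂ → ℂ) (hu : Micromagnetics.MemH1 Ω u)
    (hu1 : ∀ᵐ x ∂volume.restrict Ω, ‖u x‖ = 1) :
    (∃ φ : ℂ → ℝ, Micromagnetics.IsH1Lifting Ω u φ ∧
      ∀ ψ : ℂ → ℝ, Micromagnetics.IsH1Lifting Ω u ψ ↔
        ∃ k : ℤ, ∀ᵐ x ∂volume.restrict Ω, ψ x = φ x + 2 * Real.pi * k) ∧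
    (∀ h : ℂ, Micromagnetics.VortexEnergyDefined Ω h u) ∧
    ∀ φ : ℂ → ℝ, Micromagnetics.IsH1Lifting Ω u φ →
      ∀ g : ℂ → ℝ, Micromagnetics.IsTangentLifting Ω g →
        ∀ h : ℂ, Micromagnetics.LiftedEnergyDefined Ω g h φ ∧
          ∀ ε η : ℝ, 0 < ε → 0 < η →
            Micromagnetics.vortexEnergy Ω ε η h u = Micromagnetics.liftedEnergy Ω g ε h φ := by
  refine ⟨?_, fun h => Micromagnetics.vortexEnergyDefined hΩ hu hu1 h,
    fun φ hφ g hg h => ⟨hφ.liftedEnergyDefined hΩ hu hg h,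
      fun ε η _ _ => hφ.vortexEnergy_eq hΩ hu hu1 hg h ε η⟩⟩
  obtain ⟨φ, hφ⟩ := Micromagnetics.IsBddSimplyConnectedC11.exists_isH1Lifting hΩ hu hu1
  exact ⟨φ, hφ, fun ψ =>
    ⟨fun hψ => hφ.exists_eq_add hΩ.isC11.1 hΩ.simplyConnected hu hu1 hψ,
      fun ⟨_, hk⟩ => hφ.add_const hΩ.bounded hk⟩⟩
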